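/- **Notation.** For measurable $S\subset[0,1]^2$, $F\in L^1([0,1]^2)$ and $x\in\mathbb R^3$ let $$E_SF(x)=\int_S F(\xi)\,e^{2\pi i(\xi,|\xi|^2)\cdot x}\,d\xi,\qquad EF=E_{[0,1]^2}F .$$ Let $R=n^2$ with $n\ge 1$ an integer, and let $\mathcal Q_R$ be the set of the $R$ squares $[\frac{i}{\sqrt R},\frac{i+1}{\sqrt R}]\times[\frac{j}{\sqrt R},\frac{j+1}{\sqrt R}]$, $0\le i,j<\sqrt R$. For a positive integer $M$, an $M$-set is a union of $M$ squares of $\mathcal Q_R$. Fix $W>3$, and for a ball $B$ of radius $R$ centred at $c\in\mathbb R^3$ put $w_B(x)=(1+|x-c|/R)^{-W}$, and $\|f\|_{L^p(w_B)}^p=\int_{\mathbb R^3}|f|^pw_B$. For $\beta\in[0,1)$, let $A$ be a set of pairs $(R,M)$ with $R$ the square of a positive integer, $M\mid R$, and $aR^\beta\le M\le bR^\beta$ for constants $a,b>0$ depending only on $A$ (in short, $M\sim R^\beta$ on $A$). We say that large ensemble $l^p$ decoupling holds on $A$ if for every $\varepsilon>0$ there is a constant $K$ such that $$\|EF\|_{L^p(B)}^p\le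 K R^\varepsilon\Big(\frac RM\Big)^{\frac p2-1}\sum_{j=1}^{R/M}\|E_{P_j}F\|_{L^p(w_B)}^p\qquad(*)$$ for all $(R,M)\in A$, all partitions of $\mathcal Q_R$ into $M$-sets $P_1,\dots,P_{R/M}$, all balls $B\subset\mathbb R^3$ of radius $R$ and all $F\in L^1([0,1]^2)$. **Corollary.** Let $3<p\le4$. 1. Let $A$ be such a set with $M\sim R^{\frac{4-p}{p-2}}$, and assume that its scales are those of all sizes $\ge1$, up to a constant: there is $D$ such that for every real $r\ge1$ some $(R,M)\in A$ has $r\le R\le Dr$. If large ensemble $l^p$ decoupling holds on $A$, then the restriction conjecture for the paraboloid holds in $L^p$: for every $\varepsilon>0$ there is a constant $K$ such that $$\int_{B}|EF|^p\le K R^\varepsilon\|F\|_\infty^p$$ for all real $R\ge1$, all balls $B\subset\mathbb R^3$ of radius $\sqrt R$ and all $F\in L^\infty([0,1]^2)$. 2. Let $\Delta>0$ with $\frac{4-p}{p-2}+\Delta<1$, and let $A$ be such a set with $M\sim R^{\frac{4-p}{p-2}+\Delta}$ that contains pairs with arbitrarily large $R$. Then large ensemble $l^p$ decoupling fails on $A$: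 there is $\varepsilon>0$ such that for every $K$, $(*)$ is false for some $(R,M)\in A$, some partition of $\mathcal Q_R$ into $M$-sets, some ball $B$ of radius $R$ and some $F\in L^1([0,1]^2)$. -/

import Mathlib

open MeasureTheory

namespace LargeEnsemble

noncomputable section

/-- The unit square `[0,1]²` of the frequency plane. -/
def unitSquare : Set (EuclideanSpace ℝ (Fin 2)) :=
  {ξ | ∀ i, ξ i ∈ Set.Icc (0 : ℝ) 1}

/-- The extension operator of the paraboloid,
`E_S F (x) = ∫_S F(ξ) e((ξ, |ξ|²) · x) dξ`, where `e(t) = exp(2πit)`. -/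
def extension (S : Set (EuclideanSpace ℝ (Fin 2))) (F : EuclideanSpace ℝ (Fin 2) → ℂ)
    (x : EuclideanSpace ℝ (Fin 3)) : ℂ :=
  ∫ ξ in S, F ξ * Complex.exp (2 * Real.pi * Complex.I *
    ((ξ 0 * x 0 + ξ 1 * x 1 + ‖ξ‖ ^ 2 * x 2 : ℝ) : ℂ))

/-- The canonical squares at scale `R = n²`: the square of side `1/√R = 1/n` with
lower left corner `(j 0 / n, j 1 / n)`. There are `n² = R` of them, and they tile `[0,1]²`. -/
def canonicalSquare (n : ℕ) (j : Fin 2 → Fin n) : Set (EuclideanSpace ℝ (Fin 2)) :=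
  {ξ | ∀ i, ξ i ∈ Set.Icc (((j i : ℕ) : ℝ) / n) ((((j i : ℕ) : ℝ) + 1) / n)}

/-- The subset of `[0,1]²` covered by a collection of canonical squares. -/
def ensemble (n : ℕ) (P : Finset (Fin 2 → Fin n)) : Set (EuclideanSpace ℝ (Fin 2)) :=
  ⋃ j ∈ P, canonicalSquare n j

/-- The weight `(1 + |x - c| / R)^{-W}`, which replaces the sharp cutoff to the ball of radius `R`
and centre `c` on the right hand side of a decoupling inequality. -/
def ballWeight (W R : ℝ) (c x : EuclideanSpace ℝ (Fin 3)) : ℝ :=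
  (1 + dist x c / R) ^ (-W)

/-- `A` is a set of pairs `(n, M)`, standing for the scale `R = n²` and the size `M`, such that
`M` divides `R` (so that the `R` canonical squares can be partitioned into `R / M` sets of
size `M`), and `M ∼ R ^ β`. -/
def IsScaleFamily (β : ℝ) (A : Set (ℕ × ℕ)) : Prop :=
  (∀ q ∈ A, 1 ≤ q.1 ∧ q.2 ∣ q.1 ^ 2) ∧
  ∃ a b : ℝ, 0 < a ∧ 0 < b ∧ ∀ q ∈ A,
    a * ((q.1 : ℝ) ^ 2) ^ β ≤ (q.2 : ℝ) ∧ (q.2 : ℝ) ≤ b * ((q.1 : ℝ) ^ 2) ^ β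

/-- Large ensemble `l^p` decoupling for the scales and sizes `(n, M) ∈ A`, with `R = n²`:
for every `ε > 0` there is a constant `K` such that
`‖EF‖_{L^p(B)}^p ≤ K R^ε (R/M)^{p/2-1} ∑_{P ∈ pt} ‖E_P F‖_{L^p(w_B)}^p`
for all `(n, M) ∈ A`, all partitions `pt` of the canonical squares into sets of `M` squares,
all balls `B` of radius `R`, and all `F`. -/
def Decoupling (W p : ℝ) (A : Set (ℕ × ℕ)) : Prop :=
  ∀ ε : ℝ, 0 < ε → ∃ K : ℝ, ∀ n M : ℕ, (n, M) ∈ A →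
    ∀ pt : Finpartition (Finset.univ : Finset (Fin 2 → Fin n)),
      (∀ P ∈ pt.parts, P.card = M) →
    ∀ (c : EuclideanSpace ℝ (Fin 3)) (F : EuclideanSpace ℝ (Fin 2) → ℂ),
      IntegrableOn F unitSquare →
      ∫ x in Metric.ball c ((n : ℝ) ^ 2), ‖extension unitSquare F x‖ ^ p
        ≤ K * ((n : ℝ) ^ 2) ^ ε * ((n : ℝ) ^ 2 / (M : ℝ)) ^ (p / 2 - 1) *
          ∑ P ∈ pt.parts,
            ∫ x, ‖extension (ensemble n P) F x‖ ^ p * ballWeight W ((n : ℝ) ^ 2) c x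

/-- The restriction conjecture for the paraboloid in `L^p`: for every `ε > 0` there is `K` with
`∫_B |EF|^p ≤ K R^ε ‖F‖_∞^p` for all `R ≥ 1`, all balls `B` of radius `√R`, and all bounded
`F` on `[0,1]²`. -/
def RestrictionConjecture (p : ℝ) : Prop :=
  ∀ ε : ℝ, 0 < ε → ∃ K : ℝ, ∀ R : ℝ, 1 ≤ R →
    ∀ (c : EuclideanSpace ℝ (Fin 3)) (F : EuclideanSpace ℝ (Fin 2) → ℂ),
      MemLp F ⊤ (volume.restrict unitSquare) →
      ∫ x in Metric.ball c (Real.sqrt R), ‖extension unitSquare F x‖ ^ p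
        ≤ K * R ^ ε * (eLpNorm F ⊤ (volume.restrict unitSquare)).toReal ^ p

end

end LargeEnsemble

/-! The proof averages the decoupling inequality over random partitions. Split the `n² = M L`
squares into `M` groups of `L`, shift each group cyclically by an independent uniform amount, and
let the `j`-th part collect the `j`-th element of every shifted group. Each part is then a random
set containing one uniformly chosen square from every group. Take a step function `F` with `|F| ≤
1`. At a fixed point, `E_{P_j} F` is a sum of `M` independent terms with mean `EF / L`, each of size
at most `n⁻²`. A Rosenthal bound (`moment_bound`, `sum_shifts_le`) controls its `p`-th moment by
`L^{-p} |EF|^p + L^{-p/2} S^{p/2} + n^{4-2p} L⁻¹ S`, where `S` majorizes the square function `∑ |E_θ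
1|²` over the squares `θ`.

Summing over the `L` parts and inserting the decoupling factor `L^{p/2-1}` bounds `∫ |EF|^p` by `K
R^ε` times `L^{-p/2} ∫ |EF|^p + ∫ S^{p/2} + L^{p/2-1} n^{4-2p} ∫ S`, with weights
(`step_inequality`). The square function is harmless: `∫ S ≲ n²`, and `∫ S^{p/2} ≲ n^{3-p}` because
`p > 3`. The first term is absorbed into the left side, since a small power `R^ε` cannot compensate
`L^{-p/2}` (`step_bound`). On balls of radius `n²` there remains `∫ |EF|^p ≲ n^{2ε} (n^{3-p} +
L^{p/2-1} n^{6-2p})`. If `M ∼ R^β` with `β = (4-p)/(p-2) + Δ`, then `L ∼ n^{2(1-β)}` and the last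
term is of order `n^{-Δ(p-2)}` (`family_bound`). The critical exponent is the one for which it has
order one.

If `Δ > 0`, the bound tends to zero for small `ε`, whereas `|E1| ≥ 1/2` near the origin: decoupling
fails. If `Δ = 0`, the bound is the restriction estimate for step functions. It passes to all
bounded functions on balls of radius `r` much smaller than `n`: there the phase is nearly constant
on each square, so only averages over squares matter. `integral_extension_le_of_step` makes this
rigorous by a second absorption argument, over a class of perturbed phases. -/

namespace LargeEnsemble

/-! ### Moments of sums of independent variables -/

/-- Peeling off the first coordinate of a sum over all choice functions. -/
lemma sum_fin_cons {k L : ℕ} {E : Type*} [AddCommMonoid E] (f : (Fin (k + 1) → Fin L) → E) :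
    ∑ s, f s = ∑ l : Fin L, ∑ s : Fin k → Fin L, f (Fin.cons l s) := by
  rw [← Fintype.sum_prod_type']
  exact (Equiv.sum_comp (Fin.consEquiv fun _ : Fin (k + 1) ↦ Fin L) f).symm

/-- Only the square of the real inner product is estimated, by Cauchy–Schwarz. The terms linear in
it are kept exactly, since they average to zero when the variables are centred. -/
lemma norm_add_pow_four_le (z w : ℂ) :
    ‖z + w‖ ^ 4 ≤ ‖z‖ ^ 4 + 6 * (‖z‖ ^ 2 * ‖w‖ ^ 2) + ‖w‖ ^ 4 +
      4 * ‖z‖ ^ 2 * (z.re * w.re + z.im * w.im) + 4 * ‖w‖ ^ 2 * (z.re * w.re + z.im * w.im) := by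
  have e : ∀ u : ℂ, ‖u‖ ^ 4 = (u.re ^ 2 + u.im ^ 2) ^ 2 := by
    intro u
    rw [show ‖u‖ ^ 4 = (‖u‖ ^ 2) ^ 2 by ring, Complex.sq_norm, Complex.normSq_apply]; ring
  have e2 : ∀ u : ℂ, ‖u‖ ^ 2 = u.re ^ 2 + u.im ^ 2 := by
    intro u; rw [Complex.sq_norm, Complex.normSq_apply]; ring
  rw [e, e, e, e2, e2]
  simp only [Complex.add_re, Complex.add_im]
  nlinarith [sq_nonneg (z.re * w.im - z.im * w.re)]

lemma norm_add_sq_expand (z w : ℂ) :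
    ‖z + w‖ ^ 2 = ‖z‖ ^ 2 + ‖w‖ ^ 2 + 2 * (z.re * w.re + z.im * w.im) := by
  have e2 : ∀ u : ℂ, ‖u‖ ^ 2 = u.re ^ 2 + u.im ^ 2 := by
    intro u; rw [Complex.sq_norm, Complex.normSq_apply]; ring
  rw [e2, e2, e2]
  simp only [Complex.add_re, Complex.add_im]
  ring

/-- Moments of a sum of independent centred variables, the `g`-th of which is uniform on the
values `y g l`. -/
lemma centred_moments (L : ℕ) (hL : 0 < L) : ∀ (k : ℕ) (y : Fin k → Fin L → ℂ),
    (∀ g, ∑ l, y g l = 0) →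
    (∑ s : Fin k → Fin L, ∑ g, y g (s g) = 0) ∧
    (∑ s : Fin k → Fin L, ‖∑ g, y g (s g)‖ ^ 2 = (L : ℝ) ^ k * (∑ g, ∑ l, ‖y g l‖ ^ 2 / L)) ∧
    (∑ s : Fin k → Fin L, ‖∑ g, y g (s g)‖ ^ 4 ≤
      (L : ℝ) ^ k * (3 * (∑ g, ∑ l, ‖y g l‖ ^ 2 / L) ^ 2 + ∑ g, ∑ l, ‖y g l‖ ^ 4 / L)) := by
  have hL' : (L : ℝ) ≠ 0 := by positivity
  intro k
  induction k with
  | zero => intro y _; simp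
  | succ k ih =>
    intro y hy
    obtain ⟨h1, h2, h4⟩ := ih (fun g ↦ y g.succ) (fun g ↦ hy g.succ)
    have hre : ∑ l, (y 0 l).re = 0 := by rw [← Complex.re_sum, hy]; rfl
    have him : ∑ l, (y 0 l).im = 0 := by rw [← Complex.im_sum, hy]; rfl
    set Z : (Fin k → Fin L) → ℂ := fun s ↦ ∑ g : Fin k, y g.succ (s g) with hZ
    have hZre : ∑ s, (Z s).re = 0 := by rw [← Complex.re_sum, h1]; rfl
    have hZim : ∑ s, (Z s).im = 0 := by rw [← Complex.im_sum, h1]; rfl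
    have hexp : ∀ (l : Fin L) (s : Fin k → Fin L),
        ∑ g, y g ((Fin.cons l s : Fin (k + 1) → Fin L) g) = Z s + y 0 l := by
      intro l s
      rw [Fin.sum_univ_succ, add_comm]; simp [hZ]
    set v : ℝ := ∑ g : Fin k, ∑ l, ‖y g.succ l‖ ^ 2 / L with hv
    set q : ℝ := ∑ g : Fin k, ∑ l, ‖y g.succ l‖ ^ 4 / L with hq
    set v0 : ℝ := ∑ l, ‖y 0 l‖ ^ 2 / L with hv0
    set q0 : ℝ := ∑ l, ‖y 0 l‖ ^ 4 / L with hq0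
    have ev0 : ∑ l, ‖y 0 l‖ ^ 2 = L * v0 := by
      rw [hv0, ← Finset.sum_div]; field_simp
    have eq0 : ∑ l, ‖y 0 l‖ ^ 4 = L * q0 := by
      rw [hq0, ← Finset.sum_div]; field_simp
    -- Independence and centring: a term linear in the new variable has mean zero, whatever function
    -- of the old ones multiplies it. `cross'` exchanges the roles.
    have cross : ∀ (f : (Fin k → Fin L) → ℝ),
        ∑ l, ∑ s, f s * ((Z s).re * (y 0 l).re + (Z s).im * (y 0 l).im) = 0 := by
      intro f
      rw [Finset.sum_comm]
      refine Finset.sum_eq_zero fun s _ ↦ ?_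
      rw [← Finset.mul_sum, Finset.sum_add_distrib, ← Finset.mul_sum, ← Finset.mul_sum, hre, him]
      simp
    have cross' : ∀ (f : Fin L → ℝ),
        ∑ l, ∑ s, f l * ((Z s).re * (y 0 l).re + (Z s).im * (y 0 l).im) = 0 := by
      intro f
      refine Finset.sum_eq_zero fun l _ ↦ ?_
      rw [← Finset.mul_sum, Finset.sum_add_distrib, ← Finset.sum_mul, ← Finset.sum_mul, hZre, hZim]
      simp
    have hv0n : 0 ≤ v0 := by positivity
    refine ⟨?_, ?_, ?_⟩
    · rw [sum_fin_cons]
      simp_rw [hexp, Finset.sum_add_distrib]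
      simp [h1, ← Finset.mul_sum, hy]
    · rw [sum_fin_cons, Fin.sum_univ_succ]
      simp_rw [hexp, norm_add_sq_expand, Finset.sum_add_distrib]
      have := cross (fun _ ↦ 2)
      rw [this, h2]
      simp only [Finset.sum_const, Finset.card_univ, Fintype.card_fun, Fintype.card_fin,
        nsmul_eq_mul, ← Finset.mul_sum, ev0]
      push_cast
      ring
    · rw [sum_fin_cons, Fin.sum_univ_succ, Fin.sum_univ_succ]
      simp_rw [hexp]
      calc ∑ l, ∑ s, ‖Z s + y 0 l‖ ^ 4 ≤ ∑ l, ∑ s, (‖Z s‖ ^ 4 + 6 * (‖Z s‖ ^ 2 * ‖y 0 l‖ ^ 2)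
            + ‖y 0 l‖ ^ 4 + 4 * ‖Z s‖ ^ 2 * ((Z s).re * (y 0 l).re + (Z s).im * (y 0 l).im)
            + 4 * ‖y 0 l‖ ^ 2 * ((Z s).re * (y 0 l).re + (Z s).im * (y 0 l).im)) := by
            gcongr with l _ s _
            exact norm_add_pow_four_le _ _
        _ = L * ∑ s, ‖Z s‖ ^ 4 + 6 * ((∑ s, ‖Z s‖ ^ 2) * (L * v0)) + (L : ℝ) ^ k * (L * q0) := by
            have c1 := cross (fun s ↦ 4 * ‖Z s‖ ^ 2)
            have c2 := cross' (fun l ↦ 4 * ‖y 0 l‖ ^ 2)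
            rw [← ev0, ← eq0, Finset.sum_mul_sum, Finset.sum_comm (s := Finset.univ (α := Fin k → _))]
            simp only [Finset.sum_add_distrib]
            rw [c1, c2, add_zero, add_zero]
            simp only [← Finset.mul_sum]
            simp [Finset.mul_sum]
        _ ≤ L * ((L : ℝ) ^ k * (3 * v ^ 2 + q)) + 6 * (((L : ℝ) ^ k * v) * (L * v0))
            + (L : ℝ) ^ k * (L * q0) := by rw [h2]; gcongr
        -- The mixed term `6 v v0` is exactly the cross term of `3 (v0 + v)²`, which fixes the
        -- constant 3.
        _ ≤ (L : ℝ) ^ (k + 1) * (3 * (v0 + v) ^ 2 + (q0 + q)) := by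
            have : 0 ≤ (L : ℝ) ^ (k + 1) * (3 * v0 ^ 2) := by positivity
            ring_nf at this ⊢
            linarith

/-- One of the two terms suffices according as `z ≤ lam` or `z ≥ lam`. This reduces the `p`-th
moment to the second and fourth, with a threshold still to be chosen. -/
lemma rpow_le_two_add_four {p lam z : ℝ} (hp2 : 2 ≤ p) (hp4 : p ≤ 4) (hlam : 0 < lam)
    (hz : 0 ≤ z) : z ^ p ≤ lam ^ (p - 2) * z ^ 2 + lam ^ (p - 4) * z ^ 4 := by
  rcases hz.eq_or_lt with rfl | hz'
  · rw [Real.zero_rpow (by linarith)]; simp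
  rcases le_total z lam with h | h
  · have e : z ^ p = z ^ (p - 2) * z ^ 2 := by
      rw [← Real.rpow_natCast z 2, ← Real.rpow_add hz']; congr 1; push_cast; ring
    rw [e]
    have : z ^ (p - 2) ≤ lam ^ (p - 2) := Real.rpow_le_rpow hz h (by linarith)
    have : 0 ≤ lam ^ (p - 4) * z ^ 4 := by positivity
    nlinarith [sq_nonneg z, mul_le_mul_of_nonneg_right ‹z ^ (p-2) ≤ _› (sq_nonneg z)]
  · have e : z ^ p = z ^ (p - 4) * z ^ 4 := by
      rw [← Real.rpow_natCast z 4, ← Real.rpow_add hz']; congr 1; push_cast; ring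
    rw [e]
    have h1 : z ^ (p - 4) ≤ lam ^ (p - 4) :=
      Real.rpow_le_rpow_of_nonpos hlam h (by linarith)
    have : 0 ≤ lam ^ (p - 2) * z ^ 2 := by positivity
    have := mul_le_mul_of_nonneg_right h1 (by positivity : 0 ≤ z ^ 4)
    linarith

lemma add_rpow_le_two_rpow {p a b : ℝ} (hp : 1 ≤ p) (ha : 0 ≤ a) (hb : 0 ≤ b) :
    (a + b) ^ p ≤ 2 ^ (p - 1) * (a ^ p + b ^ p) :=
  by
  lift a to NNReal using ha
  lift b to NNReal using hb
  exact_mod_cast NNReal.rpow_add_le_mul_rpow_add_rpow a b hp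

/-- A Rosenthal type bound for the `p`-th moment of a sum of `k` independent variables, the `g`-th
of which is uniform on the `L` values `y g l`, all bounded by `m`. -/
lemma moment_bound {p : ℝ} (hp2 : 2 ≤ p) (hp4 : p ≤ 4) {k L : ℕ} (hL : 0 < L)
    (y : Fin k → Fin L → ℂ) {m v : ℝ} (hm : 0 < m) (hy : ∀ g l, ‖y g l‖ ≤ m)
    (hv : (∑ g, ∑ l, ‖y g l‖ ^ 2) / L ≤ v) :
    ∑ s : Fin k → Fin L, ‖∑ g, y g (s g)‖ ^ p ≤
      (L : ℝ) ^ k * (4096 * ((‖∑ g, ∑ l, y g l‖ / L) ^ p + v ^ (p / 2) + m ^ (p - 2) * v)) := by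
  have hL' : (0 : ℝ) < L := by positivity
  have hv0 : 0 ≤ v := le_trans (by positivity) hv
  set a : Fin k → ℂ := fun g ↦ (∑ l, y g l) / L with ha
  set z : Fin k → Fin L → ℂ := fun g l ↦ y g l - a g with hz
  have hz0 : ∀ g, ∑ l, z g l = 0 := by
    intro g
    have : (L : ℂ) ≠ 0 := by exact_mod_cast hL.ne'
    simp only [hz, Finset.sum_sub_distrib, ha]
    simp; field_simp; simp
  have ham : ∀ g, ‖a g‖ ≤ m := by
    intro g
    rw [ha]; simp only [norm_div, Complex.norm_natCast]
    rw [div_le_iff₀ hL']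
    calc ‖∑ l, y g l‖ ≤ ∑ l : Fin L, m := norm_sum_le_of_le _ fun l _ ↦ hy g l
      _ = m * L := by simp [mul_comm]
  have hzm : ∀ g l, ‖z g l‖ ≤ 2 * m := fun g l ↦ by
    have := norm_sub_le (y g l) (a g)
    simp only [hz]; linarith [hy g l, ham g]
  obtain ⟨-, h2, h4⟩ := centred_moments L hL k z hz0
  have hzv : ∑ g, ∑ l, ‖z g l‖ ^ 2 / L ≤ v := by
    refine le_trans ?_ hv
    rw [Finset.sum_div]
    refine Finset.sum_le_sum fun g _ ↦ ?_
    rw [← Finset.sum_div]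
    gcongr ?_ / _
    have e : ∀ l, ‖y g l‖ ^ 2 = ‖z g l‖ ^ 2 + ‖a g‖ ^ 2 +
        2 * ((z g l).re * (a g).re + (z g l).im * (a g).im) := by
      intro l; rw [← norm_add_sq_expand]; simp [hz]
    have hre : ∑ l, (z g l).re = 0 := by rw [← Complex.re_sum, hz0]; rfl
    have him : ∑ l, (z g l).im = 0 := by rw [← Complex.im_sum, hz0]; rfl
    simp_rw [e, Finset.sum_add_distrib, ← Finset.mul_sum, Finset.sum_add_distrib,
      ← Finset.sum_mul, hre, him]
    have : 0 ≤ ∑ _l : Fin L, ‖a g‖ ^ 2 := by positivity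
    linarith
  set u : ℝ := ∑ g, ∑ l, ‖z g l‖ ^ 2 / L with hu
  have hu0 : 0 ≤ u := by positivity
  have hq : ∑ g, ∑ l, ‖z g l‖ ^ 4 / L ≤ 4 * m ^ 2 * u := by
    rw [hu, Finset.mul_sum]
    refine Finset.sum_le_sum fun g _ ↦ ?_
    rw [Finset.mul_sum]
    refine Finset.sum_le_sum fun l _ ↦ ?_
    rw [← mul_div_assoc]
    gcongr
    have : ‖z g l‖ ^ 2 ≤ (2 * m) ^ 2 := by gcongr; exact hzm g l
    nlinarith [sq_nonneg ‖z g l‖]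
  -- The second moment is at most `v` and the fourth at most `3v² + 4m²v ≤ 4 lam² v`, so this
  -- threshold makes both contributions of size `lam ^ (p - 2) * v`.
  set lam : ℝ := Real.sqrt (v + m ^ 2) with hlam
  have hlam2 : lam ^ 2 = v + m ^ 2 := Real.sq_sqrt (by positivity)
  have hlam0 : 0 < lam := Real.sqrt_pos.2 (by positivity)
  have hZ : ∑ s : Fin k → Fin L, ‖∑ g, z g (s g)‖ ^ p ≤
      (L : ℝ) ^ k * (5 * (lam ^ (p - 2) * v)) := by
    calc ∑ s : Fin k → Fin L, ‖∑ g, z g (s g)‖ ^ p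
        ≤ ∑ s : Fin k → Fin L, (lam ^ (p - 2) * ‖∑ g, z g (s g)‖ ^ 2
          + lam ^ (p - 4) * ‖∑ g, z g (s g)‖ ^ 4) := by
          gcongr with s _
          exact rpow_le_two_add_four hp2 hp4 hlam0 (norm_nonneg _)
      _ ≤ lam ^ (p - 2) * ((L : ℝ) ^ k * u) + lam ^ (p - 4) *
            ((L : ℝ) ^ k * (3 * u ^ 2 + 4 * m ^ 2 * u)) := by
          rw [Finset.sum_add_distrib, ← Finset.mul_sum, ← Finset.mul_sum, h2]
          gcongr
          refine h4.trans ?_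
          gcongr
      _ ≤ lam ^ (p - 2) * ((L : ℝ) ^ k * v) + lam ^ (p - 4) *
            ((L : ℝ) ^ k * (4 * (lam ^ 2 * v))) := by
          rw [hlam2]
          gcongr
          nlinarith [sq_nonneg m, mul_le_mul hzv hzv hu0 hv0,
            mul_le_mul_of_nonneg_left hzv (sq_nonneg m)]
      _ = _ := by
          have : lam ^ (p - 2) = lam ^ (p - 4) * lam ^ 2 := by
            rw [← Real.rpow_natCast lam 2, ← Real.rpow_add hlam0]; congr 1; push_cast; ring
          rw [this]; ring
  have hlamp : lam ^ (p - 2) * v ≤ 2 * (v ^ (p / 2) + m ^ (p - 2) * v) := by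
    have e1 : lam ^ (p - 2) = (v + m ^ 2) ^ ((p - 2) / 2) := by
      rw [← hlam2, ← Real.rpow_natCast lam 2, ← Real.rpow_mul hlam0.le]; congr 1; push_cast; ring
    -- The power is subadditive because its exponent is at most one; this is where `p ≤ 4` enters.
    have e2 : (v + m ^ 2) ^ ((p - 2) / 2) ≤ 2 * (v ^ ((p - 2) / 2) + m ^ (p - 2)) := by
      have hmono : (v + m ^ 2) ^ ((p - 2) / 2) ≤ v ^ ((p - 2) / 2) + (m ^ 2) ^ ((p - 2) / 2) :=
        Real.rpow_add_le_add_rpow hv0 (by positivity) (by linarith) (by linarith)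
      have : (m ^ 2) ^ ((p - 2) / 2) = m ^ (p - 2) := by
        rw [← Real.rpow_natCast m 2, ← Real.rpow_mul hm.le]; congr 1; push_cast; ring
      rw [this] at hmono
      have : 0 ≤ v ^ ((p - 2) / 2) := by positivity
      have : 0 ≤ m ^ (p - 2) := by positivity
      linarith
    have e3 : v ^ ((p - 2) / 2) * v = v ^ (p / 2) := by
      rcases hv0.eq_or_lt with h | h
      · rw [← h, Real.zero_rpow (by linarith : p / 2 ≠ 0)]; simp
      · nth_rewrite 2 [← Real.rpow_one v]
        rw [← Real.rpow_add h]; congr 1; ring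
    rw [e1]
    nlinarith [mul_le_mul_of_nonneg_right e2 hv0]
  have h2p : (2 : ℝ) ^ (p - 1) ≤ 8 := by
    calc (2 : ℝ) ^ (p - 1) ≤ 2 ^ (3 : ℝ) := Real.rpow_le_rpow_of_exponent_le (by norm_num) (by linarith)
      _ = 8 := by norm_num
  set A : ℝ := (‖∑ g, ∑ l, y g l‖ / L) ^ p with hA
  have hA0 : 0 ≤ A := by positivity
  have hsum : ∀ s : Fin k → Fin L, ‖∑ g, y g (s g)‖ ^ p ≤
      8 * (A + ‖∑ g, z g (s g)‖ ^ p) := by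
    intro s
    have e : ∑ g, y g (s g) = (∑ g, a g) + ∑ g, z g (s g) := by
      rw [← Finset.sum_add_distrib]; simp [hz]
    have ea : ‖∑ g, a g‖ = ‖∑ g, ∑ l, y g l‖ / L := by
      simp only [ha]; rw [← Finset.sum_div]; simp
    calc ‖∑ g, y g (s g)‖ ^ p ≤ (‖∑ g, a g‖ + ‖∑ g, z g (s g)‖) ^ p := by
          rw [e]; gcongr; exact norm_add_le _ _
      _ ≤ 2 ^ (p - 1) * (‖∑ g, a g‖ ^ p + ‖∑ g, z g (s g)‖ ^ p) :=
          add_rpow_le_two_rpow (by linarith) (norm_nonneg _) (norm_nonneg _)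
      _ ≤ 8 * (A + ‖∑ g, z g (s g)‖ ^ p) := by
          rw [ea]; gcongr
  calc ∑ s : Fin k → Fin L, ‖∑ g, y g (s g)‖ ^ p
      ≤ ∑ s : Fin k → Fin L, 8 * (A + ‖∑ g, z g (s g)‖ ^ p) :=
        Finset.sum_le_sum fun s _ ↦ hsum s
    _ = 8 * ((L : ℝ) ^ k * A + ∑ s : Fin k → Fin L, ‖∑ g, z g (s g)‖ ^ p) := by
        rw [← Finset.mul_sum, Finset.sum_add_distrib]; simp
    _ ≤ 8 * ((L : ℝ) ^ k * A + (L : ℝ) ^ k * (5 * (2 * (v ^ (p / 2) + m ^ (p - 2) * v)))) := by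
        gcongr
        refine hZ.trans ?_
        gcongr
    _ ≤ _ := by
        have h1 : 0 ≤ v ^ (p / 2) + m ^ (p - 2) * v := by positivity
        have h2 : 0 < (L : ℝ) ^ k := by positivity
        have : 0 ≤ (L : ℝ) ^ k * A := by positivity
        have : 0 ≤ (L : ℝ) ^ k * (v ^ (p / 2) + m ^ (p - 2) * v) := by positivity
        nlinarith

/-! ### One dimensional extension integrals and sums of their squares -/

/-- The one dimensional extension integral over `[α, α + h]`. -/
noncomputable def fresnel (α h x t : ℝ) : ℂ :=
  ∫ η in α..(α + h), Complex.exp (2 * Real.pi * Complex.I * ((η * x + η ^ 2 * t : ℝ) : ℂ))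

lemma norm_exp_two_pi (r : ℝ) : ‖Complex.exp (2 * Real.pi * Complex.I * (r : ℂ))‖ = 1 := by
  rw [show (2 * Real.pi * Complex.I * (r : ℂ)) = ((2 * Real.pi * r : ℝ) : ℂ) * Complex.I by
    push_cast; ring]
  exact Complex.norm_exp_ofReal_mul_I _

lemma norm_fresnel_le {α h x t : ℝ} (hh : 0 ≤ h) : ‖fresnel α h x t‖ ≤ h := by
  have := intervalIntegral.norm_integral_le_of_norm_le_const (a := α) (b := α + h) (C := 1)
    (f := fun η : ℝ ↦ Complex.exp (2 * Real.pi * Complex.I * ((η * x + η ^ 2 * t : ℝ) : ℂ)))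
    (fun η _ ↦ (norm_exp_two_pi _).le)
  simpa [abs_of_nonneg hh, fresnel] using this

lemma continuous_fresnel (α h : ℝ) : Continuous fun q : ℝ × ℝ ↦ fresnel α h q.1 q.2 := by
  unfold fresnel
  apply intervalIntegral.continuous_parametric_intervalIntegral_of_continuous'
  fun_prop

/-- Integration by parts: decay of the one dimensional extension integral. -/
lemma mul_norm_fresnel_le {α h x t : ℝ} (hh : 0 ≤ h) :
    |x + 2 * α * t| * ‖fresnel α h x t‖ ≤ 1 + |t| * h ^ 2 := by
  set y := x + 2 * α * t with hy
  set e : ℝ → ℂ := fun η ↦ Complex.exp (2 * Real.pi * Complex.I * ((η * x + η ^ 2 * t : ℝ) : ℂ))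
    with he
  have hd : ∀ η : ℝ, HasDerivAt e (e η * (2 * Real.pi * Complex.I * ((x + 2 * η * t : ℝ) : ℂ))) η := by
    intro η
    have h1 : HasDerivAt (fun η : ℝ ↦ η * x + η ^ 2 * t) (x + 2 * η * t) η := by
      have := ((hasDerivAt_id η).mul_const x).add (((hasDerivAt_id η).pow 2).mul_const t)
      convert this using 1 <;> first | rfl | simp
    exact (h1.ofReal_comp.const_mul _).cexp
  have hcont : Continuous e := by
    rw [he]; fun_prop
  have hftc : ∫ η in α..(α + h), e η * (2 * Real.pi * Complex.I * ((x + 2 * η * t : ℝ) : ℂ))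
      = e (α + h) - e α :=
    intervalIntegral.integral_eq_sub_of_hasDerivAt (fun η _ ↦ hd η)
      (Continuous.intervalIntegrable (by fun_prop) _ _)
  -- The derivative of the phase is frozen at the left endpoint, where it equals `y`; the remainder
  -- `2 (η - α) t` is responsible for the term `|t| h²`.
  have hsplit : ∫ η in α..(α + h), e η * (2 * Real.pi * Complex.I * ((x + 2 * η * t : ℝ) : ℂ))
      = 2 * Real.pi * Complex.I * y * fresnel α h x t +
        ∫ η in α..(α + h), e η * (4 * Real.pi * Complex.I * (((η - α) * t : ℝ) : ℂ)) := by
    unfold fresnel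
    rw [← intervalIntegral.integral_const_mul, ← intervalIntegral.integral_add]
    · refine intervalIntegral.integral_congr fun η _ ↦ ?_
      simp only [he, hy]; push_cast; ring
    · exact Continuous.intervalIntegrable (by fun_prop) _ _
    · exact Continuous.intervalIntegrable (by fun_prop) _ _
  have hrem : ‖∫ η in α..(α + h), e η * (4 * Real.pi * Complex.I * (((η - α) * t : ℝ) : ℂ))‖
      ≤ 2 * Real.pi * |t| * h ^ 2 := by
    have hb : ∀ η ∈ Set.Ioc α (α + h),
        ‖e η * (4 * Real.pi * Complex.I * (((η - α) * t : ℝ) : ℂ))‖ ≤ 4 * Real.pi * |t| * (η - α) := by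
      intro η hη
      rw [norm_mul, he, norm_exp_two_pi]
      simp only [norm_mul, Complex.norm_I, Complex.norm_real, Real.norm_eq_abs,
        abs_of_nonneg (sub_nonneg.2 hη.1.le), abs_of_pos Real.pi_pos]
      norm_num
      linarith
    refine (intervalIntegral.norm_integral_le_of_norm_le (by linarith)
      (Filter.Eventually.of_forall hb) (Continuous.intervalIntegrable (by fun_prop) _ _)).trans ?_
    rw [intervalIntegral.integral_const_mul, intervalIntegral.integral_sub (by simp) (by simp),
      integral_id, intervalIntegral.integral_const]
    simp only [smul_eq_mul]
    apply le_of_eq; ring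
  have hmain : 2 * Real.pi * Complex.I * y * fresnel α h x t = e (α + h) - e α -
      ∫ η in α..(α + h), e η * (4 * Real.pi * Complex.I * (((η - α) * t : ℝ) : ℂ)) := by
    rw [← hftc, hsplit]; ring
  have hn : 2 * Real.pi * (|y| * ‖fresnel α h x t‖) ≤ 2 + 2 * Real.pi * |t| * h ^ 2 := by
    calc 2 * Real.pi * (|y| * ‖fresnel α h x t‖)
        = ‖2 * Real.pi * Complex.I * y * fresnel α h x t‖ := by
          simp [abs_of_pos Real.pi_pos]; ring
      _ ≤ (‖e (α + h)‖ + ‖e α‖) + 2 * Real.pi * |t| * h ^ 2 := by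
          rw [hmain]
          exact (norm_sub_le _ _).trans (add_le_add (norm_sub_le _ _) hrem)
      _ = _ := by simp only [he, norm_exp_two_pi]; norm_num
  have hpi := Real.pi_gt_three
  have : 0 ≤ |t| * h ^ 2 := by positivity
  nlinarith

/-- The majorant of the square of `fresnel`. -/
noncomputable def fresnelBound (α h x t : ℝ) : ℝ :=
  2 * h ^ 2 * (1 + ((x + 2 * α * t) * (h / (1 + |t| * h ^ 2))) ^ 2)⁻¹

lemma fresnelBound_nonneg (α h x t : ℝ) : 0 ≤ fresnelBound α h x t := by
  unfold fresnelBound; positivity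

/-- The trivial bound and the integration by parts bound each contribute `h²`; adding them gives the
factor 2 and a Cauchy profile centred at `x = -2αt`. -/
lemma norm_sq_fresnel_le {α h x t : ℝ} (hh : 0 ≤ h) :
    ‖fresnel α h x t‖ ^ 2 ≤ fresnelBound α h x t := by
  have h1 := norm_fresnel_le (α := α) (x := x) (t := t) hh
  have h2 := mul_norm_fresnel_le (α := α) (x := x) (t := t) hh
  set I := ‖fresnel α h x t‖ with hI
  have hI0 : 0 ≤ I := norm_nonneg _
  have hτ : 0 < 1 + |t| * h ^ 2 := by positivity
  set τ := 1 + |t| * h ^ 2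
  set y := x + 2 * α * t
  unfold fresnelBound
  rw [← div_eq_mul_inv, le_div_iff₀ (by positivity)]
  have h3 : I * (|y| * (h / τ)) ≤ h := by
    calc I * (|y| * (h / τ)) = (|y| * I) * (h / τ) := by ring
      _ ≤ τ * (h / τ) := by gcongr
      _ = h := by field_simp
  have h4 : (I * (|y| * (h / τ))) ^ 2 ≤ h ^ 2 := by gcongr
  have h5 : I ^ 2 ≤ h ^ 2 := by gcongr
  have h6 : (I * (|y| * (h / τ))) ^ 2 = I ^ 2 * (y * (h / τ)) ^ 2 := by
    rw [mul_pow, mul_pow, mul_pow, sq_abs]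
  calc I ^ 2 * (1 + (y * (h / τ)) ^ 2) = I ^ 2 + I ^ 2 * (y * (h / τ)) ^ 2 := by ring
    _ ≤ 2 * h ^ 2 := by rw [← h6]; linarith

/-- For `d ≤ 1` the mean value theorem applies, as `1 + c²` is comparable to `1 + y²` when `|c - y|
≤ 1`. For larger `d` a step of length one is enough. The right side is designed to telescope along
an arithmetic progression. -/
lemma inv_one_add_sq_le_arctan {y d : ℝ} (hd : 0 < d) :
    (1 + y ^ 2)⁻¹ ≤ 3 * (1 + d⁻¹) * (Real.arctan (y + d) - Real.arctan y) := by
  have key : ∀ d : ℝ, 0 < d → d ≤ 1 →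
      d * (1 + y ^ 2)⁻¹ ≤ 3 * (Real.arctan (y + d) - Real.arctan y) := by
    intro d hd hd1
    obtain ⟨c, hc, hc'⟩ := exists_deriv_eq_slope Real.arctan (a := y) (b := y + d) (by linarith)
      Real.continuous_arctan.continuousOn Real.differentiable_arctan.differentiableOn
    rw [Real.deriv_arctan, eq_div_iff (by linarith)] at hc'
    rw [← hc']
    have h1 : (1 + y ^ 2)⁻¹ ≤ 3 * (1 / (1 + c ^ 2)) := by
      rw [inv_eq_one_div, mul_one_div, div_le_div_iff₀ (by positivity) (by positivity)]
      have : (c - y) ^ 2 ≤ 1 := by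
        have h1 := hc.1; have h2 := hc.2
        nlinarith
      nlinarith [sq_nonneg (c - 2 * y)]
    nlinarith
  rcases le_total d 1 with h | h
  · have := key d hd h
    have h0 : 0 ≤ Real.arctan (y + d) - Real.arctan y :=
      sub_nonneg.2 (Real.arctan_strictMono.monotone (by linarith))
    have h2 : (1 + y ^ 2)⁻¹ ≤ 3 * d⁻¹ * (Real.arctan (y + d) - Real.arctan y) := by
      calc (1 + y ^ 2)⁻¹ = d⁻¹ * (d * (1 + y ^ 2)⁻¹) := by field_simp
        _ ≤ d⁻¹ * (3 * (Real.arctan (y + d) - Real.arctan y)) := by gcongr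
        _ = _ := by ring
    nlinarith
  · have := key 1 one_pos le_rfl
    have h1 : Real.arctan (y + 1) ≤ Real.arctan (y + d) :=
      Real.arctan_strictMono.monotone (by linarith)
    have h0 : 0 ≤ Real.arctan (y + d) - Real.arctan y :=
      sub_nonneg.2 (Real.arctan_strictMono.monotone (by linarith))
    have : 0 ≤ d⁻¹ * (Real.arctan (y + d) - Real.arctan y) := by positivity
    nlinarith

lemma sum_inv_one_add_sq_le (n : ℕ) (z : ℝ) {d : ℝ} (hd : d ≠ 0) :
    ∑ i ∈ Finset.range n, (1 + (z + i * d) ^ 2)⁻¹ ≤ 3 * Real.pi * (1 + |d|⁻¹) := by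
  have key : ∀ (z d : ℝ), 0 < d →
      ∑ i ∈ Finset.range n, (1 + (z + i * d) ^ 2)⁻¹ ≤ 3 * Real.pi * (1 + d⁻¹) := by
    intro z d hd
    calc ∑ i ∈ Finset.range n, (1 + (z + i * d) ^ 2)⁻¹
        ≤ ∑ i ∈ Finset.range n, 3 * (1 + d⁻¹) *
          (Real.arctan (z + (i + 1 : ℕ) * d) - Real.arctan (z + i * d)) := by
          gcongr with i _
          rw [show z + ((i + 1 : ℕ) : ℝ) * d = z + i * d + d by push_cast; ring]
          exact inv_one_add_sq_le_arctan hd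
      _ = 3 * (1 + d⁻¹) * (Real.arctan (z + n * d) - Real.arctan z) := by
          rw [← Finset.mul_sum, Finset.sum_range_sub (fun i : ℕ ↦ Real.arctan (z + i * d))]
          simp
      _ ≤ 3 * (1 + d⁻¹) * Real.pi := by
          gcongr
          linarith [Real.arctan_lt_pi_div_two (z + n * d),
            Real.neg_pi_div_two_lt_arctan z]
      _ = _ := by ring
  rcases lt_or_gt_of_ne hd with h | h
  · rw [abs_of_neg h]
    convert key (-z) (-d) (by linarith) using 4 with i _
    ring
  · rw [abs_of_pos h]; exact key z d h

/-- The sum of the majorants over the intervals `[i / n, (i + 1) / n]`. -/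
noncomputable def fresnelSum (n : ℕ) (x t : ℝ) : ℝ :=
  ∑ i ∈ Finset.range n, fresnelBound (i / n) (1 / n) x t

lemma fresnelSum_nonneg (n : ℕ) (x t : ℝ) : 0 ≤ fresnelSum n x t :=
  Finset.sum_nonneg fun _ _ ↦ fresnelBound_nonneg _ _ _ _

lemma continuous_fresnelSum (n : ℕ) : Continuous fun q : ℝ × ℝ ↦ fresnelSum n q.1 q.2 := by
  unfold fresnelSum fresnelBound
  refine continuous_finsetSum _ fun i _ ↦ ?_
  have h1 : ∀ q : ℝ × ℝ, 1 + |q.2| * (1 / (n : ℝ)) ^ 2 ≠ 0 := fun q ↦ by positivity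
  refine Continuous.mul continuous_const (Continuous.inv₀ ?_ fun q ↦ by positivity)
  have : Continuous fun q : ℝ × ℝ ↦ (1 / (n : ℝ)) / (1 + |q.2| * (1 / (n : ℝ)) ^ 2) :=
    Continuous.div continuous_const (by fun_prop) h1
  fun_prop

lemma fresnelSum_le_trivial {n : ℕ} (hn : 1 ≤ n) (x t : ℝ) : fresnelSum n x t ≤ 2 / n := by
  have hn' : (0 : ℝ) < n := by exact_mod_cast hn
  calc fresnelSum n x t ≤ ∑ i ∈ Finset.range n, 2 * (1 / (n : ℝ)) ^ 2 := by
        unfold fresnelSum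
        gcongr with i _
        unfold fresnelBound
        refine mul_le_of_le_one_right (by positivity) (inv_le_one_of_one_le₀ ?_)
        nlinarith [sq_nonneg ((x + 2 * (i / n : ℝ) * t) * (1 / n / (1 + |t| * (1 / (n : ℝ)) ^ 2)))]
    _ = 2 / n := by simp; field_simp

/-- The profiles of neighbouring intervals are centred at points `2|t|/n` apart, so their arguments
form an arithmetic progression and the telescoping bound applies. -/
lemma fresnelSum_le_decay {n : ℕ} (hn : 1 ≤ n) (x : ℝ) {t : ℝ} (ht : t ≠ 0) :
    fresnelSum n x t ≤ 9 * Real.pi / n ^ 2 + 3 * Real.pi / |t| := by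
  have hn' : (0 : ℝ) < n := by exact_mod_cast hn
  set τ := 1 + |t| * (1 / (n : ℝ)) ^ 2 with hτ
  have hτ0 : 0 < τ := by positivity
  have ht0 : 0 < |t| := abs_pos.2 ht
  have e : fresnelSum n x t = 2 * (1 / (n : ℝ)) ^ 2 * ∑ i ∈ Finset.range n,
      (1 + (x * (1 / n / τ) + i * (2 * t * (1 / n) ^ 2 / τ)) ^ 2)⁻¹ := by
    unfold fresnelSum fresnelBound
    rw [Finset.mul_sum]
    refine Finset.sum_congr rfl fun i _ ↦ ?_
    rw [← hτ]
    congr 4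
    ring
  rw [e]
  have hd : 2 * t * (1 / (n : ℝ)) ^ 2 / τ ≠ 0 := by positivity
  calc _ ≤ 2 * (1 / (n : ℝ)) ^ 2 * (3 * Real.pi * (1 + |2 * t * (1 / (n : ℝ)) ^ 2 / τ|⁻¹)) := by
        gcongr
        exact sum_inv_one_add_sq_le n _ hd
    _ = 9 * Real.pi / n ^ 2 + 3 * Real.pi / |t| := by
        have : |2 * t * (1 / (n : ℝ)) ^ 2 / τ| = 2 * |t| * (1 / (n : ℝ)) ^ 2 / τ := by
          rw [abs_div, abs_mul, abs_mul, abs_of_pos hτ0, abs_of_pos (by positivity : 0 < (1 / (n : ℝ)) ^ 2)]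
          norm_num
        rw [this, hτ]
        field_simp
        ring

/-- The trivial bound is used for `|t| ≤ n` and the decay bound for `n ≤ |t| ≤ n²`; the denominator
`n + |t|` unites the two ranges. -/
lemma fresnelSum_le_near {n : ℕ} (hn : 1 ≤ n) (x : ℝ) {t : ℝ} (ht : |t| ≤ n ^ 2) :
    fresnelSum n x t ≤ 24 * Real.pi / (n + |t|) := by
  have hn' : (0 : ℝ) < n := by exact_mod_cast hn
  have hpi := Real.pi_gt_three
  rcases le_total |t| n with h | h
  · refine (fresnelSum_le_trivial hn x t).trans ?_
    rw [div_le_div_iff₀ hn' (by positivity)]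
    nlinarith
  · have ht0 : 0 < |t| := hn'.trans_le h
    refine (fresnelSum_le_decay hn x (abs_pos.1 ht0)).trans ?_
    calc 9 * Real.pi / (n : ℝ) ^ 2 + 3 * Real.pi / |t| ≤ 9 * Real.pi / |t| + 3 * Real.pi / |t| := by
          gcongr
      _ = 12 * Real.pi / |t| := by ring
      _ ≤ 24 * Real.pi / (n + |t|) := by
          rw [div_le_div_iff₀ ht0 (by positivity)]
          nlinarith

lemma fresnelSum_le_far {n : ℕ} (hn : 1 ≤ n) (x : ℝ) {t : ℝ} (ht : (n : ℝ) ^ 2 ≤ |t|) :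
    fresnelSum n x t ≤ 12 * Real.pi / n ^ 2 := by
  have hn' : (0 : ℝ) < n := by exact_mod_cast hn
  have ht0 : 0 < |t| := (by positivity : (0 : ℝ) < n ^ 2).trans_le ht
  refine (fresnelSum_le_decay hn x (abs_pos.1 ht0)).trans ?_
  calc 9 * Real.pi / (n : ℝ) ^ 2 + 3 * Real.pi / |t|
      ≤ 9 * Real.pi / (n : ℝ) ^ 2 + 3 * Real.pi / (n : ℝ) ^ 2 := by gcongr
    _ = 12 * Real.pi / n ^ 2 := by ring

lemma integrable_fresnelBound {α h : ℝ} (hh : 0 < h) (t : ℝ) :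
    Integrable (fun x ↦ fresnelBound α h x t) ∧
      ∫ x, fresnelBound α h x t = 2 * h * Real.pi * (1 + |t| * h ^ 2) := by
  have hτ : 0 < 1 + |t| * h ^ 2 := by positivity
  set τ := 1 + |t| * h ^ 2 with hτd
  have hc : 0 < h / τ := by positivity
  have e : (fun x ↦ fresnelBound α h x t) = fun x ↦
      2 * h ^ 2 * ((fun u : ℝ ↦ (fun v : ℝ ↦ (1 + v ^ 2)⁻¹) (u * (h / τ))) (x + 2 * α * t)) := by
    funext x; simp only [fresnelBound, ← hτd]
  rw [e]
  constructor
  · exact ((integrable_inv_one_add_sq.comp_mul_right' hc.ne').comp_add_right _).const_mul _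
  · rw [integral_const_mul, integral_add_right_eq_self
      (fun u : ℝ ↦ (fun v : ℝ ↦ (1 + v ^ 2)⁻¹) (u * (h / τ))),
      Measure.integral_comp_mul_right (fun v : ℝ ↦ (1 + v ^ 2)⁻¹), integral_univ_inv_one_add_sq, abs_of_pos (by positivity)]
    simp only [smul_eq_mul]
    field_simp

/-- Each of the `n` Cauchy profiles has mass of order `1/n` times the spreading factor, so the total
stays bounded for `|t| ≤ n²`. -/
lemma integral_fresnelSum {n : ℕ} (hn : 1 ≤ n) (t : ℝ) :
    Integrable (fun x ↦ fresnelSum n x t) ∧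
      ∫ x, fresnelSum n x t = 2 * Real.pi * (1 + |t| * (1 / n) ^ 2) := by
  have hn' : (0 : ℝ) < n := by exact_mod_cast hn
  have hh : (0 : ℝ) < 1 / n := by positivity
  unfold fresnelSum
  refine ⟨integrable_finsetSum _ fun i _ ↦ (integrable_fresnelBound hh t).1, ?_⟩
  rw [integral_finsetSum _ fun i _ ↦ (integrable_fresnelBound hh t).1]
  simp_rw [(integrable_fresnelBound hh t).2]
  simp
  field_simp

/-- The `x` integral of a power of the square function majorant, for `|t| ≤ n²`. -/
lemma lintegral_fresnelSum_rpow_le {n : ℕ} (hn : 1 ≤ n) {q : ℝ} (hq : 1 ≤ q) {t : ℝ}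
    (ht : |t| ≤ n ^ 2) :
    ∫⁻ x, ENNReal.ofReal (fresnelSum n x t ^ q) ≤
      ENNReal.ofReal (4 * Real.pi * (24 * Real.pi / (n + |t|)) ^ (q - 1)) := by
  have hn' : (0 : ℝ) < n := by exact_mod_cast hn
  have hpi := Real.pi_pos
  -- The power is split as `q - 1` copies of the supremum and one copy of the `L¹` norm.
  calc ∫⁻ x, ENNReal.ofReal (fresnelSum n x t ^ q)
      ≤ ∫⁻ x, ENNReal.ofReal ((24 * Real.pi / (n + |t|)) ^ (q - 1)) *
          ENNReal.ofReal (fresnelSum n x t) := by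
        refine lintegral_mono fun x ↦ ?_
        rw [← ENNReal.ofReal_mul (by positivity)]
        refine ENNReal.ofReal_le_ofReal ?_
        have h0 := fresnelSum_nonneg n x t
        rcases h0.eq_or_lt with h | h
        · rw [← h, Real.zero_rpow (by linarith)]; simp
        · calc fresnelSum n x t ^ q = fresnelSum n x t ^ (q - 1) * fresnelSum n x t := by
                rw [← Real.rpow_add_one h.ne']; congr 1; ring
            _ ≤ _ := by
                gcongr
                exact fresnelSum_le_near hn x ht
    _ = ENNReal.ofReal ((24 * Real.pi / (n + |t|)) ^ (q - 1)) *
          ENNReal.ofReal (2 * Real.pi * (1 + |t| * (1 / n) ^ 2)) := by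
        rw [lintegral_const_mul' _ _ ENNReal.ofReal_ne_top,
          ← ofReal_integral_eq_lintegral_ofReal (integral_fresnelSum hn t).1
            (Filter.Eventually.of_forall fun x ↦ fresnelSum_nonneg n x t),
          (integral_fresnelSum hn t).2]
    _ ≤ _ := by
        rw [← ENNReal.ofReal_mul (by positivity)]
        refine ENNReal.ofReal_le_ofReal ?_
        rw [mul_comm]
        refine mul_le_mul_of_nonneg_right ?_ (by positivity)
        have : |t| * (1 / (n : ℝ)) ^ 2 ≤ 1 := by
          rw [one_div, inv_pow, ← div_eq_mul_inv, div_le_one (by positivity)]; exact ht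
        nlinarith

/-! ### Weights adapted to a ball -/

/-- The total mass of the weight at scale one. -/
noncomputable def weightMass (W : ℝ) : ℝ := ∫ x : EuclideanSpace ℝ (Fin 3), (1 + ‖x‖) ^ (-W)

lemma weightMass_nonneg (W : ℝ) : 0 ≤ weightMass W :=
  integral_nonneg fun x ↦ by positivity

lemma ballWeight_eq (W : ℝ) {R : ℝ} (hR : 0 < R) (c x : EuclideanSpace ℝ (Fin 3)) :
    ballWeight W R c x =
      (fun y : EuclideanSpace ℝ (Fin 3) ↦ (1 + ‖R⁻¹ • y‖) ^ (-W)) (x - c) := by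
  simp only [ballWeight, norm_smul, norm_inv, Real.norm_eq_abs, abs_of_pos hR, dist_eq_norm]
  congr 2; field_simp

lemma ballWeight_nonneg (W : ℝ) {R : ℝ} (hR : 0 < R) (c x : EuclideanSpace ℝ (Fin 3)) :
    0 ≤ ballWeight W R c x := by unfold ballWeight; positivity

lemma ballWeight_le_one {W : ℝ} (hW : 3 < W) {R : ℝ} (hR : 0 < R) (c x : EuclideanSpace ℝ (Fin 3)) :
    ballWeight W R c x ≤ 1 := by
  unfold ballWeight
  refine Real.rpow_le_one_of_one_le_of_nonpos ?_ (by linarith)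
  have : 0 ≤ dist x c / R := by positivity
  linarith

lemma continuous_ballWeight (W : ℝ) {R : ℝ} (hR : 0 < R) (c : EuclideanSpace ℝ (Fin 3)) :
    Continuous (ballWeight W R c) := by
  unfold ballWeight
  refine Continuous.rpow_const (by fun_prop) fun x ↦ Or.inl ?_
  positivity

lemma integral_ballWeight {W : ℝ} (hW : 3 < W) {R : ℝ} (hR : 0 < R)
    (c : EuclideanSpace ℝ (Fin 3)) :
    Integrable (ballWeight W R c) ∧ ∫ x, ballWeight W R c x = R ^ 3 * weightMass W := by
  have h1 : Integrable fun x : EuclideanSpace ℝ (Fin 3) ↦ (1 + ‖x‖) ^ (-W) :=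
    integrable_one_add_norm (by simpa using hW)
  have e : ballWeight W R c = fun x ↦
      (fun y : EuclideanSpace ℝ (Fin 3) ↦ (1 + ‖R⁻¹ • y‖) ^ (-W)) (x - c) :=
    funext fun x ↦ ballWeight_eq W hR c x
  rw [e]
  constructor
  · exact (h1.comp_smul (inv_ne_zero hR.ne')).comp_sub_right c
  · rw [integral_sub_right_eq_self
      (fun y : EuclideanSpace ℝ (Fin 3) ↦ (1 + ‖R⁻¹ • y‖) ^ (-W)) c,
      Measure.integral_comp_inv_smul_of_nonneg volume
        (fun y : EuclideanSpace ℝ (Fin 3) ↦ (1 + ‖y‖) ^ (-W)) hR.le]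
    simp [weightMass]

lemma integrable_mul_ballWeight {W : ℝ} (hW : 3 < W) {R : ℝ} (hR : 0 < R)
    (c : EuclideanSpace ℝ (Fin 3)) {f : EuclideanSpace ℝ (Fin 3) → ℝ} (hf : Continuous f) {B : ℝ}
    (hB : ∀ x, |f x| ≤ B) : Integrable fun x ↦ f x * ballWeight W R c x :=
  (integral_ballWeight hW hR c).1.bdd_mul hf.aestronglyMeasurable
    (Filter.Eventually.of_forall hB)

/-- Moving by less than `R` changes `dist / R` by less than one, hence `1 + dist / R` by a factor of
at most two. -/
lemma ballWeight_comparable {W : ℝ} (hW : 3 < W) {R : ℝ} (hR : 0 < R)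
    {c x z : EuclideanSpace ℝ (Fin 3)} (h : dist z x < R) :
    ballWeight W R c x ≤ 2 ^ W * ballWeight W R c z := by
  unfold ballWeight
  have h0 : 0 ≤ dist x c / R := by positivity
  have h1 : 0 ≤ dist z c / R := by positivity
  have : (1 + dist z c / R) / 2 ≤ 1 + dist x c / R := by
    have h2 : dist z c ≤ R + dist x c := by linarith [dist_triangle z x c]
    have : dist z c / R ≤ 1 + dist x c / R := by
      rw [div_le_iff₀ hR, add_mul, div_mul_cancel₀ _ hR.ne']; linarith
    linarith
  calc (1 + dist x c / R) ^ (-W) ≤ ((1 + dist z c / R) / 2) ^ (-W) :=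
        Real.rpow_le_rpow_of_nonpos (by positivity) this (by linarith)
    _ = 2 ^ W * (1 + dist z c / R) ^ (-W) := by
        rw [Real.div_rpow (by positivity) (by norm_num), Real.rpow_neg (by norm_num : (0:ℝ) ≤ 2)]
        field_simp

/-- The volume of the unit ball of `ℝ³`. -/
noncomputable def unitBallVolume : ℝ :=
  volume.real (Metric.ball (0 : EuclideanSpace ℝ (Fin 3)) 1)

lemma unitBallVolume_pos : 0 < unitBallVolume :=
  ENNReal.toReal_pos (Metric.measure_ball_pos _ _ one_pos).ne' measure_ball_lt_top.ne

lemma volume_ball_eq {R : ℝ} (hR : 0 < R) (c : EuclideanSpace ℝ (Fin 3)) :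
    volume (Metric.ball c R) = ENNReal.ofReal (R ^ 3 * unitBallVolume) := by
  rw [Measure.addHaar_ball_of_pos _ _ hR, ENNReal.ofReal_mul (by positivity), unitBallVolume,
    measureReal_def, ENNReal.ofReal_toReal measure_ball_lt_top.ne]
  simp

/-- A weighted integral is controlled by the largest integral over a ball of the same radius. -/
lemma integral_mul_ballWeight_le {W : ℝ} (hW : 3 < W) {R : ℝ} (hR : 0 < R)
    (c : EuclideanSpace ℝ (Fin 3)) {f : EuclideanSpace ℝ (Fin 3) → ℝ} (hf : Continuous f)
    (hf0 : ∀ x, 0 ≤ f x) {Q : ℝ} (hQ : ∀ z, ∫ x in Metric.ball z R, f x ≤ Q) :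
    ∫ x, f x * ballWeight W R c x ≤ 2 ^ W * weightMass W / unitBallVolume * Q := by
  have hv := unitBallVolume_pos
  have hm := weightMass_nonneg W
  have hQ0 : 0 ≤ Q := (integral_nonneg hf0).trans (hQ 0)
  have hw := continuous_ballWeight W hR c
  have hloc : ∀ z, ∫⁻ x in Metric.ball z R, ENNReal.ofReal (f x) ≤ ENNReal.ofReal Q := by
    intro z
    rw [← ofReal_integral_eq_lintegral_ofReal _ (Filter.Eventually.of_forall hf0)]
    · exact ENNReal.ofReal_le_ofReal (hQ z)
    · exact (hf.continuousOn.integrableOn_compact (isCompact_closedBall z R)).mono_set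
        Metric.ball_subset_closedBall
  have hmeas : Measurable fun q : EuclideanSpace ℝ (Fin 3) × EuclideanSpace ℝ (Fin 3) ↦
      (Metric.ball q.1 R).indicator (fun z ↦ ENNReal.ofReal (f q.1) *
        ENNReal.ofReal (2 ^ W * ballWeight W R c z)) q.2 := by
    have : (fun q : EuclideanSpace ℝ (Fin 3) × EuclideanSpace ℝ (Fin 3) ↦
      (Metric.ball q.1 R).indicator (fun z ↦ ENNReal.ofReal (f q.1) *
        ENNReal.ofReal (2 ^ W * ballWeight W R c z)) q.2) =
        {q : EuclideanSpace ℝ (Fin 3) × EuclideanSpace ℝ (Fin 3) | dist q.2 q.1 < R}.indicator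
          (fun q ↦ ENNReal.ofReal (f q.1) * ENNReal.ofReal (2 ^ W * ballWeight W R c q.2)) := by
      funext q; simp [Set.indicator, Metric.mem_ball]
    rw [this]
    refine Measurable.indicator ?_ (measurableSet_lt (by fun_prop) (by fun_prop))
    have := hf.measurable
    have := hw.measurable
    fun_prop
  have key : ENNReal.ofReal (R ^ 3 * unitBallVolume) *
      ∫⁻ x, ENNReal.ofReal (f x * ballWeight W R c x) ≤
      ENNReal.ofReal (2 ^ W * (R ^ 3 * weightMass W) * Q) := by
    -- The constant volume factor becomes an integral over `z` in the ball about `x`. On it the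
    -- weight may be evaluated at `z`, and Tonelli turns the `x` integral into one over the ball
    -- about `z`.
    calc ENNReal.ofReal (R ^ 3 * unitBallVolume) * ∫⁻ x, ENNReal.ofReal (f x * ballWeight W R c x)
        = ∫⁻ x, ∫⁻ z in Metric.ball x R, ENNReal.ofReal (f x * ballWeight W R c x) := by
          rw [← lintegral_const_mul' _ _ ENNReal.ofReal_ne_top]
          refine lintegral_congr fun x ↦ ?_
          rw [setLIntegral_const, volume_ball_eq hR, mul_comm]
      _ ≤ ∫⁻ x, ∫⁻ z in Metric.ball x R, ENNReal.ofReal (f x) *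
            ENNReal.ofReal (2 ^ W * ballWeight W R c z) := by
          refine lintegral_mono fun x ↦ setLIntegral_mono' measurableSet_ball fun z hz ↦ ?_
          rw [← ENNReal.ofReal_mul (hf0 x)]
          refine ENNReal.ofReal_le_ofReal (mul_le_mul_of_nonneg_left ?_ (hf0 x))
          exact ballWeight_comparable hW hR (Metric.mem_ball.1 hz)
      _ = ∫⁻ z, ∫⁻ x, (Metric.ball x R).indicator (fun z ↦ ENNReal.ofReal (f x) *
            ENNReal.ofReal (2 ^ W * ballWeight W R c z)) z := by
          rw [lintegral_lintegral_swap]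
          · exact lintegral_congr fun x ↦ (lintegral_indicator measurableSet_ball _).symm
          · exact (hmeas.comp measurable_swap).aemeasurable
      _ = ∫⁻ z, ENNReal.ofReal (2 ^ W * ballWeight W R c z) *
            ∫⁻ x in Metric.ball z R, ENNReal.ofReal (f x) := by
          refine lintegral_congr fun z ↦ ?_
          rw [← lintegral_const_mul' _ _ ENNReal.ofReal_ne_top,
            ← lintegral_indicator measurableSet_ball]
          refine lintegral_congr fun x ↦ ?_
          simp only [Set.indicator, Metric.mem_ball, dist_comm x z, mul_comm]
      _ ≤ ∫⁻ z, ENNReal.ofReal (2 ^ W * ballWeight W R c z) * ENNReal.ofReal Q := by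
          gcongr with z
          exact hloc z
      _ = ENNReal.ofReal (2 ^ W * (R ^ 3 * weightMass W) * Q) := by
          rw [lintegral_mul_const' _ _ ENNReal.ofReal_ne_top,
            ← ofReal_integral_eq_lintegral_ofReal
              ((integral_ballWeight hW hR c).1.const_mul _)
              (Filter.Eventually.of_forall fun z ↦
                mul_nonneg (by positivity) (ballWeight_nonneg W hR c z)),
            integral_const_mul, (integral_ballWeight hW hR c).2, ← ENNReal.ofReal_mul (by positivity)]
  have hR3 : 0 < R ^ 3 * unitBallVolume := by positivity
  rw [integral_eq_lintegral_of_nonneg_ae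
    (Filter.Eventually.of_forall fun x ↦ mul_nonneg (hf0 x) (ballWeight_nonneg W hR c x))
    (hf.mul hw).aestronglyMeasurable]
  refine ENNReal.toReal_le_of_le_ofReal (by positivity) ?_
  have h2 : ∫⁻ x, ENNReal.ofReal (f x * ballWeight W R c x) ≤
      ENNReal.ofReal (2 ^ W * (R ^ 3 * weightMass W) * Q) / ENNReal.ofReal (R ^ 3 * unitBallVolume) := by
    rw [ENNReal.le_div_iff_mul_le (Or.inl (by simpa using hR3)) (Or.inl ENNReal.ofReal_ne_top),
      mul_comm]
    exact key
  refine h2.trans (le_of_eq ?_)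
  rw [← ENNReal.ofReal_div_of_pos hR3]
  congr 1
  field_simp

/-! ### The square function in `L²` and `L^p` -/

/-- Iterated integration over `ℝ³`, the last coordinate outermost. -/
lemma lintegral_euclidean_three {g : ℝ → ℝ → ℝ → ENNReal}
    (hg : Measurable fun q : ℝ × ℝ × ℝ ↦ g q.1 q.2.1 q.2.2) :
    ∫⁻ x : EuclideanSpace ℝ (Fin 3), g (x 2) (x 0) (x 1) = ∫⁻ t, ∫⁻ a, ∫⁻ b, g t a b := by
  have h1 : MeasurePreserving (fun x : EuclideanSpace ℝ (Fin 3) ↦ (x 2, x 0, x 1)) := by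
    have a1 := PiLp.volume_preserving_ofLp (Fin 3)
    have a2 := volume_preserving_piFinSuccAbove (fun _ : Fin 3 ↦ ℝ) 2
    have a3 := (MeasurePreserving.id (volume : Measure ℝ)).prod (volume_preserving_finTwoArrow ℝ)
    exact a3.comp (a2.comp a1)
  have := h1.lintegral_comp (f := fun q : ℝ × ℝ × ℝ ↦ g q.1 q.2.1 q.2.2) hg
  simp only at this
  rw [this, Measure.volume_eq_prod, lintegral_prod _ hg.aemeasurable]
  refine lintegral_congr fun t ↦ ?_
  rw [Measure.volume_eq_prod, lintegral_prod]
  exact (hg.comp (measurable_const.prodMk measurable_id)).aemeasurable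

/-- The majorant of the square function of a step function. -/
noncomputable def squareBound (n : ℕ) (x : EuclideanSpace ℝ (Fin 3)) : ℝ :=
  fresnelSum n (x 0) (x 2) * fresnelSum n (x 1) (x 2)

lemma squareBound_nonneg (n : ℕ) (x : EuclideanSpace ℝ (Fin 3)) : 0 ≤ squareBound n x :=
  mul_nonneg (fresnelSum_nonneg _ _ _) (fresnelSum_nonneg _ _ _)

lemma continuous_squareBound (n : ℕ) : Continuous (squareBound n) := by
  have h := continuous_fresnelSum n
  unfold squareBound
  exact (h.comp (f := fun x : EuclideanSpace ℝ (Fin 3) ↦ (x 0, x 2)) (by fun_prop)).mul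
    (h.comp (f := fun x : EuclideanSpace ℝ (Fin 3) ↦ (x 1, x 2)) (by fun_prop))

lemma squareBound_le {n : ℕ} (hn : 1 ≤ n) (x : EuclideanSpace ℝ (Fin 3)) :
    squareBound n x ≤ 4 := by
  have hn' : (1 : ℝ) ≤ n := by exact_mod_cast hn
  have : (2 : ℝ) / n ≤ 2 := by rw [div_le_iff₀ (by linarith)]; linarith
  have h0 := (fresnelSum_le_trivial hn (x 0) (x 2)).trans this
  have h1 := (fresnelSum_le_trivial hn (x 1) (x 2)).trans this
  unfold squareBound
  nlinarith [fresnelSum_nonneg n (x 0) (x 2), fresnelSum_nonneg n (x 1) (x 2)]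

/-- For fixed `t` the majorant is a product of functions of the two remaining coordinates, so the
slice integral is the product of two one dimensional integrals. -/
lemma lintegral_squareBound_near {n : ℕ} (hn : 1 ≤ n) {q : ℝ} (hq : 1 ≤ q) :
    ∫⁻ x : EuclideanSpace ℝ (Fin 3), {x : EuclideanSpace ℝ (Fin 3) | |x 2| ≤ (n : ℝ) ^ 2}.indicator
      (fun x ↦ ENNReal.ofReal (squareBound n x ^ q)) x ≤
    ∫⁻ t in Set.Icc (-(n : ℝ) ^ 2) ((n : ℝ) ^ 2),
      ENNReal.ofReal ((4 * Real.pi * (24 * Real.pi / (n + |t|)) ^ (q - 1)) ^ 2) := by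
  have hm : ∀ {α : Type} [MeasurableSpace α] {f g : α → ℝ}, Measurable f → Measurable g →
      Measurable fun a ↦ ENNReal.ofReal (fresnelSum n (f a) (g a) ^ q) := fun hf hg ↦
    (((continuous_fresnelSum n).measurable.comp (hf.prodMk hg)).pow_const q).ennreal_ofReal
  obtain ⟨φ, hφ⟩ : ∃ φ : ℝ → ℝ → ENNReal, ∀ a t, φ a t = ENNReal.ofReal (fresnelSum n a t ^ q) :=
    ⟨_, fun _ _ ↦ rfl⟩
  obtain ⟨g, hg⟩ : ∃ g : ℝ → ℝ → ℝ → ENNReal, ∀ t a b, g t a b =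
      (Set.Icc (-(n : ℝ) ^ 2) ((n : ℝ) ^ 2)).indicator (fun t ↦ φ a t * φ b t) t :=
    ⟨_, fun _ _ _ ↦ rfl⟩
  have hgm : Measurable fun u : ℝ × ℝ × ℝ ↦ g u.1 u.2.1 u.2.2 := by
    simp_rw [hg, hφ]
    have : Measurable fun u : ℝ × ℝ × ℝ ↦ ENNReal.ofReal (fresnelSum n u.2.1 u.1 ^ q) *
        ENNReal.ofReal (fresnelSum n u.2.2 u.1 ^ q) :=
      (hm (by fun_prop) (by fun_prop)).mul (hm (by fun_prop) (by fun_prop))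
    exact this.indicator (measurable_fst measurableSet_Icc)
  have e : ∀ x : EuclideanSpace ℝ (Fin 3),
      {x : EuclideanSpace ℝ (Fin 3) | |x 2| ≤ (n : ℝ) ^ 2}.indicator
      (fun x ↦ ENNReal.ofReal (squareBound n x ^ q)) x = g (x 2) (x 0) (x 1) := by
    intro x
    rw [hg]
    simp only [Set.indicator, Set.mem_ofPred_eq, Set.mem_Icc, abs_le]
    split_ifs
    · rw [hφ, hφ, ← ENNReal.ofReal_mul (by have := fresnelSum_nonneg n (x 0) (x 2); positivity),
        ← Real.mul_rpow (fresnelSum_nonneg _ _ _) (fresnelSum_nonneg _ _ _), squareBound]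
    · rfl
  rw [lintegral_congr e, lintegral_euclidean_three hgm, ← lintegral_indicator measurableSet_Icc]
  refine lintegral_mono fun t ↦ ?_
  by_cases ht : t ∈ Set.Icc (-(n : ℝ) ^ 2) ((n : ℝ) ^ 2)
  · simp only [hg, Set.indicator_of_mem ht]
    have hI := lintegral_fresnelSum_rpow_le hn hq (abs_le.2 ht)
    simp_rw [← hφ] at hI
    have hmt : Measurable fun a ↦ φ a t := by
      simp_rw [hφ]; exact hm measurable_id measurable_const
    calc ∫⁻ a, ∫⁻ b, φ a t * φ b t = (∫⁻ a, φ a t) * ∫⁻ b, φ b t := by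
          rw [← lintegral_mul_const _ hmt]
          exact lintegral_congr fun a ↦ lintegral_const_mul _ hmt
      _ ≤ _ := by
          rw [sq, ENNReal.ofReal_mul (by positivity)]
          exact mul_le_mul' hI hI
  · simp [hg, Set.indicator_of_notMem ht]

/-- Inside the slab `|x 2| ≤ n²` the weight is dropped and the slice bound integrated. Outside it
the majorant is uniformly of order `n⁻⁴`, and the mass of the weight takes care of integrability. -/
lemma integral_squareBound_le {W : ℝ} (hW : 3 < W) {n : ℕ} (hn : 1 ≤ n) {q T : ℝ} (hq : 1 ≤ q)
    (hT0 : 0 ≤ T) (hT : ∫⁻ t in Set.Icc (-(n : ℝ) ^ 2) ((n : ℝ) ^ 2),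
      ENNReal.ofReal ((4 * Real.pi * (24 * Real.pi / (n + |t|)) ^ (q - 1)) ^ 2) ≤ ENNReal.ofReal T)
    (c : EuclideanSpace ℝ (Fin 3)) :
    ∫ x, squareBound n x ^ q * ballWeight W ((n : ℝ) ^ 2) c x ≤
      T + ((12 * Real.pi / n ^ 2) ^ 2) ^ q * (((n : ℝ) ^ 2) ^ 3 * weightMass W) := by
  have hn' : (0 : ℝ) < n := by exact_mod_cast hn
  have hR : (0 : ℝ) < (n : ℝ) ^ 2 := by positivity
  have hm := weightMass_nonneg W
  have hsq := squareBound_nonneg n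
  have hc : Continuous fun x ↦ squareBound n x ^ q :=
    (continuous_squareBound n).rpow_const fun x ↦ Or.inr (by linarith)
  have hw0 := ballWeight_nonneg W hR c
  set K : ℝ := ((12 * Real.pi / (n : ℝ) ^ 2) ^ 2) ^ q with hK
  have hK0 : 0 ≤ K := by positivity
  rw [integral_eq_lintegral_of_nonneg_ae
    (Filter.Eventually.of_forall fun x ↦ mul_nonneg (by have := hsq x; positivity) (hw0 x))
    (hc.mul (continuous_ballWeight W hR c)).aestronglyMeasurable]
  refine ENNReal.toReal_le_of_le_ofReal (by positivity) ?_
  calc ∫⁻ x, ENNReal.ofReal (squareBound n x ^ q * ballWeight W ((n : ℝ) ^ 2) c x)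
      ≤ ∫⁻ x, ({x : EuclideanSpace ℝ (Fin 3) | |x 2| ≤ (n : ℝ) ^ 2}.indicator
          (fun x ↦ ENNReal.ofReal (squareBound n x ^ q)) x +
          ENNReal.ofReal (K * ballWeight W ((n : ℝ) ^ 2) c x)) := by
        refine lintegral_mono fun x ↦ ?_
        by_cases hx : |x 2| ≤ (n : ℝ) ^ 2
        · refine le_add_right ?_
          rw [Set.indicator_of_mem (by exact hx)]
          refine ENNReal.ofReal_le_ofReal (mul_le_of_le_one_right ?_ (ballWeight_le_one hW hR c x))
          have := hsq x; positivity
        · refine le_add_left (ENNReal.ofReal_le_ofReal ?_)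
          refine mul_le_mul_of_nonneg_right ?_ (hw0 x)
          rw [hK]
          refine Real.rpow_le_rpow (hsq x) ?_ (by linarith)
          rw [sq]
          exact mul_le_mul (fresnelSum_le_far hn _ (not_le.1 hx).le)
            (fresnelSum_le_far hn _ (not_le.1 hx).le) (fresnelSum_nonneg _ _ _) (by positivity)
    _ ≤ ENNReal.ofReal T + ENNReal.ofReal (K * (((n : ℝ) ^ 2) ^ 3 * weightMass W)) := by
        rw [lintegral_add_right _ (by
          have := (continuous_ballWeight W hR c).measurable
          fun_prop)]
        gcongr
        · exact (lintegral_squareBound_near hn hq).trans hT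
        · rw [← ofReal_integral_eq_lintegral_ofReal ((integral_ballWeight hW hR c).1.const_mul _)
            (Filter.Eventually.of_forall fun x ↦ mul_nonneg hK0 (hw0 x)), integral_const_mul,
            (integral_ballWeight hW hR c).2]
    _ = _ := by rw [ENNReal.ofReal_add hT0 (by positivity)]

/-- The `L²` bound for the square function. -/
lemma integral_squareBound_one_le {W : ℝ} (hW : 3 < W) :
    ∃ C : ℝ, 0 ≤ C ∧ ∀ n : ℕ, 1 ≤ n → ∀ c : EuclideanSpace ℝ (Fin 3),
      ∫ x, squareBound n x * ballWeight W ((n : ℝ) ^ 2) c x ≤ C * (n : ℝ) ^ 2 := by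
  have hm := weightMass_nonneg W
  refine ⟨2 * (4 * Real.pi) ^ 2 + (12 * Real.pi) ^ 2 * weightMass W, by positivity,
    fun n hn c ↦ ?_⟩
  have hn' : (0 : ℝ) < n := by exact_mod_cast hn
  have := integral_squareBound_le hW hn (q := 1) (T := (2 * (n : ℝ) ^ 2) * (4 * Real.pi) ^ 2) le_rfl
    (by positivity) (by
      simp only [sub_self, Real.rpow_zero, mul_one]
      rw [setLIntegral_const, Real.volume_Icc, ← ENNReal.ofReal_mul (by positivity)]
      refine ENNReal.ofReal_le_ofReal (le_of_eq ?_)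
      ring) c
  simp only [Real.rpow_one] at this
  refine this.trans (le_of_eq ?_)
  field_simp

/-- The `L^p` bound for the square function, `p > 3`. -/
lemma integral_squareBound_rpow_le {W : ℝ} (hW : 3 < W) {p : ℝ} (hp : 3 < p) :
    ∃ C : ℝ, 0 ≤ C ∧ ∀ n : ℕ, 1 ≤ n → ∀ c : EuclideanSpace ℝ (Fin 3),
      ∫ x, squareBound n x ^ (p / 2) * ballWeight W ((n : ℝ) ^ 2) c x ≤ C * (n : ℝ) ^ (3 - p) := by
  have hm := weightMass_nonneg W
  set J : ℝ := ∫ t : ℝ, (1 + ‖t‖) ^ (-(p - 2)) with hJ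
  -- The decay exponent `p - 2` exceeds one precisely because `p > 3`; rescaling by `n` then yields
  -- `n^{2-p} · n = n^{3-p}`.
  have hJi : Integrable fun t : ℝ ↦ (1 + ‖t‖) ^ (-(p - 2)) :=
    integrable_one_add_norm (by simp; linarith)
  have hJ0 : 0 ≤ J := integral_nonneg fun t ↦ by positivity
  refine ⟨(4 * Real.pi) ^ 2 * (24 * Real.pi) ^ (p - 2) * J + ((12 * Real.pi) ^ 2) ^ (p / 2) *
    weightMass W, by positivity, fun n hn c ↦ ?_⟩
  have hn' : (0 : ℝ) < n := by exact_mod_cast hn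
  have hn1 : (1 : ℝ) ≤ n := by exact_mod_cast hn
  set A : ℝ := (4 * Real.pi) ^ 2 * (24 * Real.pi) ^ (p - 2) with hA
  have hA0 : 0 ≤ A := by positivity
  have hT : ∫⁻ t in Set.Icc (-(n : ℝ) ^ 2) ((n : ℝ) ^ 2),
      ENNReal.ofReal ((4 * Real.pi * (24 * Real.pi / (n + |t|)) ^ (p / 2 - 1)) ^ 2) ≤
      ENNReal.ofReal (A * J * (n : ℝ) ^ (3 - p)) := by
    have e : ∀ t : ℝ, (4 * Real.pi * (24 * Real.pi / (n + |t|)) ^ (p / 2 - 1)) ^ 2 =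
        A * (n : ℝ) ^ (2 - p) * (fun s : ℝ ↦ (1 + ‖s‖) ^ (-(p - 2))) (t / n) := by
      intro t
      have h1 : ((24 * Real.pi / (n + |t|)) ^ (p / 2 - 1)) ^ 2 = (24 * Real.pi / (n + |t|)) ^ (p - 2) := by
        rw [← Real.rpow_natCast, ← Real.rpow_mul (by positivity)]; congr 1; push_cast; ring
      have h2 : (n : ℝ) + |t| = n * (1 + ‖t / n‖) := by
        rw [norm_div, Real.norm_eq_abs, Real.norm_eq_abs, abs_of_pos hn']; field_simp
      rw [mul_pow, h1, Real.div_rpow (by positivity) (by positivity), h2,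
        Real.mul_rpow hn'.le (by positivity), hA]
      simp only
      rw [Real.rpow_neg (by positivity : 0 ≤ 1 + ‖t / n‖), show 2 - p = -(p - 2) by ring,
        Real.rpow_neg hn'.le]
      field_simp
    simp_rw [e]
    refine (setLIntegral_le_lintegral _ _).trans ?_
    rw [← ofReal_integral_eq_lintegral_ofReal]
    · refine ENNReal.ofReal_le_ofReal (le_of_eq ?_)
      rw [integral_const_mul, Measure.integral_comp_div (fun s : ℝ ↦ (1 + ‖s‖) ^ (-(p - 2))),
        abs_of_pos hn', smul_eq_mul, ← hJ, show 3 - p = (2 - p) + 1 by ring,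
        Real.rpow_add_one hn'.ne']
      ring
    · exact (hJi.comp_div hn'.ne').const_mul _
    · exact Filter.Eventually.of_forall fun t ↦ by positivity
  refine (integral_squareBound_le hW hn (by linarith) (by positivity) hT c).trans ?_
  have h2 : ((12 * Real.pi / (n : ℝ) ^ 2) ^ 2) ^ (p / 2) * (((n : ℝ) ^ 2) ^ 3 * weightMass W) ≤
      ((12 * Real.pi) ^ 2) ^ (p / 2) * weightMass W * (n : ℝ) ^ (3 - p) := by
    have e1 : ((12 * Real.pi / (n : ℝ) ^ 2) ^ 2) ^ (p / 2) =
        ((12 * Real.pi) ^ 2) ^ (p / 2) * (n : ℝ) ^ (-(2 * p)) := by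
      rw [div_pow, Real.div_rpow (by positivity) (by positivity), Real.rpow_neg hn'.le,
        div_eq_mul_inv, ← pow_mul, ← Real.rpow_natCast (n : ℝ), ← Real.rpow_mul hn'.le]
      congr 3; push_cast; ring
    have e2 : (n : ℝ) ^ (-(2 * p)) * ((n : ℝ) ^ 2) ^ 3 = (n : ℝ) ^ (6 - 2 * p) := by
      rw [← pow_mul, ← Real.rpow_natCast (n : ℝ), ← Real.rpow_add hn']; congr 1; push_cast; ring
    have e3 : (n : ℝ) ^ (6 - 2 * p) ≤ (n : ℝ) ^ (3 - p) :=
      Real.rpow_le_rpow_of_exponent_le hn1 (by linarith)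
    calc _ = ((12 * Real.pi) ^ 2) ^ (p / 2) * weightMass W * (n : ℝ) ^ (6 - 2 * p) := by
          rw [e1, ← e2]; ring
      _ ≤ _ := by gcongr
  linarith

/-! ### Step functions on the canonical squares and their extensions -/

/-- The half open version of `canonicalSquare`. -/
def halfOpenSquare (n : ℕ) (j : Fin 2 → Fin n) : Set (EuclideanSpace ℝ (Fin 2)) :=
  {ξ | ∀ i, ξ i ∈ Set.Ico (((j i : ℕ) : ℝ) / n) ((((j i : ℕ) : ℝ) + 1) / n)}

/-- The function which equals `b j` on the `j`-th (half open) canonical square. -/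
noncomputable def stepFun (n : ℕ) (b : (Fin 2 → Fin n) → ℂ) (ξ : EuclideanSpace ℝ (Fin 2)) : ℂ :=
  ∑ j, (halfOpenSquare n j).indicator (fun _ ↦ b j) ξ

/-- The extension of the indicator function of the `j`-th canonical square. -/
noncomputable def squareExt (n : ℕ) (j : Fin 2 → Fin n) (x : EuclideanSpace ℝ (Fin 3)) : ℂ :=
  fresnel (((j 0 : ℕ) : ℝ) / n) (1 / n) (x 0) (x 2) *
    fresnel (((j 1 : ℕ) : ℝ) / n) (1 / n) (x 1) (x 2)

lemma measurableSet_halfOpenSquare (n : ℕ) (j : Fin 2 → Fin n) :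
    MeasurableSet (halfOpenSquare n j) := by
  have : halfOpenSquare n j = ⋂ i, (fun ξ : EuclideanSpace ℝ (Fin 2) ↦ ξ i) ⁻¹'
      Set.Ico (((j i : ℕ) : ℝ) / n) ((((j i : ℕ) : ℝ) + 1) / n) := by
    ext ξ; simp [halfOpenSquare]
  rw [this]
  exact MeasurableSet.iInter fun i ↦ measurableSet_Ico.preimage (by fun_prop)

/-- The closed squares of the statement overlap along edges; this permits computing with disjoint
ones. -/
lemma halfOpenSquare_ae_eq (n : ℕ) (j : Fin 2 → Fin n) :
    halfOpenSquare n j =ᵐ[volume] canonicalSquare n j := by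
  have h := (PiLp.volume_preserving_ofLp (Fin 2)).quasiMeasurePreserving.preimage_ae_eq
    (Measure.univ_pi_Ico_ae_eq_Icc (μ := fun _ : Fin 2 ↦ (volume : Measure ℝ))
      (f := fun i ↦ ((j i : ℕ) : ℝ) / n) (g := fun i ↦ (((j i : ℕ) : ℝ) + 1) / n))
  have e1 : halfOpenSquare n j = (@WithLp.ofLp 2 (Fin 2 → ℝ)) ⁻¹' (Set.univ.pi fun i ↦
      Set.Ico (((j i : ℕ) : ℝ) / n) ((((j i : ℕ) : ℝ) + 1) / n)) := by
    ext ξ; simp [halfOpenSquare]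
  have e2 : canonicalSquare n j = (@WithLp.ofLp 2 (Fin 2 → ℝ)) ⁻¹' (Set.Icc
      (fun i ↦ ((j i : ℕ) : ℝ) / n) (fun i ↦ (((j i : ℕ) : ℝ) + 1) / n)) := by
    ext ξ; simp only [canonicalSquare, Set.mem_preimage, Set.mem_Icc, Pi.le_def]
    exact forall_and
  rw [e1, e2]
  exact h

lemma eq_of_mem_halfOpenSquare {n : ℕ} {j k : Fin 2 → Fin n} {ξ : EuclideanSpace ℝ (Fin 2)}
    (hj : ξ ∈ halfOpenSquare n j) (hk : ξ ∈ halfOpenSquare n k) : j = k := by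
  funext i
  have hn : 0 < n := (j i).pos
  have hn' : (0 : ℝ) < n := by exact_mod_cast hn
  have h1 := hj i
  have h2 := hk i
  have a1 := (h1.1.trans_lt h2.2)
  have a2 := (h2.1.trans_lt h1.2)
  rw [div_lt_div_iff_of_pos_right hn'] at a1 a2
  have b1 : (j i : ℕ) < (k i : ℕ) + 1 := by exact_mod_cast a1
  have b2 : (k i : ℕ) < (j i : ℕ) + 1 := by exact_mod_cast a2
  exact Fin.ext (by omega)

lemma stepFun_of_mem {n : ℕ} {b : (Fin 2 → Fin n) → ℂ} {j : Fin 2 → Fin n}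
    {ξ : EuclideanSpace ℝ (Fin 2)} (h : ξ ∈ halfOpenSquare n j) : stepFun n b ξ = b j := by
  unfold stepFun
  rw [Finset.sum_eq_single j]
  · exact Set.indicator_of_mem h _
  · intro k _ hk
    exact Set.indicator_of_notMem (fun h' ↦ hk (eq_of_mem_halfOpenSquare h' h)) _
  · simp

lemma measurable_stepFun (n : ℕ) (b : (Fin 2 → Fin n) → ℂ) : Measurable (stepFun n b) := by
  unfold stepFun
  exact Finset.measurable_fun_sum _ fun j _ ↦
    measurable_const.indicator (measurableSet_halfOpenSquare n j)

lemma norm_stepFun_le {n : ℕ} {b : (Fin 2 → Fin n) → ℂ} {B : ℝ} (hB : 0 ≤ B) (hb : ∀ j, ‖b j‖ ≤ B)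
    (ξ : EuclideanSpace ℝ (Fin 2)) : ‖stepFun n b ξ‖ ≤ B := by
  by_cases h : ∃ j, ξ ∈ halfOpenSquare n j
  · obtain ⟨j, hj⟩ := h
    rw [stepFun_of_mem hj]; exact hb j
  · push Not at h
    unfold stepFun
    rw [Finset.sum_eq_zero fun j _ ↦ Set.indicator_of_notMem (h j) _]
    simpa using hB

lemma integral_canonicalSquare_prod (n : ℕ) (j : Fin 2 → Fin n) (f : Fin 2 → ℝ → ℂ) :
    ∫ ξ in canonicalSquare n j, f 0 (ξ 0) * f 1 (ξ 1) =
      (∫ s in ((j 0 : ℕ) : ℝ) / n..((j 0 : ℕ) : ℝ) / n + 1 / n, f 0 s) *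
        ∫ s in ((j 1 : ℕ) : ℝ) / n..((j 1 : ℕ) : ℝ) / n + 1 / n, f 1 s := by
  have e : canonicalSquare n j = (@WithLp.ofLp 2 (Fin 2 → ℝ)) ⁻¹' (Set.univ.pi fun i ↦
      Set.Icc (((j i : ℕ) : ℝ) / n) ((((j i : ℕ) : ℝ) + 1) / n)) := by
    ext ξ; simp only [canonicalSquare, Set.mem_preimage, Set.mem_univ_pi]; rfl
  have hle : ∀ i, ((j i : ℕ) : ℝ) / n ≤ ((j i : ℕ) : ℝ) / n + 1 / n := fun i ↦ by
    have : (0 : ℝ) ≤ 1 / n := by positivity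
    linarith
  rw [e, (PiLp.volume_preserving_ofLp (Fin 2)).setIntegral_preimage_emb
    (MeasurableEquiv.toLp 2 (Fin 2 → ℝ)).symm.measurableEmbedding
    (fun η : Fin 2 → ℝ ↦ f 0 (η 0) * f 1 (η 1)), volume_pi, Measure.restrict_pi_pi]
  have := integral_fintype_prod_eq_prod (𝕜 := ℂ) (μ := fun i : Fin 2 ↦ (volume : Measure ℝ).restrict
    (Set.Icc (((j i : ℕ) : ℝ) / n) ((((j i : ℕ) : ℝ) + 1) / n))) f
  simp only [Fin.prod_univ_two] at this
  rw [this]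
  simp only [intervalIntegral.integral_of_le (hle _), ← integral_Icc_eq_integral_Ioc, add_div]

/-- Since `|ξ|²` is a sum over coordinates, the exponential factors and the integral over a square
is a product of two one dimensional ones. -/
lemma extension_canonicalSquare (n : ℕ) (j : Fin 2 → Fin n) (b : (Fin 2 → Fin n) → ℂ)
    (x : EuclideanSpace ℝ (Fin 3)) :
    extension (canonicalSquare n j) (stepFun n b) x = b j * squareExt n j x := by
  have h1 : extension (canonicalSquare n j) (stepFun n b) x = ∫ ξ in canonicalSquare n j,
      b j * ((fun (i : Fin 2) (s : ℝ) ↦ Complex.exp (2 * Real.pi * Complex.I *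
        ((s * x i.castSucc + s ^ 2 * x 2 : ℝ) : ℂ))) 0 (ξ 0) *
        (fun (i : Fin 2) (s : ℝ) ↦ Complex.exp (2 * Real.pi * Complex.I *
        ((s * x i.castSucc + s ^ 2 * x 2 : ℝ) : ℂ))) 1 (ξ 1)) := by
    unfold extension
    rw [← Measure.restrict_congr_set (halfOpenSquare_ae_eq n j)]
    refine setIntegral_congr_fun (measurableSet_halfOpenSquare n j) fun ξ hξ ↦ ?_
    simp only
    rw [stepFun_of_mem hξ, ← Complex.exp_add, EuclideanSpace.real_norm_sq_eq, Fin.sum_univ_two]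
    congr 2
    simp only [Fin.castSucc_zero, show (1 : Fin 2).castSucc = (1 : Fin 3) from rfl]
    push_cast
    ring
  rw [h1, integral_const_mul, integral_canonicalSquare_prod n j (fun (i : Fin 2) (s : ℝ) ↦
    Complex.exp (2 * Real.pi * Complex.I * ((s * x i.castSucc + s ^ 2 * x 2 : ℝ) : ℂ)))]
  rfl

lemma integrableOn_extension_integrand {S : Set (EuclideanSpace ℝ (Fin 2))}
    {F : EuclideanSpace ℝ (Fin 2) → ℂ} (hF : IntegrableOn F S) (x : EuclideanSpace ℝ (Fin 3)) :
    IntegrableOn (fun ξ ↦ F ξ * Complex.exp (2 * Real.pi * Complex.I *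
      ((ξ 0 * x 0 + ξ 1 * x 1 + ‖ξ‖ ^ 2 * x 2 : ℝ) : ℂ))) S :=
  hF.mul_bdd (c := 1) (Continuous.aestronglyMeasurable (by fun_prop))
    (Filter.Eventually.of_forall fun ξ ↦ (norm_exp_two_pi _).le)

lemma unitSquare_eq_ensemble {n : ℕ} (hn : 1 ≤ n) : unitSquare = ensemble n Finset.univ := by
  have hn' : (0 : ℝ) < n := by exact_mod_cast hn
  ext ξ
  simp only [unitSquare, ensemble, canonicalSquare, Finset.mem_univ, Set.iUnion_true,
    Set.mem_iUnion, Set.mem_ofPred_eq]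
  constructor
  · intro h
    have : ∀ i, ∃ k : Fin n, ξ i ∈ Set.Icc (((k : ℕ) : ℝ) / n) ((((k : ℕ) : ℝ) + 1) / n) := by
      intro i
      obtain ⟨h0, h1⟩ := h i
      by_cases hlt : ξ i < 1
      · have hf : ⌊n * ξ i⌋₊ < n := by
          rw [Nat.floor_lt (by positivity)]; nlinarith
        refine ⟨⟨⌊n * ξ i⌋₊, hf⟩, ?_, ?_⟩
        · rw [div_le_iff₀ hn', mul_comm (ξ i)]
          exact Nat.floor_le (by positivity)
        · rw [le_div_iff₀ hn', mul_comm (ξ i)]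
          exact (Nat.lt_floor_add_one _).le
      · have : ξ i = 1 := le_antisymm h1 (not_lt.1 hlt)
        refine ⟨⟨n - 1, by omega⟩, ?_, ?_⟩
        · rw [this, div_le_one hn']; simp
        · rw [this, le_div_iff₀ hn']
          simp [Nat.cast_sub hn]
    choose j hj using this
    exact ⟨j, hj⟩
  · rintro ⟨j, hj⟩ i
    obtain ⟨h0, h1⟩ := hj i
    refine ⟨le_trans (by positivity) h0, h1.trans ?_⟩
    rw [div_le_one hn']
    exact_mod_cast (j i).2

lemma isCompact_unitSquare : IsCompact unitSquare := by
  have h : unitSquare = (EuclideanSpace.equiv (Fin 2) ℝ).toHomeomorph ⁻¹'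
      (Set.univ.pi fun _ ↦ Set.Icc (0 : ℝ) 1) := by
    ext ξ; simp only [unitSquare, Set.mem_preimage, Set.mem_univ_pi]; rfl
  rw [h, Homeomorph.isCompact_preimage]
  exact isCompact_univ_pi fun _ ↦ isCompact_Icc

lemma integrableOn_stepFun (n : ℕ) (b : (Fin 2 → Fin n) → ℂ) :
    IntegrableOn (stepFun n b) unitSquare := by
  refine Measure.integrableOn_of_bounded (M := ∑ j, ‖b j‖) isCompact_unitSquare.measure_lt_top.ne
    (measurable_stepFun n b).aestronglyMeasurable (Filter.Eventually.of_forall fun ξ ↦ ?_)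
  exact norm_stepFun_le (by positivity)
    (fun j ↦ Finset.single_le_sum (f := fun j ↦ ‖b j‖) (fun _ _ ↦ norm_nonneg _) (Finset.mem_univ j)) ξ

lemma extension_ensemble {n : ℕ} (hn : 1 ≤ n) (P : Finset (Fin 2 → Fin n))
    (b : (Fin 2 → Fin n) → ℂ) (x : EuclideanSpace ℝ (Fin 3)) :
    extension (ensemble n P) (stepFun n b) x = ∑ j ∈ P, b j * squareExt n j x := by
  have hae : (⋃ j ∈ P, halfOpenSquare n j) =ᵐ[volume] ensemble n P :=
    Filter.EventuallyEq.countable_bUnion P.countable_toSet fun j _ ↦ halfOpenSquare_ae_eq n j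
  simp_rw [← extension_canonicalSquare]
  unfold extension
  simp_rw [← Measure.restrict_congr_set (halfOpenSquare_ae_eq n _)]
  rw [← Measure.restrict_congr_set hae]
  refine integral_biUnion_finset P (fun j _ ↦ measurableSet_halfOpenSquare n j)
    (fun j _ k _ hjk ↦ Set.disjoint_left.2 fun ξ h1 h2 ↦ hjk (eq_of_mem_halfOpenSquare h1 h2))
    fun j _ ↦ ?_
  refine (integrableOn_extension_integrand (integrableOn_stepFun n b) x).mono_set ?_
  rw [unitSquare_eq_ensemble hn]
  refine Set.Subset.trans (fun ξ hξ i ↦ Set.Ico_subset_Icc_self (hξ i))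
    (Set.subset_biUnion_of_mem (u := canonicalSquare n) (Finset.mem_univ j))

lemma extension_unitSquare {n : ℕ} (hn : 1 ≤ n) (b : (Fin 2 → Fin n) → ℂ)
    (x : EuclideanSpace ℝ (Fin 3)) :
    extension unitSquare (stepFun n b) x = ∑ j, b j * squareExt n j x := by
  rw [unitSquare_eq_ensemble hn, extension_ensemble hn]

lemma continuous_squareExt (n : ℕ) (j : Fin 2 → Fin n) : Continuous (squareExt n j) := by
  unfold squareExt
  exact ((continuous_fresnel _ _).comp (f := fun x : EuclideanSpace ℝ (Fin 3) ↦ (x 0, x 2))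
    (by fun_prop)).mul ((continuous_fresnel _ _).comp
    (f := fun x : EuclideanSpace ℝ (Fin 3) ↦ (x 1, x 2)) (by fun_prop))

lemma norm_squareExt_le (n : ℕ) (j : Fin 2 → Fin n) (x : EuclideanSpace ℝ (Fin 3)) :
    ‖squareExt n j x‖ ≤ 1 / (n : ℝ) ^ 2 := by
  have h : (0 : ℝ) ≤ 1 / n := by positivity
  rw [squareExt, norm_mul, show 1 / (n : ℝ) ^ 2 = 1 / n * (1 / n) by rw [← sq, one_div_pow]]
  exact mul_le_mul (norm_fresnel_le h) (norm_fresnel_le h) (norm_nonneg _) h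

/-- The double sum over both coordinates of `j` factors, because the majorant of each term is a
product. -/
lemma sum_norm_sq_squareExt_le (n : ℕ) (x : EuclideanSpace ℝ (Fin 3)) :
    ∑ j, ‖squareExt n j x‖ ^ 2 ≤ squareBound n x := by
  have h : (0 : ℝ) ≤ 1 / n := by positivity
  rw [← Equiv.sum_comp (finTwoArrowEquiv (Fin n)).symm, Fintype.sum_prod_type, squareBound,
    fresnelSum, fresnelSum, Finset.sum_range, Finset.sum_range, Finset.sum_mul_sum]
  gcongr with a _ b _
  rw [squareExt, norm_mul, mul_pow]
  exact mul_le_mul (norm_sq_fresnel_le h) (norm_sq_fresnel_le h) (by positivity)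
    (fresnelBound_nonneg _ _ _ _)

/-! ### Random partitions into parts meeting every group once -/

lemma shift_injective {α : Type*} {M L : ℕ} [NeZero L] (e : Fin M × Fin L ≃ α) (s : Fin M → Fin L)
    (j : Fin L) : Function.Injective fun g ↦ e (g, s g + j) := fun _ _ h ↦
  (Prod.ext_iff.1 (e.injective h)).1

/-- The `j`-th part of the shifted partition: a set containing one element of each of the
`M` groups `e '' ({g} × Fin L)`. -/
def shiftPart {α : Type*} {M L : ℕ} [NeZero L] (e : Fin M × Fin L ≃ α) (s : Fin M → Fin L)
    (j : Fin L) : Finset α :=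
  Finset.univ.map ⟨fun g ↦ e (g, s g + j), shift_injective e s j⟩

lemma mem_shiftPart {α : Type*} {M L : ℕ} [NeZero L] (e : Fin M × Fin L ≃ α) (s : Fin M → Fin L)
    (j : Fin L) (a : α) : a ∈ shiftPart e s j ↔ s (e.symm a).1 + j = (e.symm a).2 := by
  simp only [shiftPart, Finset.mem_map, Finset.mem_univ, true_and, Function.Embedding.coeFn_mk]
  constructor
  · rintro ⟨g, rfl⟩; simp
  · intro h
    exact ⟨(e.symm a).1, by rw [h]; simp⟩

lemma shiftPart_injective {α : Type*} {M L : ℕ} [NeZero L] [NeZero M] (e : Fin M × Fin L ≃ α)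
    (s : Fin M → Fin L) : Function.Injective (shiftPart e s) := by
  intro j j' h
  have h1 : e (0, s 0 + j) ∈ shiftPart e s j := by simp [mem_shiftPart]
  rw [h] at h1
  simpa [mem_shiftPart, eq_comm] using h1

/-- The partition into the sets `shiftPart`. -/
def shiftPartition {α : Type*} [DecidableEq α] [Fintype α] {M L : ℕ} [NeZero L] [NeZero M]
    (e : Fin M × Fin L ≃ α) (s : Fin M → Fin L) : Finpartition (Finset.univ : Finset α) :=
  Finpartition.ofExistsUnique (Finset.univ.map ⟨shiftPart e s, shiftPart_injective e s⟩)
    (fun _ _ ↦ Finset.subset_univ _)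
    (fun a _ ↦ by
      refine ⟨shiftPart e s ((e.symm a).2 - s (e.symm a).1), ⟨by simp, by simp [mem_shiftPart]⟩, ?_⟩
      rintro P ⟨hP, haP⟩
      simp only [Finset.mem_map, Finset.mem_univ, true_and, Function.Embedding.coeFn_mk] at hP
      obtain ⟨j, rfl⟩ := hP
      rw [mem_shiftPart] at haP
      rw [← haP]; simp)
    (by
      simp only [Finset.mem_map, Finset.mem_univ, true_and, Function.Embedding.coeFn_mk, not_exists]
      intro j h
      have h1 : e (0, s 0 + j) ∈ shiftPart e s j := by simp [mem_shiftPart]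
      rw [h] at h1
      simp at h1)

lemma card_of_mem_shiftPartition {α : Type*} [DecidableEq α] [Fintype α] {M L : ℕ} [NeZero L]
    [NeZero M] (e : Fin M × Fin L ≃ α) (s : Fin M → Fin L) {P : Finset α}
    (hP : P ∈ (shiftPartition e s).parts) : P.card = M := by
  simp only [shiftPartition, Finpartition.ofExistsUnique, Finset.mem_map, Finset.mem_univ, true_and,
    Function.Embedding.coeFn_mk] at hP
  obtain ⟨j, rfl⟩ := hP
  simp [shiftPart]

lemma sum_shiftPartition {α : Type*} [DecidableEq α] [Fintype α] {M L : ℕ} [NeZero L]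
    [NeZero M] (e : Fin M × Fin L ≃ α) (s : Fin M → Fin L) (f : Finset α → ℝ) :
    ∑ P ∈ (shiftPartition e s).parts, f P = ∑ j, f (shiftPart e s j) := by
  simp [shiftPartition, Finpartition.ofExistsUnique]

/-! ### Averaging decoupling over the random partitions -/

lemma continuous_norm_sum_squareExt_rpow {n : ℕ} {p : ℝ} (hp : 0 ≤ p) (b : (Fin 2 → Fin n) → ℂ)
    (P : Finset (Fin 2 → Fin n)) :
    Continuous fun x ↦ ‖∑ j ∈ P, b j * squareExt n j x‖ ^ p :=
  (continuous_finsetSum _ fun j _ ↦ continuous_const.mul (continuous_squareExt n j)).norm.rpow_const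
    fun _ ↦ Or.inr hp

lemma norm_sum_squareExt_le {n : ℕ} {b : (Fin 2 → Fin n) → ℂ} (hb : ∀ j, ‖b j‖ ≤ 1)
    (P : Finset (Fin 2 → Fin n)) (x : EuclideanSpace ℝ (Fin 3)) :
    ‖∑ j ∈ P, b j * squareExt n j x‖ ≤ 1 := by
  calc ‖∑ j ∈ P, b j * squareExt n j x‖ ≤ ∑ j ∈ P, ‖b j * squareExt n j x‖ := norm_sum_le _ _
    _ ≤ ∑ j, ‖b j * squareExt n j x‖ :=
        Finset.sum_le_sum_of_subset_of_nonneg (Finset.subset_univ _) fun _ _ _ ↦ norm_nonneg _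
    _ ≤ ∑ j : Fin 2 → Fin n, 1 / (n : ℝ) ^ 2 := by
        refine Finset.sum_le_sum fun j _ ↦ ?_
        rw [norm_mul]
        exact (mul_le_of_le_one_left (norm_nonneg _) (hb j)).trans (norm_squareExt_le n j x)
    _ ≤ 1 := by
        simp only [Finset.sum_const, Finset.card_univ, Fintype.card_fun, Fintype.card_fin,
          nsmul_eq_mul]
        push_cast
        rcases eq_or_ne (n : ℝ) 0 with h | h
        · simp [h]
        · field_simp; rfl

lemma integrable_norm_sum_squareExt_rpow {W p : ℝ} (hW : 3 < W) (hp : 0 ≤ p) {R : ℝ} (hR : 0 < R)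
    {n : ℕ} {b : (Fin 2 → Fin n) → ℂ} (hb : ∀ j, ‖b j‖ ≤ 1) (P : Finset (Fin 2 → Fin n))
    (c : EuclideanSpace ℝ (Fin 3)) :
    Integrable fun x ↦ ‖∑ j ∈ P, b j * squareExt n j x‖ ^ p * ballWeight W R c x :=
  integrable_mul_ballWeight hW hR c (continuous_norm_sum_squareExt_rpow hp b P) (B := 1) fun x ↦ by
    rw [abs_of_nonneg (by positivity)]
    exact Real.rpow_le_one (norm_nonneg _) (norm_sum_squareExt_le hb P x) hp

lemma integrable_squareBound_rpow {W q : ℝ} (hW : 3 < W) (hq : 0 ≤ q) {n : ℕ} (hn : 1 ≤ n)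
    {R : ℝ} (hR : 0 < R) (c : EuclideanSpace ℝ (Fin 3)) :
    Integrable fun x ↦ squareBound n x ^ q * ballWeight W R c x :=
  integrable_mul_ballWeight hW hR c
    ((continuous_squareBound n).rpow_const fun _ ↦ Or.inr hq) (B := 4 ^ q) fun x ↦ by
      have := squareBound_nonneg n x
      rw [abs_of_nonneg (by positivity)]
      exact Real.rpow_le_rpow this (squareBound_le hn x) hq

/-- The average over all shifts of the `p`-th moments of the parts, pointwise. -/
lemma sum_shifts_le {p : ℝ} (hp2 : 2 ≤ p) (hp4 : p ≤ 4) {n M L : ℕ} [NeZero L] (hn : 1 ≤ n)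
    (e : Fin M × Fin L ≃ (Fin 2 → Fin n)) {b : (Fin 2 → Fin n) → ℂ} (hb : ∀ j, ‖b j‖ ≤ 1)
    (x : EuclideanSpace ℝ (Fin 3)) (j : Fin L) :
    ∑ s : Fin M → Fin L, ‖∑ k ∈ shiftPart e s j, b k * squareExt n k x‖ ^ p ≤
      (L : ℝ) ^ M * (4096 * ((L : ℝ) ^ (-p) * ‖∑ k, b k * squareExt n k x‖ ^ p +
        (L : ℝ) ^ (-(p / 2)) * squareBound n x ^ (p / 2) +
        (n : ℝ) ^ (4 - 2 * p) * (L : ℝ)⁻¹ * squareBound n x)) := by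
  have hn' : (0 : ℝ) < n := by exact_mod_cast hn
  have hL0 : 0 < L := Nat.pos_of_ne_zero (NeZero.ne L)
  have hL' : (0 : ℝ) < L := by exact_mod_cast hL0
  have hS := squareBound_nonneg n x
  have hterm : ∀ k, ‖b k * squareExt n k x‖ ≤ ‖squareExt n k x‖ := fun k ↦ by
    rw [norm_mul]; exact mul_le_of_le_one_left (norm_nonneg _) (hb k)
  -- Shifting by `j` permutes each group, so the mean and the variance bound are the same for every
  -- part.
  have hreindex : ∀ {E : Type} [AddCommMonoid E] (f : (Fin 2 → Fin n) → E),
      ∑ g, ∑ l, f (e (g, l + j)) = ∑ k, f k := by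
    intro E _ f
    rw [← Equiv.sum_comp e, Fintype.sum_prod_type]
    exact Finset.sum_congr rfl fun g _ ↦ Equiv.sum_comp (Equiv.addRight j) fun l ↦ f (e (g, l))
  have := moment_bound hp2 hp4 hL0 (fun g l ↦ b (e (g, l + j)) * squareExt n (e (g, l + j)) x)
    (m := 1 / (n : ℝ) ^ 2) (v := squareBound n x / L) (by positivity)
    (fun g l ↦ (hterm _).trans (norm_squareExt_le n _ x)) (by
      gcongr
      rw [hreindex fun k ↦ ‖b k * squareExt n k x‖ ^ 2]
      refine le_trans ?_ (sum_norm_sq_squareExt_le n x)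
      gcongr with k _
      exact hterm k)
  rw [hreindex fun k ↦ b k * squareExt n k x] at this
  refine (le_of_eq ?_).trans (this.trans (le_of_eq ?_))
  · refine Finset.sum_congr rfl fun s _ ↦ ?_
    simp [shiftPart]
  · rw [Real.div_rpow (norm_nonneg _) hL'.le, Real.div_rpow hS hL'.le, Real.rpow_neg hL'.le,
      Real.rpow_neg hL'.le]
    have : (1 / (n : ℝ) ^ 2) ^ (p - 2) = (n : ℝ) ^ (4 - 2 * p) := by
      rw [one_div, Real.inv_rpow (by positivity), ← Real.rpow_natCast, ← Real.rpow_mul hn'.le,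
        ← Real.rpow_neg hn'.le]
      congr 1; push_cast; ring
    rw [this]
    ring

/-- Averaging a decoupling inequality for step functions over all shifted partitions. -/
lemma step_inequality {W p : ℝ} (hW : 3 < W) (hp3 : 3 < p) (hp4 : p ≤ 4) :
    ∃ C : ℝ, 0 < C ∧ ∀ n M L : ℕ, 1 ≤ n → 1 ≤ M → n ^ 2 = M * L → ∀ κ : ℝ, 0 ≤ κ →
      (∀ pt : Finpartition (Finset.univ : Finset (Fin 2 → Fin n)),
        (∀ P ∈ pt.parts, P.card = M) → ∀ (c : EuclideanSpace ℝ (Fin 3))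
        (b : (Fin 2 → Fin n) → ℂ),
        ∫ x in Metric.ball c ((n : ℝ) ^ 2), ‖extension unitSquare (stepFun n b) x‖ ^ p
          ≤ κ * (L : ℝ) ^ (p / 2 - 1) * ∑ P ∈ pt.parts,
            ∫ x, ‖extension (ensemble n P) (stepFun n b) x‖ ^ p * ballWeight W ((n : ℝ) ^ 2) c x) →
      ∀ Q : ℝ, (∀ (c : EuclideanSpace ℝ (Fin 3)) (b : (Fin 2 → Fin n) → ℂ), (∀ j, ‖b j‖ ≤ 1) →
        ∫ x in Metric.ball c ((n : ℝ) ^ 2), ‖extension unitSquare (stepFun n b) x‖ ^ p ≤ Q) →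
      ∀ (c : EuclideanSpace ℝ (Fin 3)) (b : (Fin 2 → Fin n) → ℂ), (∀ j, ‖b j‖ ≤ 1) →
        ∫ x in Metric.ball c ((n : ℝ) ^ 2), ‖extension unitSquare (stepFun n b) x‖ ^ p ≤
          C * κ * ((L : ℝ) ^ (-(p / 2)) * Q + (n : ℝ) ^ (3 - p) +
            (L : ℝ) ^ (p / 2 - 1) * (n : ℝ) ^ (6 - 2 * p)) := by
  obtain ⟨C2, hC2, h2⟩ := integral_squareBound_rpow_le hW hp3
  obtain ⟨C3, hC3, h3⟩ := integral_squareBound_one_le hW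
  set C1 : ℝ := 2 ^ W * weightMass W / unitBallVolume with hC1d
  have hC1 : 0 ≤ C1 := by
    have := weightMass_nonneg W
    have := unitBallVolume_pos
    positivity
  refine ⟨4096 * (C1 + C2 + C3 + 1), by positivity, ?_⟩
  intro n M L hn hM hML κ hκ hdec Q hQ c b hb
  have hn' : (0 : ℝ) < n := by exact_mod_cast hn
  have hR : (0 : ℝ) < (n : ℝ) ^ 2 := by positivity
  have hL : 1 ≤ L := by
    rcases Nat.eq_zero_or_pos L with h | h
    · rw [h, mul_zero] at hML
      have : 0 < n ^ 2 := by positivity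
      omega
    · exact h
  have : NeZero L := ⟨by omega⟩
  have : NeZero M := ⟨by omega⟩
  have hL' : (0 : ℝ) < L := by exact_mod_cast hL
  have hp0 : 0 ≤ p := by linarith
  have hQ0 : 0 ≤ Q := (integral_nonneg fun x ↦ by positivity).trans (hQ c b hb)
  obtain ⟨e⟩ : Nonempty (Fin M × Fin L ≃ (Fin 2 → Fin n)) := by
    rw [← Fintype.card_eq]; simp [hML]
  set w := ballWeight W ((n : ℝ) ^ 2) c with hw
  have hw0 : ∀ x, 0 ≤ w x := ballWeight_nonneg W hR c
  set I := ∫ x in Metric.ball c ((n : ℝ) ^ 2), ‖extension unitSquare (stepFun n b) x‖ ^ p with hI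
  have hone : ∀ s : Fin M → Fin L, I ≤ κ * (L : ℝ) ^ (p / 2 - 1) *
      ∑ j, ∫ x, ‖∑ k ∈ shiftPart e s j, b k * squareExt n k x‖ ^ p * w x := by
    intro s
    have := hdec (shiftPartition e s) (fun P hP ↦ card_of_mem_shiftPartition e s hP) c b
    rw [sum_shiftPartition e s
      fun P ↦ ∫ x, ‖extension (ensemble n P) (stepFun n b) x‖ ^ p * w x] at this
    simpa only [extension_ensemble hn] using this
  have i1 : Integrable fun x ↦ ‖∑ k, b k * squareExt n k x‖ ^ p * w x :=
    integrable_norm_sum_squareExt_rpow hW hp0 hR hb Finset.univ c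
  have i2 : Integrable fun x ↦ squareBound n x ^ (p / 2) * w x :=
    integrable_squareBound_rpow hW (by linarith) hn hR c
  have i3 : Integrable fun x ↦ squareBound n x * w x := by
    simpa using integrable_squareBound_rpow hW zero_le_one hn hR c
  set A : ℝ := 4096 * ((L : ℝ) ^ (-p) * (C1 * Q) + (L : ℝ) ^ (-(p / 2)) * (C2 * (n : ℝ) ^ (3 - p)) +
    (n : ℝ) ^ (4 - 2 * p) * (L : ℝ)⁻¹ * (C3 * (n : ℝ) ^ 2)) with hA
  have hpart : ∀ j, ∑ s : Fin M → Fin L,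
      ∫ x, ‖∑ k ∈ shiftPart e s j, b k * squareExt n k x‖ ^ p * w x ≤ (L : ℝ) ^ M * A := by
    intro j
    rw [← integral_finsetSum _ fun s _ ↦ integrable_norm_sum_squareExt_rpow hW hp0 hR hb _ c]
    calc ∫ x, ∑ s : Fin M → Fin L, ‖∑ k ∈ shiftPart e s j, b k * squareExt n k x‖ ^ p * w x
        ≤ ∫ x, (L : ℝ) ^ M * (4096 * ((L : ℝ) ^ (-p) * (‖∑ k, b k * squareExt n k x‖ ^ p * w x) +
          (L : ℝ) ^ (-(p / 2)) * (squareBound n x ^ (p / 2) * w x) +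
          (n : ℝ) ^ (4 - 2 * p) * (L : ℝ)⁻¹ * (squareBound n x * w x))) := by
          refine integral_mono
            (integrable_finsetSum _ fun s _ ↦ integrable_norm_sum_squareExt_rpow hW hp0 hR hb _ c)
            (((((i1.const_mul _).add (i2.const_mul _)).add (i3.const_mul _)).const_mul _).const_mul _)
            fun x ↦ ?_
          simp only
          rw [← Finset.sum_mul]
          refine (mul_le_mul_of_nonneg_right
            (sum_shifts_le (by linarith) hp4 hn e hb x j) (hw0 x)).trans (le_of_eq ?_)
          ring
      _ = (L : ℝ) ^ M * (4096 * ((L : ℝ) ^ (-p) * (∫ x, ‖∑ k, b k * squareExt n k x‖ ^ p * w x) +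
          (L : ℝ) ^ (-(p / 2)) * (∫ x, squareBound n x ^ (p / 2) * w x) +
          (n : ℝ) ^ (4 - 2 * p) * (L : ℝ)⁻¹ * (∫ x, squareBound n x * w x))) := by
          rw [integral_const_mul, integral_const_mul, integral_add, integral_add, integral_const_mul,
            integral_const_mul, integral_const_mul]
          · exact i1.const_mul _
          · exact i2.const_mul _
          · exact (i1.const_mul _).add (i2.const_mul _)
          · exact i3.const_mul _
      _ ≤ (L : ℝ) ^ M * A := by
          rw [hA]
          gcongr
          -- The right side of decoupling carries a weight that is not supported in the ball. This
          -- is why `Q` must bound the integrals over balls with arbitrary centres.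
          · refine integral_mul_ballWeight_le hW hR c
              (continuous_norm_sum_squareExt_rpow hp0 b Finset.univ) (fun x ↦ by positivity)
              fun z ↦ ?_
            simpa only [extension_unitSquare hn] using hQ z b hb
          · exact h2 n hn c
          · exact h3 n hn c
  -- The left side is independent of the shift, so summing over all `L ^ M` shifts multiplies it by
  -- their number. The sum over the parts contributes a further factor `L`.
  have hsum : (L : ℝ) ^ M * I ≤ κ * (L : ℝ) ^ (p / 2 - 1) * (L * ((L : ℝ) ^ M * A)) := by
    calc (L : ℝ) ^ M * I = ∑ _s : Fin M → Fin L, I := by simp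
      _ ≤ ∑ s : Fin M → Fin L, κ * (L : ℝ) ^ (p / 2 - 1) *
          ∑ j, ∫ x, ‖∑ k ∈ shiftPart e s j, b k * squareExt n k x‖ ^ p * w x :=
          Finset.sum_le_sum fun s _ ↦ hone s
      _ = κ * (L : ℝ) ^ (p / 2 - 1) * ∑ j, ∑ s : Fin M → Fin L,
          ∫ x, ‖∑ k ∈ shiftPart e s j, b k * squareExt n k x‖ ^ p * w x := by
          rw [← Finset.mul_sum, Finset.sum_comm]
      _ ≤ κ * (L : ℝ) ^ (p / 2 - 1) * ∑ _j : Fin L, (L : ℝ) ^ M * A := by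
          gcongr with j _
          exact hpart j
      _ = _ := by simp
  have hfin : I ≤ κ * ((L : ℝ) ^ (p / 2) * A) := by
    have hLM : (0 : ℝ) < (L : ℝ) ^ M := by positivity
    refine le_of_mul_le_mul_left (hsum.trans (le_of_eq ?_)) hLM
    have : (L : ℝ) ^ (p / 2) = (L : ℝ) ^ (p / 2 - 1) * L := by
      rw [← Real.rpow_add_one hL'.ne']; congr 1; ring
    rw [this]; ring
  have hAe : (L : ℝ) ^ (p / 2) * A = 4096 * (C1 * ((L : ℝ) ^ (-(p / 2)) * Q) +
      C2 * (n : ℝ) ^ (3 - p) + C3 * ((L : ℝ) ^ (p / 2 - 1) * (n : ℝ) ^ (6 - 2 * p))) := by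
    have e1 : (L : ℝ) ^ (-(p / 2)) = (L : ℝ) ^ (p / 2) * (L : ℝ) ^ (-p) := by
      rw [← Real.rpow_add hL']; congr 1; ring
    have e2 : (L : ℝ) ^ (p / 2) * (L : ℝ) ^ (-(p / 2)) = 1 := by
      rw [← Real.rpow_add hL']; simp
    have e3 : (L : ℝ) ^ (p / 2 - 1) = (L : ℝ) ^ (p / 2) * (L : ℝ)⁻¹ := by
      rw [Real.rpow_sub_one hL'.ne', div_eq_mul_inv]
    have e4 : (n : ℝ) ^ (6 - 2 * p) = (n : ℝ) ^ (4 - 2 * p) * (n : ℝ) ^ 2 := by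
      rw [← Real.rpow_natCast (n : ℝ) 2, ← Real.rpow_add hn']; congr 1; push_cast; ring
    rw [hA, e3, e4]
    calc _ = 4096 * (C1 * (((L : ℝ) ^ (p / 2) * (L : ℝ) ^ (-p)) * Q) +
          C2 * (n : ℝ) ^ (3 - p) * ((L : ℝ) ^ (p / 2) * (L : ℝ) ^ (-(p / 2))) +
          C3 * ((L : ℝ) ^ (p / 2) * (L : ℝ)⁻¹ * ((n : ℝ) ^ (4 - 2 * p) * (n : ℝ) ^ 2))) := by ring
      _ = _ := by rw [e2, ← e1, mul_one]
  refine hfin.trans ?_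
  rw [hAe]
  set X := (L : ℝ) ^ (-(p / 2)) * Q with hX
  set Y := (n : ℝ) ^ (3 - p) with hY
  set Z := (L : ℝ) ^ (p / 2 - 1) * (n : ℝ) ^ (6 - 2 * p) with hZ
  have hX0 : 0 ≤ X := by positivity
  have hY0 : 0 ≤ Y := by positivity
  have hZ0 : 0 ≤ Z := by positivity
  calc κ * (4096 * (C1 * X + C2 * Y + C3 * Z))
      ≤ κ * (4096 * ((C1 + C2 + C3 + 1) * X + (C1 + C2 + C3 + 1) * Y + (C1 + C2 + C3 + 1) * Z)) := by
        gcongr <;> linarith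
    _ = _ := by ring

/-! ### Perturbation of the phase -/

/-- The extension operator with a general phase function in place of `(ξ, |ξ|²)`. -/
noncomputable def phaseExt (φ : EuclideanSpace ℝ (Fin 2) → Fin 3 → ℝ)
    (F : EuclideanSpace ℝ (Fin 2) → ℂ) (x : EuclideanSpace ℝ (Fin 3)) : ℂ :=
  ∫ ξ in unitSquare, F ξ * Complex.exp (2 * Real.pi * Complex.I * ((∑ i, φ ξ i * x i : ℝ) : ℂ))

/-- The phase function of the paraboloid. -/
noncomputable def paraboloid (ξ : EuclideanSpace ℝ (Fin 2)) : Fin 3 → ℝ := ![ξ 0, ξ 1, ‖ξ‖ ^ 2]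

lemma phaseExt_paraboloid (F : EuclideanSpace ℝ (Fin 2) → ℂ) :
    phaseExt paraboloid F = extension unitSquare F := by
  funext x
  simp [phaseExt, paraboloid, extension, Fin.sum_univ_three]

lemma measurable_paraboloid : Measurable paraboloid := by
  refine measurable_pi_iff.2 fun i ↦ ?_
  fin_cases i
  · exact (by fun_prop : Measurable fun ξ : EuclideanSpace ℝ (Fin 2) ↦ ξ 0)
  · exact (by fun_prop : Measurable fun ξ : EuclideanSpace ℝ (Fin 2) ↦ ξ 1)
  · exact (by fun_prop : Measurable fun ξ : EuclideanSpace ℝ (Fin 2) ↦ ‖ξ‖ ^ 2)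

instance isFiniteMeasure_unitSquare : IsFiniteMeasure (volume.restrict unitSquare) :=
  ⟨by simpa using isCompact_unitSquare.measure_lt_top⟩

lemma volume_unitSquare : volume.real unitSquare = 1 := by
  have h1 : unitSquare = (@WithLp.ofLp 2 (Fin 2 → ℝ)) ⁻¹' (Set.Icc (fun _ ↦ 0) (fun _ ↦ 1)) := by
    ext ξ; simp only [unitSquare, Set.mem_preimage, Set.mem_Icc, Pi.le_def]; exact forall_and
  rw [measureReal_def, h1, (PiLp.volume_preserving_ofLp (Fin 2)).measure_preimage
    measurableSet_Icc.nullMeasurableSet, Real.volume_Icc_pi]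
  simp

lemma integrable_phase {φ : EuclideanSpace ℝ (Fin 2) → Fin 3 → ℝ} (hφ : Measurable φ)
    {F : EuclideanSpace ℝ (Fin 2) → ℂ} (hF : Measurable F) {B : ℝ} (hB : ∀ ξ, ‖F ξ‖ ≤ B)
    (x : EuclideanSpace ℝ (Fin 3)) :
    IntegrableOn (fun ξ ↦ F ξ * Complex.exp (2 * Real.pi * Complex.I *
      ((∑ i, φ ξ i * x i : ℝ) : ℂ))) unitSquare := by
  refine Integrable.of_bound (C := B) (Measurable.aestronglyMeasurable (by fun_prop))
    (Filter.Eventually.of_forall fun ξ ↦ ?_)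
  rw [norm_mul, norm_exp_two_pi, mul_one]
  exact hB ξ

lemma norm_phaseExt_le {φ : EuclideanSpace ℝ (Fin 2) → Fin 3 → ℝ}
    {F : EuclideanSpace ℝ (Fin 2) → ℂ} (hB : ∀ ξ, ‖F ξ‖ ≤ 1)
    (x : EuclideanSpace ℝ (Fin 3)) : ‖phaseExt φ F x‖ ≤ 1 := by
  refine (norm_setIntegral_le_of_norm_le_const (C := 1) isCompact_unitSquare.measure_lt_top
    fun ξ _ ↦ ?_).trans (by rw [volume_unitSquare, mul_one])
  rw [norm_mul, norm_exp_two_pi, mul_one]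
  exact hB ξ

/-- Joint continuity of the extension operator along a segment of phases. -/
lemma continuous_phaseExt_segment {φ D : EuclideanSpace ℝ (Fin 2) → Fin 3 → ℝ} (hφ : Measurable φ)
    (hD : Measurable D) {F : EuclideanSpace ℝ (Fin 2) → ℂ} (hF : Measurable F)
    (hB : ∀ ξ, ‖F ξ‖ ≤ 1) :
    Continuous fun q : EuclideanSpace ℝ (Fin 3) × ℝ ↦
      phaseExt (fun ξ i ↦ φ ξ i + q.2 * D ξ i) F q.1 := by
  unfold phaseExt
  refine continuous_of_dominated (bound := fun _ ↦ 1) (fun q ↦ ?_) (fun q ↦ ?_) (by simp) ?_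
  · exact Measurable.aestronglyMeasurable (by fun_prop)
  · refine Filter.Eventually.of_forall fun ξ ↦ ?_
    rw [norm_mul, norm_exp_two_pi, mul_one]
    exact hB ξ
  · exact Filter.Eventually.of_forall fun ξ ↦ by fun_prop

lemma continuous_phaseExt {φ : EuclideanSpace ℝ (Fin 2) → Fin 3 → ℝ} (hφ : Measurable φ)
    {F : EuclideanSpace ℝ (Fin 2) → ℂ} (hF : Measurable F) (hB : ∀ ξ, ‖F ξ‖ ≤ 1) :
    Continuous (phaseExt φ F) := by
  have := (continuous_phaseExt_segment hφ (measurable_const (a := (0 : Fin 3 → ℝ))) hF hB).comp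
    (f := fun x : EuclideanSpace ℝ (Fin 3) ↦ (x, (0 : ℝ))) (by fun_prop)
  simpa [Function.comp_def] using this

lemma exp_sub_exp_eq_integral (A B : ℝ) :
    Complex.exp (2 * Real.pi * Complex.I * ((A + B : ℝ) : ℂ)) -
      Complex.exp (2 * Real.pi * Complex.I * (A : ℂ)) =
      ∫ s in Set.Icc (0 : ℝ) 1, 2 * Real.pi * Complex.I * B *
        Complex.exp (2 * Real.pi * Complex.I * ((A + s * B : ℝ) : ℂ)) := by
  have hd : ∀ s : ℝ, HasDerivAt
      (fun s : ℝ ↦ Complex.exp (2 * Real.pi * Complex.I * ((A + s * B : ℝ) : ℂ)))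
      (Complex.exp (2 * Real.pi * Complex.I * ((A + s * B : ℝ) : ℂ)) *
        (2 * Real.pi * Complex.I * (B : ℂ))) s := by
    intro s
    have h1 : HasDerivAt (fun s : ℝ ↦ A + s * B) B s := by
      simpa using ((hasDerivAt_id s).mul_const B).const_add A
    exact (h1.ofReal_comp.const_mul _).cexp
  have := intervalIntegral.integral_eq_sub_of_hasDerivAt (a := 0) (b := 1) (fun s _ ↦ hd s)
    (Continuous.intervalIntegrable (by fun_prop) _ _)
  rw [integral_Icc_eq_integral_Ioc, ← intervalIntegral.integral_of_le zero_le_one]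
  simp only [one_mul, zero_mul, add_zero] at this
  rw [← this]
  exact intervalIntegral.integral_congr fun s _ ↦ by ring

/-- The fundamental theorem of calculus along the segment `φ + sD`. The factor `D ξ i` brought down
by the derivative is moved into the amplitude, so that only extension operators appear. -/
lemma phaseExt_sub_eq {φ D : EuclideanSpace ℝ (Fin 2) → Fin 3 → ℝ} (hφ : Measurable φ)
    (hD : Measurable D) {δ : ℝ} (hδ : ∀ ξ i, |D ξ i| ≤ δ)
    {F : EuclideanSpace ℝ (Fin 2) → ℂ} (hF : Measurable F) (hB : ∀ ξ, ‖F ξ‖ ≤ 1)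
    (x : EuclideanSpace ℝ (Fin 3)) :
    phaseExt (fun ξ i ↦ φ ξ i + D ξ i) F x - phaseExt φ F x =
      ∫ s in Set.Icc (0 : ℝ) 1, ∑ i, 2 * Real.pi * Complex.I * x i *
        phaseExt (fun ξ i ↦ φ ξ i + s * D ξ i) (fun ξ ↦ F ξ * D ξ i) x := by
  have hDb : ∀ i ξ, ‖F ξ * (D ξ i : ℂ)‖ ≤ δ := fun i ξ ↦ by
    rw [norm_mul, Complex.norm_real, Real.norm_eq_abs]
    exact (mul_le_of_le_one_left (abs_nonneg _) (hB ξ)).trans (hδ ξ i)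
  have hinner : ∀ s : ℝ, ∑ i, 2 * Real.pi * Complex.I * x i *
        phaseExt (fun ξ i ↦ φ ξ i + s * D ξ i) (fun ξ ↦ F ξ * D ξ i) x =
      ∫ ξ in unitSquare, F ξ * (2 * Real.pi * Complex.I * ((∑ i, D ξ i * x i : ℝ) : ℂ) *
        Complex.exp (2 * Real.pi * Complex.I *
          (((∑ i, φ ξ i * x i) + s * ∑ i, D ξ i * x i : ℝ) : ℂ))) := by
    intro s
    unfold phaseExt
    simp_rw [← integral_const_mul]
    rw [← integral_finsetSum]
    · refine integral_congr_ae (Filter.Eventually.of_forall fun ξ ↦ ?_)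
      simp only
      have : ∑ i, (φ ξ i + s * D ξ i) * x i = (∑ i, φ ξ i * x i) + s * ∑ i, D ξ i * x i := by
        rw [Finset.mul_sum, ← Finset.sum_add_distrib]
        exact Finset.sum_congr rfl fun i _ ↦ by ring
      rw [this]
      push_cast
      simp only [Finset.mul_sum, Finset.sum_mul]
      exact Finset.sum_congr rfl fun i _ ↦ by ring
    · intro i _
      exact (integrable_phase (by fun_prop) (by fun_prop) (hDb i) x).const_mul _
  simp_rw [hinner]
  rw [integral_integral_swap]
  · unfold phaseExt
    rw [← integral_sub (integrable_phase (by fun_prop) hF hB x) (integrable_phase hφ hF hB x)]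
    refine integral_congr_ae (Filter.Eventually.of_forall fun ξ ↦ ?_)
    simp only
    rw [integral_const_mul, ← exp_sub_exp_eq_integral, mul_sub]
    simp only [add_mul, Finset.sum_add_distrib]
  · refine Integrable.of_bound (C := 2 * Real.pi * ∑ i, δ * |x i|)
      (Measurable.aestronglyMeasurable (by fun_prop)) (Filter.Eventually.of_forall fun q ↦ ?_)
    simp only [Function.uncurry]
    rw [norm_mul, norm_mul, norm_exp_two_pi, mul_one]
    refine (mul_le_of_le_one_left (norm_nonneg _) (hB _)).trans ?_
    rw [norm_mul, Complex.norm_real, Real.norm_eq_abs]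
    have e : ‖2 * (Real.pi : ℂ) * Complex.I‖ = 2 * Real.pi := by simp [abs_of_pos Real.pi_pos]
    rw [e]
    gcongr
    refine (Finset.abs_sum_le_sum_abs _ _).trans ?_
    gcongr with i _
    rw [abs_mul]
    gcongr
    exact hδ _ i

lemma sum_three_rpow_le {p : ℝ} (hp : 1 ≤ p) {a : Fin 3 → ℝ} (ha : ∀ i, 0 ≤ a i) :
    (∑ i, a i) ^ p ≤ 3 ^ (p - 1) * ∑ i, a i ^ p := by
  simpa using Real.rpow_sum_le_const_mul_sum_rpow_of_nonneg (s := Finset.univ) hp (fun i _ ↦ ha i)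

lemma integral_unit_rpow_le {p : ℝ} (hp : 1 ≤ p) {g : ℝ → ℝ} (hg : Continuous g)
    (hg0 : ∀ s, 0 ≤ g s) :
    (∫ s in Set.Icc (0 : ℝ) 1, g s) ^ p ≤ ∫ s in Set.Icc (0 : ℝ) 1, g s ^ p := by
  have : IsProbabilityMeasure (volume.restrict (Set.Icc (0 : ℝ) 1)) := ⟨by simp⟩
  refine (convexOn_rpow hp).map_integral_le (μ := volume.restrict (Set.Icc (0 : ℝ) 1)) ?_
    isClosed_Ici (Filter.Eventually.of_forall hg0) ?_ ?_
  · exact (Real.continuous_rpow_const (by linarith)).continuousOn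
  · exact hg.continuousOn.integrableOn_compact isCompact_Icc
  · exact (hg.rpow_const fun _ ↦ Or.inr (by linarith)).continuousOn.integrableOn_compact
      isCompact_Icc

lemma abs_coord_le_norm (x : EuclideanSpace ℝ (Fin 3)) (i : Fin 3) : |x i| ≤ ‖x‖ :=
  PiLp.norm_apply_le x i

/-- The amplitudes `G i` are `F * D i` normalized by `d`, so they are admissible inputs again; the
price is `d` times the size `r` of `x`. -/
lemma norm_phaseExt_sub_le {r d : ℝ} (hd : 0 ≤ d)
    {φ D : EuclideanSpace ℝ (Fin 2) → Fin 3 → ℝ} (hφ : Measurable φ) (hD : Measurable D)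
    (hDb : ∀ ξ i, |D ξ i| ≤ d) {F : EuclideanSpace ℝ (Fin 2) → ℂ} (hF : Measurable F)
    (hB : ∀ ξ, ‖F ξ‖ ≤ 1) {G : Fin 3 → EuclideanSpace ℝ (Fin 2) → ℂ} (hG : ∀ i, Measurable (G i))
    (hGb : ∀ i ξ, ‖G i ξ‖ ≤ 1) (hGF : ∀ i ξ, F ξ * (D ξ i : ℂ) = (d : ℂ) * G i ξ)
    {x : EuclideanSpace ℝ (Fin 3)} (hx : ‖x‖ ≤ r) :
    ‖phaseExt (fun ξ i ↦ φ ξ i + D ξ i) F x - phaseExt φ F x‖ ≤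
      (2 * Real.pi * d * r) * ∑ i, ∫ s in Set.Icc (0 : ℝ) 1,
        ‖phaseExt (fun ξ i ↦ φ ξ i + s * D ξ i) (G i) x‖ := by
  have hpi := Real.pi_pos
  have hcont : ∀ i, Continuous fun s : ℝ ↦ ‖phaseExt (fun ξ i ↦ φ ξ i + s * D ξ i) (G i) x‖ :=
    fun i ↦ ((continuous_phaseExt_segment hφ hD (hG i) (hGb i)).comp
      (f := fun s : ℝ ↦ (x, s)) (by fun_prop)).norm
  have e1 : ∀ i (s : ℝ), phaseExt (fun ξ i ↦ φ ξ i + s * D ξ i) (fun ξ ↦ F ξ * D ξ i) x =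
      (d : ℂ) * phaseExt (fun ξ i ↦ φ ξ i + s * D ξ i) (G i) x := by
    intro i s
    unfold phaseExt
    rw [← integral_const_mul]
    refine integral_congr_ae (Filter.Eventually.of_forall fun ξ ↦ ?_)
    simp only [hGF, mul_assoc]
  rw [phaseExt_sub_eq hφ hD hDb hF hB x,
    ← integral_finsetSum _ fun i _ ↦ (hcont i).integrableOn_Icc, ← integral_const_mul]
  refine norm_integral_le_of_norm_le ?_ (Filter.Eventually.of_forall fun s ↦ ?_)
  · exact Continuous.integrableOn_Icc
      (continuous_const.mul (continuous_finsetSum _ fun i _ ↦ hcont i))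
  · rw [Finset.mul_sum]
    refine norm_sum_le_of_le _ fun i _ ↦ ?_
    have e : ‖2 * (Real.pi : ℂ) * Complex.I‖ = 2 * Real.pi := by
      simp [abs_of_pos Real.pi_pos]
    rw [e1, norm_mul, norm_mul (2 * (Real.pi : ℂ) * Complex.I), norm_mul (d : ℂ), e,
      Complex.norm_real, Complex.norm_real, Real.norm_eq_abs, Real.norm_eq_abs, abs_of_nonneg hd]
    set N := ‖phaseExt (fun ξ i ↦ φ ξ i + s * D ξ i) (G i) x‖
    have hN : 0 ≤ N := norm_nonneg _
    calc 2 * Real.pi * |x i| * (d * N) ≤ 2 * Real.pi * r * (d * N) := by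
          gcongr
          exact (abs_coord_le_norm x i).trans hx
      _ = 2 * Real.pi * d * r * N := by ring

/-- Minkowski's inequality for averages over a segment and three summands. -/
lemma integral_ball_rpow_le {p r c X : ℝ} (hp : 1 ≤ p) (hc : 0 ≤ c)
    {H : Fin 3 → EuclideanSpace ℝ (Fin 3) × ℝ → ℝ} (hH : ∀ i, Continuous (H i))
    (hH0 : ∀ i q, 0 ≤ H i q) (hH1 : ∀ i q, H i q ≤ 1) {f : EuclideanSpace ℝ (Fin 3) → ℝ}
    (hf : Continuous f) (hf0 : ∀ x, 0 ≤ f x)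
    (hfH : ∀ x ∈ Metric.ball (0 : EuclideanSpace ℝ (Fin 3)) r,
      f x ≤ c * ∑ i, ∫ s in Set.Icc (0 : ℝ) 1, H i (x, s))
    (hX : ∀ i, ∀ s ∈ Set.Icc (0 : ℝ) 1, ∫ x in Metric.ball 0 r, H i (x, s) ^ p ≤ X) :
    ∫ x in Metric.ball 0 r, f x ^ p ≤ (3 * c) ^ p * X := by
  have hp0 : 0 ≤ p := by linarith
  have hHx : ∀ i x, Continuous fun s ↦ H i (x, s) := fun i x ↦ (hH i).comp (by fun_prop)
  have hpt : ∀ x ∈ Metric.ball (0 : EuclideanSpace ℝ (Fin 3)) r,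
      f x ^ p ≤ c ^ p * (3 ^ (p - 1) * ∑ i, ∫ s in Set.Icc (0 : ℝ) 1, H i (x, s) ^ p) := by
    intro x hx
    have hI0 : ∀ i, 0 ≤ ∫ s in Set.Icc (0 : ℝ) 1, H i (x, s) :=
      fun i ↦ integral_nonneg fun s ↦ hH0 _ _
    calc f x ^ p ≤ (c * ∑ i, ∫ s in Set.Icc (0 : ℝ) 1, H i (x, s)) ^ p :=
          Real.rpow_le_rpow (hf0 x) (hfH x hx) hp0
      _ = c ^ p * (∑ i, ∫ s in Set.Icc (0 : ℝ) 1, H i (x, s)) ^ p :=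
          Real.mul_rpow hc (Finset.sum_nonneg fun i _ ↦ hI0 i)
      _ ≤ _ := by
          gcongr
          refine (sum_three_rpow_le hp hI0).trans ?_
          gcongr with i _
          exact integral_unit_rpow_le hp (hHx i x) fun s ↦ hH0 _ _
  have hHp : ∀ i, Continuous fun q ↦ H i q ^ p := fun i ↦ (hH i).rpow_const fun _ ↦ Or.inr hp0
  have hint2 : ∀ i, Integrable (fun q ↦ H i q ^ p)
      ((volume.restrict (Metric.ball (0 : EuclideanSpace ℝ (Fin 3)) r)).prod
        (volume.restrict (Set.Icc (0 : ℝ) 1))) := by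
    intro i
    have : IsFiniteMeasure (volume.restrict (Metric.ball (0 : EuclideanSpace ℝ (Fin 3)) r)) :=
      ⟨by simpa only [Measure.restrict_apply_univ] using measure_ball_lt_top⟩
    refine Integrable.of_bound (C := 1) (hHp i).aestronglyMeasurable
      (Filter.Eventually.of_forall fun q ↦ ?_)
    have := hH0 i q
    rw [Real.norm_eq_abs, abs_of_nonneg (by positivity)]
    exact Real.rpow_le_one this (hH1 i q) hp0
  calc ∫ x in Metric.ball 0 r, f x ^ p
      ≤ ∫ x in Metric.ball 0 r, c ^ p *
        (3 ^ (p - 1) * ∑ i, ∫ s in Set.Icc (0 : ℝ) 1, H i (x, s) ^ p) := by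
        refine setIntegral_mono_on ?_ ?_ measurableSet_ball hpt
        · exact ((hf.rpow_const fun _ ↦ Or.inr hp0).continuousOn.integrableOn_compact
            (isCompact_closedBall 0 r)).mono_set Metric.ball_subset_closedBall
        · exact ((integrable_finsetSum _ fun i _ ↦
            (hint2 i).integral_prod_left).const_mul _).const_mul _
    _ = c ^ p * (3 ^ (p - 1) * ∑ i, ∫ s in Set.Icc (0 : ℝ) 1,
          ∫ x in Metric.ball 0 r, H i (x, s) ^ p) := by
        rw [integral_const_mul, integral_const_mul,
          integral_finsetSum _ fun i _ ↦ (hint2 i).integral_prod_left]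
        congr 2
        refine Finset.sum_congr rfl fun i _ ↦ ?_
        exact integral_integral_swap (f := fun x s ↦ H i (x, s) ^ p) (hint2 i)
    _ ≤ c ^ p * (3 ^ (p - 1) * ∑ _i : Fin 3, X) := by
        gcongr with i _
        calc ∫ s in Set.Icc (0 : ℝ) 1, ∫ x in Metric.ball 0 r, H i (x, s) ^ p
            ≤ ∫ _s in Set.Icc (0 : ℝ) 1, X :=
              setIntegral_mono_on (hint2 i).integral_prod_right (by simp) measurableSet_Icc
                fun s hs ↦ hX i s hs
          _ = X := by simp
    _ = (3 * c) ^ p * X := by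
        rw [Real.mul_rpow (by norm_num) hc, Real.rpow_sub_one (by norm_num)]
        simp only [Finset.sum_const, Finset.card_univ, Fintype.card_fin, nsmul_eq_mul]
        push_cast
        ring

/-- Changing the phase by a small amount changes the extension operator by a small multiple of its
size. -/
lemma integral_phaseExt_sub_le {p r d X : ℝ} (hp : 1 ≤ p) (hr : 0 < r) (hd : 0 < d)
    (hX : ∀ (φ : EuclideanSpace ℝ (Fin 2) → Fin 3 → ℝ) (F : EuclideanSpace ℝ (Fin 2) → ℂ),
      Measurable φ → (∀ ξ i, |φ ξ i - paraboloid ξ i| ≤ d) → Measurable F → (∀ ξ, ‖F ξ‖ ≤ 1) →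
      ∫ x in Metric.ball 0 r, ‖phaseExt φ F x‖ ^ p ≤ X)
    {φ ψ : EuclideanSpace ℝ (Fin 2) → Fin 3 → ℝ} (hφ : Measurable φ) (hψ : Measurable ψ)
    (hφd : ∀ ξ i, |φ ξ i - paraboloid ξ i| ≤ d) (hψd : ∀ ξ i, |ψ ξ i - paraboloid ξ i| ≤ d)
    {F : EuclideanSpace ℝ (Fin 2) → ℂ} (hF : Measurable F) (hB : ∀ ξ, ‖F ξ‖ ≤ 1) :
    ∫ x in Metric.ball 0 r, ‖phaseExt φ F x - phaseExt ψ F x‖ ^ p ≤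
      (12 * Real.pi * d * r) ^ p * X := by
  have hpi := Real.pi_pos
  obtain ⟨D, hDdef⟩ : ∃ D : EuclideanSpace ℝ (Fin 2) → Fin 3 → ℝ, ∀ ξ i, D ξ i = φ ξ i - ψ ξ i :=
    ⟨_, fun _ _ ↦ rfl⟩
  have hD : Measurable D := by
    have : D = fun ξ i ↦ φ ξ i - ψ ξ i := by funext ξ i; exact hDdef ξ i
    rw [this]; fun_prop
  have hDb : ∀ ξ i, |D ξ i| ≤ 2 * d := fun ξ i ↦ by
    have := abs_sub_le (φ ξ i) (paraboloid ξ i) (ψ ξ i)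
    rw [abs_sub_comm (paraboloid ξ i)] at this
    rw [hDdef]
    linarith [hφd ξ i, hψd ξ i]
  obtain ⟨G, hGdef⟩ : ∃ G : Fin 3 → EuclideanSpace ℝ (Fin 2) → ℂ, ∀ i ξ,
      G i ξ = F ξ * ((D ξ i / (2 * d) : ℝ) : ℂ) := ⟨_, fun _ _ ↦ rfl⟩
  have hG : ∀ i, Measurable (G i) := fun i ↦ by
    have : G i = fun ξ ↦ F ξ * ((D ξ i / (2 * d) : ℝ) : ℂ) := funext (hGdef i)
    rw [this]; fun_prop
  have hGb : ∀ i ξ, ‖G i ξ‖ ≤ 1 := fun i ξ ↦ by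
    rw [hGdef, norm_mul, Complex.norm_real, Real.norm_eq_abs, abs_div]
    refine mul_le_one₀ (hB ξ) (by positivity) ?_
    rw [abs_of_pos (by positivity : 0 < 2 * d), div_le_one (by positivity)]
    exact hDb ξ i
  have hGF : ∀ i ξ, F ξ * (D ξ i : ℂ) = ((2 * d : ℝ) : ℂ) * G i ξ := fun i ξ ↦ by
    have : (d : ℂ) ≠ 0 := by exact_mod_cast hd.ne'
    rw [hGdef]; push_cast; field_simp
  have hφe : (fun ξ i ↦ ψ ξ i + D ξ i) = φ := by funext ξ i; rw [hDdef]; ring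
  -- The admissible phases form a convex set, so the whole segment from `ψ` to `φ` obeys the
  -- hypothesis `hX`.
  have hXs : ∀ i, ∀ s ∈ Set.Icc (0 : ℝ) 1,
      ∫ x in Metric.ball 0 r, ‖phaseExt (fun ξ i ↦ ψ ξ i + s * D ξ i) (G i) x‖ ^ p ≤ X := by
    intro i s hs
    refine hX (fun ξ i ↦ ψ ξ i + s * D ξ i) (G i) (by fun_prop) (fun ξ k ↦ ?_) (hG i) (hGb i)
    have : ψ ξ k + s * D ξ k - paraboloid ξ k =
        (1 - s) * (ψ ξ k - paraboloid ξ k) + s * (φ ξ k - paraboloid ξ k) := by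
      rw [hDdef]; ring
    rw [this]
    refine (abs_add_le _ _).trans ?_
    rw [abs_mul, abs_mul, abs_of_nonneg hs.1, abs_of_nonneg (sub_nonneg.2 hs.2)]
    nlinarith [mul_le_mul_of_nonneg_left (hψd ξ k) (sub_nonneg.2 hs.2),
      mul_le_mul_of_nonneg_left (hφd ξ k) hs.1]
  -- The phases `φ` and `ψ` differ by up to `2d`; this doubling and the three coordinates turn `2π`
  -- into `12π`.
  have := integral_ball_rpow_le (r := r) (c := 2 * Real.pi * (2 * d) * r) hp (by positivity)
    (H := fun i q ↦ ‖phaseExt (fun ξ i ↦ ψ ξ i + q.2 * D ξ i) (G i) q.1‖)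
    (fun i ↦ (continuous_phaseExt_segment hψ hD (hG i) (hGb i)).norm) (fun _ _ ↦ norm_nonneg _)
    (fun i q ↦ norm_phaseExt_le (hGb i) _)
    (f := fun x ↦ ‖phaseExt φ F x - phaseExt ψ F x‖)
    ((continuous_phaseExt hφ hF hB).sub (continuous_phaseExt hψ hF hB)).norm
    (fun _ ↦ norm_nonneg _) (fun x hx ↦ by
      have := norm_phaseExt_sub_le (by positivity) hψ hD hDb hF hB hG hGb hGF
        (mem_ball_zero_iff.1 hx).le
      rwa [hφe] at this) hXs
  refine this.trans (le_of_eq ?_)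
  congr 2
  ring

/-! ### Reduction from bounded functions to step functions -/

/-- The lower left corner of the `j`-th canonical square. -/
noncomputable def corner (n : ℕ) (j : Fin 2 → Fin n) : EuclideanSpace ℝ (Fin 2) :=
  WithLp.toLp 2 fun i ↦ ((j i : ℕ) : ℝ) / n

/-- The phase which is constant on each canonical square and agrees with that of the paraboloid at
the corners. -/
noncomputable def stepPhase (n : ℕ) (ξ : EuclideanSpace ℝ (Fin 2)) (i : Fin 3) : ℝ :=
  paraboloid ξ i + ∑ j, (halfOpenSquare n j).indicator
    (fun ξ ↦ paraboloid (corner n j) i - paraboloid ξ i) ξ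

lemma stepPhase_of_mem {n : ℕ} {j : Fin 2 → Fin n} {ξ : EuclideanSpace ℝ (Fin 2)}
    (h : ξ ∈ halfOpenSquare n j) : stepPhase n ξ = paraboloid (corner n j) := by
  funext i
  unfold stepPhase
  rw [Finset.sum_eq_single j]
  · rw [Set.indicator_of_mem h]; ring
  · intro k _ hk
    exact Set.indicator_of_notMem (fun h' ↦ hk (eq_of_mem_halfOpenSquare h' h)) _
  · simp

lemma measurable_stepPhase (n : ℕ) : Measurable (stepPhase n) := by
  have := measurable_paraboloid
  refine measurable_pi_iff.2 fun i ↦ ?_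
  unfold stepPhase
  refine Measurable.add (by fun_prop) (Finset.measurable_fun_sum _ fun j _ ↦ ?_)
  exact Measurable.indicator (by fun_prop) (measurableSet_halfOpenSquare n j)

/-- Passing to the corner moves each coordinate by at most `1/n` and each of the two squares in
`|ξ|²` by at most `2/n`. Off the canonical squares nothing changes, so the bound is global. -/
lemma stepPhase_close {n : ℕ} (hn : 1 ≤ n) (ξ : EuclideanSpace ℝ (Fin 2)) (i : Fin 3) :
    |stepPhase n ξ i - paraboloid ξ i| ≤ 4 / n := by
  have hn' : (0 : ℝ) < n := by exact_mod_cast hn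
  by_cases h : ∃ j, ξ ∈ halfOpenSquare n j
  · obtain ⟨j, hj⟩ := h
    rw [stepPhase_of_mem hj]
    set a : Fin 2 → ℝ := fun k ↦ ((j k : ℕ) : ℝ) / n with ha
    have h1 : ∀ k, a k ≤ ξ k ∧ ξ k ≤ a k + 1 / n := fun k ↦ by
      have := hj k
      rw [add_div] at this
      exact ⟨this.1, this.2.le⟩
    have h2 : ∀ k, 0 ≤ a k ∧ a k + 1 / n ≤ 1 := fun k ↦ by
      refine ⟨by positivity, ?_⟩
      rw [ha, ← add_div, div_le_one hn']
      exact_mod_cast (j k).2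
    set h := 1 / (n : ℝ) with hh
    have h3 : 4 / (n : ℝ) = 4 * h := by rw [hh]; ring
    have hc : ∀ k, corner n j k = a k := fun k ↦ rfl
    have h0 : 0 < h := by positivity
    rw [h3, abs_le]
    fin_cases i
    · simp only [paraboloid, hc, Fin.zero_eta, Matrix.cons_val_zero]
      constructor <;> linarith [(h1 0).1, (h1 0).2]
    · simp only [paraboloid, hc, Fin.mk_one, Matrix.cons_val_one, Matrix.cons_val_zero]
      constructor <;> linarith [(h1 1).1, (h1 1).2]
    · simp only [paraboloid, Fin.reduceFinMk, Matrix.cons_val]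
      rw [EuclideanSpace.real_norm_sq_eq, EuclideanSpace.real_norm_sq_eq, Fin.sum_univ_two,
        Fin.sum_univ_two]
      simp only [hc]
      have key : ∀ k, 0 ≤ ξ k ^ 2 - a k ^ 2 ∧ ξ k ^ 2 - a k ^ 2 ≤ 2 * h := fun k ↦ by
        obtain ⟨b1, b2⟩ := h1 k
        obtain ⟨b3, b4⟩ := h2 k
        constructor <;> nlinarith
      constructor <;> linarith [(key 0).1, (key 0).2, (key 1).1, (key 1).2]
  · push Not at h
    unfold stepPhase
    rw [Finset.sum_eq_zero fun j _ ↦ Set.indicator_of_notMem (h j) _]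
    simp only [add_zero, sub_self, abs_zero]
    positivity

lemma integral_unitSquare_eq_sum {n : ℕ} (hn : 1 ≤ n) {f : EuclideanSpace ℝ (Fin 2) → ℂ}
    (hf : IntegrableOn f unitSquare) :
    ∫ ξ in unitSquare, f ξ = ∑ j : Fin 2 → Fin n, ∫ ξ in halfOpenSquare n j, f ξ := by
  have hae : (⋃ j ∈ (Finset.univ : Finset (Fin 2 → Fin n)), halfOpenSquare n j) =ᵐ[volume]
      unitSquare := by
    rw [unitSquare_eq_ensemble hn]
    exact Filter.EventuallyEq.countable_bUnion (Finset.countable_toSet _)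
      fun j _ ↦ halfOpenSquare_ae_eq n j
  rw [← Measure.restrict_congr_set hae]
  refine integral_biUnion_finset _ (fun j _ ↦ measurableSet_halfOpenSquare n j)
    (fun j _ k _ hjk ↦ Set.disjoint_left.2 fun ξ h1 h2 ↦ hjk (eq_of_mem_halfOpenSquare h1 h2))
    fun j _ ↦ hf.mono_set ?_
  rw [unitSquare_eq_ensemble hn]
  exact Set.Subset.trans (fun ξ hξ i ↦ Set.Ico_subset_Icc_self (hξ i))
    (Set.subset_biUnion_of_mem (u := canonicalSquare n) (Finset.mem_univ j))

/-- With the step phase, a function may be replaced by its averages over the canonical squares. -/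
lemma exists_step_phaseExt_eq {n : ℕ} (hn : 1 ≤ n) {F : EuclideanSpace ℝ (Fin 2) → ℂ}
    (hF : Measurable F) (hB : ∀ ξ, ‖F ξ‖ ≤ 1) :
    ∃ b : (Fin 2 → Fin n) → ℂ, (∀ j, ‖b j‖ ≤ 1) ∧
      ∀ x, phaseExt (stepPhase n) F x = phaseExt (stepPhase n) (stepFun n b) x := by
  have hfin : ∀ j : Fin 2 → Fin n, volume (halfOpenSquare n j) < ⊤ := fun j ↦ by
    refine (measure_mono ?_).trans_lt isCompact_unitSquare.measure_lt_top
    rw [unitSquare_eq_ensemble hn]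
    exact Set.Subset.trans (fun ξ hξ i ↦ Set.Ico_subset_Icc_self (hξ i))
      (Set.subset_biUnion_of_mem (u := canonicalSquare n) (Finset.mem_univ j))
  have hnorm : ∀ j : Fin 2 → Fin n,
      ‖∫ ξ in halfOpenSquare n j, F ξ‖ ≤ volume.real (halfOpenSquare n j) := fun j ↦ by
    simpa using norm_setIntegral_le_of_norm_le_const (C := 1) (hfin j) fun ξ _ ↦ hB ξ
  refine ⟨fun j ↦ (∫ ξ in halfOpenSquare n j, F ξ) / volume.real (halfOpenSquare n j),
    fun j ↦ ?_, fun x ↦ ?_⟩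
  · rw [norm_div, Complex.norm_real, Real.norm_eq_abs, abs_of_nonneg measureReal_nonneg]
    exact div_le_one_of_le₀ (hnorm j) measureReal_nonneg
  · set b : (Fin 2 → Fin n) → ℂ := fun j ↦
      (∫ ξ in halfOpenSquare n j, F ξ) / volume.real (halfOpenSquare n j) with hb
    have hstep : ∀ ξ, ‖stepFun n b ξ‖ ≤ ∑ j, ‖b j‖ := norm_stepFun_le (by positivity)
      fun j ↦ Finset.single_le_sum (f := fun j ↦ ‖b j‖) (fun _ _ ↦ norm_nonneg _) (Finset.mem_univ j)
    unfold phaseExt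
    rw [integral_unitSquare_eq_sum hn (integrable_phase (measurable_stepPhase n) hF hB x),
      integral_unitSquare_eq_sum hn
        (integrable_phase (measurable_stepPhase n) (measurable_stepFun n b) hstep x)]
    refine Finset.sum_congr rfl fun j _ ↦ ?_
    set z := Complex.exp (2 * Real.pi * Complex.I *
      ((∑ i, paraboloid (corner n j) i * x i : ℝ) : ℂ)) with hz
    have e1 : ∫ ξ in halfOpenSquare n j, F ξ * Complex.exp (2 * Real.pi * Complex.I *
        ((∑ i, stepPhase n ξ i * x i : ℝ) : ℂ)) = (∫ ξ in halfOpenSquare n j, F ξ) * z := by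
      rw [← integral_mul_const]
      refine setIntegral_congr_fun (measurableSet_halfOpenSquare n j) fun ξ hξ ↦ ?_
      simp only [stepPhase_of_mem hξ, hz]
    have e2 : ∫ ξ in halfOpenSquare n j, stepFun n b ξ * Complex.exp (2 * Real.pi * Complex.I *
        ((∑ i, stepPhase n ξ i * x i : ℝ) : ℂ)) = volume.real (halfOpenSquare n j) * (b j * z) := by
      rw [setIntegral_congr_fun (g := fun _ ↦ b j * z) (measurableSet_halfOpenSquare n j)
        fun ξ hξ ↦ by simp only [stepPhase_of_mem hξ, stepFun_of_mem hξ, hz]]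
      rw [setIntegral_const, Complex.real_smul]
    rw [e1, e2, hb]
    rcases eq_or_ne (volume.real (halfOpenSquare n j)) 0 with h | h
    · have : ∫ ξ in halfOpenSquare n j, F ξ = 0 := by
        have := hnorm j
        rw [h] at this
        exact norm_le_zero_iff.1 this
      simp [this, h]
    · have : (volume.real (halfOpenSquare n j) : ℂ) ≠ 0 := by exact_mod_cast h
      simp only
      field_simp

/-- On a ball whose radius is a small multiple of `n`, the extension of a bounded function is
controlled by those of step functions. -/
lemma integral_extension_le_of_step {p r : ℝ} (hp : 1 ≤ p) (hr : 0 < r) {n : ℕ}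
    (hn : 1000 * r ≤ n) {Q : ℝ}
    (hQ : ∀ b : (Fin 2 → Fin n) → ℂ, (∀ j, ‖b j‖ ≤ 1) →
      ∫ x in Metric.ball 0 r, ‖extension unitSquare (stepFun n b) x‖ ^ p ≤ Q)
    {F : EuclideanSpace ℝ (Fin 2) → ℂ} (hF : Measurable F) (hB : ∀ ξ, ‖F ξ‖ ≤ 1) :
    ∫ x in Metric.ball 0 r, ‖extension unitSquare F x‖ ^ p ≤ 2 * 3 ^ (p - 1) * Q := by
  have hp0 : 0 ≤ p := by linarith
  have hn' : (0 : ℝ) < n := by linarith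
  have hn1 : 1 ≤ n := by exact_mod_cast Nat.pos_of_ne_zero (by rintro rfl; simp at hn')
  have hd : (0 : ℝ) < 4 / n := by positivity
  have hcont : ∀ {φ : EuclideanSpace ℝ (Fin 2) → Fin 3 → ℝ} {F : EuclideanSpace ℝ (Fin 2) → ℂ},
      Measurable φ → Measurable F → (∀ ξ, ‖F ξ‖ ≤ 1) → Continuous (phaseExt φ F) :=
    fun h1 h2 h3 ↦ continuous_phaseExt h1 h2 h3
  have hint : ∀ {f : EuclideanSpace ℝ (Fin 3) → ℂ}, Continuous f →
      IntegrableOn (fun x ↦ ‖f x‖ ^ p) (Metric.ball 0 r) := fun {f} hf ↦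
    ((hf.norm.rpow_const fun _ ↦ Or.inr hp0).continuousOn.integrableOn_compact
      (isCompact_closedBall 0 r)).mono_set Metric.ball_subset_closedBall
  -- The supremum runs over all nearby phases and not only the paraboloid, since the perturbation
  -- estimate for one phase involves the others.
  set S : Set ℝ := {y | ∃ (φ : EuclideanSpace ℝ (Fin 2) → Fin 3 → ℝ)
    (F : EuclideanSpace ℝ (Fin 2) → ℂ), Measurable φ ∧
    (∀ ξ i, |φ ξ i - paraboloid ξ i| ≤ 4 / n) ∧ Measurable F ∧ (∀ ξ, ‖F ξ‖ ≤ 1) ∧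
    y = ∫ x in Metric.ball 0 r, ‖phaseExt φ F x‖ ^ p} with hS
  have hSb : BddAbove S := by
    refine ⟨volume.real (Metric.ball (0 : EuclideanSpace ℝ (Fin 3)) r), ?_⟩
    rintro y ⟨φ, F, hφ, -, hF, hB, rfl⟩
    calc ∫ x in Metric.ball 0 r, ‖phaseExt φ F x‖ ^ p ≤ ∫ _x in Metric.ball
          (0 : EuclideanSpace ℝ (Fin 3)) r, (1 : ℝ) :=
          setIntegral_mono (hint (hcont hφ hF hB))
            (integrableOn_const measure_ball_lt_top.ne)
            fun x ↦ Real.rpow_le_one (norm_nonneg _) (norm_phaseExt_le hB x) hp0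
      _ = _ := by simp
  have hmem : (∫ x in Metric.ball 0 r, ‖extension unitSquare F x‖ ^ p) ∈ S :=
    ⟨paraboloid, F, measurable_paraboloid, fun ξ i ↦ by simpa using hd.le, hF, hB,
      by rw [phaseExt_paraboloid]⟩
  set X := sSup S with hXdef
  have hX : ∀ (φ : EuclideanSpace ℝ (Fin 2) → Fin 3 → ℝ) (F : EuclideanSpace ℝ (Fin 2) → ℂ),
      Measurable φ → (∀ ξ i, |φ ξ i - paraboloid ξ i| ≤ 4 / n) → Measurable F →
      (∀ ξ, ‖F ξ‖ ≤ 1) → ∫ x in Metric.ball 0 r, ‖phaseExt φ F x‖ ^ p ≤ X :=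
    fun φ F h1 h2 h3 h4 ↦ le_csSup hSb ⟨φ, F, h1, h2, h3, h4, rfl⟩
  have hX0 : 0 ≤ X := (integral_nonneg fun x ↦ by positivity).trans (le_csSup hSb hmem)
  -- With `n ≥ 1000 r`, each perturbation factor is at most `48π/1000 ≤ 1/6`. This makes the two
  -- phase changes below absorbable.
  have hsmall : 3 ^ (p - 1) * (2 * (12 * Real.pi * (4 / n) * r) ^ p) ≤ 1 / 2 := by
    have hpi := Real.pi_lt_d2
    have hpi0 := Real.pi_pos
    have h1 : 12 * Real.pi * (4 / n) * r ≤ 1 / 6 := by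
      have : 12 * Real.pi * (4 / n) * r = 48 * Real.pi * r / n := by ring
      rw [this, div_le_iff₀ hn']
      nlinarith
    have h2 : (12 * Real.pi * (4 / n) * r) ^ p ≤ (1 / 6) ^ p := by gcongr
    have h3 : (3 : ℝ) ^ (p - 1) * (1 / 6) ^ p ≤ 1 / 6 := by
      have : (1 / 6 : ℝ) ^ p = (1 / 3) ^ p * (1 / 2) ^ p := by
        rw [← Real.mul_rpow (by norm_num) (by norm_num)]; norm_num
      have h4 : (1 / 2 : ℝ) ^ p ≤ 1 / 2 := by
        calc (1 / 2 : ℝ) ^ p ≤ (1 / 2) ^ (1 : ℝ) :=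
              Real.rpow_le_rpow_of_exponent_ge (by norm_num) (by norm_num) hp
          _ = 1 / 2 := by norm_num
      have h5 : (3 : ℝ) ^ (p - 1) * (1 / 3) ^ p = 1 / 3 := by
        rw [Real.rpow_sub_one (by norm_num), one_div, Real.inv_rpow (by norm_num)]
        field_simp
      rw [this, ← mul_assoc, h5]
      linarith
    calc _ ≤ (3 : ℝ) ^ (p - 1) * (2 * (1 / 6) ^ p) := by gcongr
      _ = 2 * ((3 : ℝ) ^ (p - 1) * (1 / 6) ^ p) := by ring
      _ ≤ 1 / 2 := by linarith
  have hstep : ∀ y ∈ S, y ≤ X / 2 + 3 ^ (p - 1) * Q := by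
    rintro y ⟨φ, F, hφ, hφd, hF, hB, rfl⟩
    obtain ⟨b, hb, hbeq⟩ := exists_step_phaseExt_eq hn1 hF hB
    have hG := measurable_stepFun n b
    have hGB := norm_stepFun_le zero_le_one hb
    have hψ := measurable_stepPhase n
    have hψd := stepPhase_close hn1
    have d1 := integral_phaseExt_sub_le hp hr hd hX hφ hψ hφd hψd hF hB
    have d2 := integral_phaseExt_sub_le hp hr hd hX hψ measurable_paraboloid hψd
      (fun ξ i ↦ by simpa using hd.le) hG hGB
    have d3 := hQ b hb
    rw [← phaseExt_paraboloid] at d3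
    set f1 := fun x ↦ phaseExt φ F x - phaseExt (stepPhase n) F x with hf1
    set f2 := fun x ↦ phaseExt (stepPhase n) (stepFun n b) x - phaseExt paraboloid (stepFun n b) x
      with hf2
    set f3 := phaseExt paraboloid (stepFun n b) with hf3
    have c1 : Continuous f1 := (hcont hφ hF hB).sub (hcont hψ hF hB)
    have c2 : Continuous f2 := (hcont hψ hG hGB).sub (hcont measurable_paraboloid hG hGB)
    have c3 : Continuous f3 := hcont measurable_paraboloid hG hGB
    have c12 : IntegrableOn (fun x ↦ ‖f1 x‖ ^ p + ‖f2 x‖ ^ p) (Metric.ball 0 r) :=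
      (hint c1).add (hint c2)
    -- The chain is: `φ` to the step phase, `F` to its averages at no cost, then the step phase back
    -- to the paraboloid, where `hQ` applies.
    calc ∫ x in Metric.ball 0 r, ‖phaseExt φ F x‖ ^ p
        ≤ ∫ x in Metric.ball 0 r, 3 ^ (p - 1) * (‖f1 x‖ ^ p + ‖f2 x‖ ^ p + ‖f3 x‖ ^ p) := by
          refine setIntegral_mono (hint (hcont hφ hF hB))
            ((c12.add (hint c3)).const_mul _) fun x ↦ ?_
          have e : phaseExt φ F x = f1 x + f2 x + f3 x := by
            simp only [hf1, hf2, hf3, hbeq]; ring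
          have := sum_three_rpow_le hp (a := ![‖f1 x‖, ‖f2 x‖, ‖f3 x‖])
            (by intro i; fin_cases i <;> simp)
          simp only [Fin.sum_univ_three, Matrix.cons_val_zero, Matrix.cons_val_one,
            Matrix.cons_val] at this
          refine le_trans ?_ this
          simp only
          gcongr
          rw [e]
          exact norm_add₃_le
      _ = 3 ^ (p - 1) * ((∫ x in Metric.ball 0 r, ‖f1 x‖ ^ p) +
            (∫ x in Metric.ball 0 r, ‖f2 x‖ ^ p) + ∫ x in Metric.ball 0 r, ‖f3 x‖ ^ p) := by
          rw [integral_const_mul, integral_add c12 (hint c3),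
            integral_add (hint c1) (hint c2)]
      _ ≤ 3 ^ (p - 1) * ((12 * Real.pi * (4 / n) * r) ^ p * X +
            (12 * Real.pi * (4 / n) * r) ^ p * X + Q) := by gcongr
      _ = (3 ^ (p - 1) * (2 * (12 * Real.pi * (4 / n) * r) ^ p)) * X + 3 ^ (p - 1) * Q := by ring
      _ ≤ 1 / 2 * X + 3 ^ (p - 1) * Q := by gcongr
      _ = _ := by ring
  have hfin : X ≤ X / 2 + 3 ^ (p - 1) * Q := csSup_le ⟨_, hmem⟩ hstep
  have := le_csSup hSb hmem
  rw [← hXdef] at this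
  linarith

/-! ### Absorption and the estimate for step functions -/

lemma continuous_norm_extension_stepFun_rpow {n : ℕ} (hn : 1 ≤ n) {p : ℝ} (hp : 0 ≤ p)
    (b : (Fin 2 → Fin n) → ℂ) :
    Continuous fun x ↦ ‖extension unitSquare (stepFun n b) x‖ ^ p := by
  simp_rw [extension_unitSquare hn]
  exact continuous_norm_sum_squareExt_rpow hp b Finset.univ

lemma integrableOn_ball_of_continuous {f : EuclideanSpace ℝ (Fin 3) → ℝ} (hf : Continuous f)
    (c : EuclideanSpace ℝ (Fin 3)) (r : ℝ) : IntegrableOn f (Metric.ball c r) :=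
  (hf.continuousOn.integrableOn_compact (isCompact_closedBall c r)).mono_set
    Metric.ball_subset_closedBall

/-- If the linear term in `step_inequality` can be absorbed, then step functions satisfy
an extension estimate. -/
lemma step_bound {W p : ℝ} (hW : 3 < W) (hp3 : 3 < p) (hp4 : p ≤ 4) :
    ∃ C : ℝ, 0 < C ∧ ∀ n M L : ℕ, 1 ≤ n → 1 ≤ M → n ^ 2 = M * L → ∀ κ : ℝ, 0 ≤ κ →
      (∀ pt : Finpartition (Finset.univ : Finset (Fin 2 → Fin n)),
        (∀ P ∈ pt.parts, P.card = M) → ∀ (c : EuclideanSpace ℝ (Fin 3))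
        (b : (Fin 2 → Fin n) → ℂ),
        ∫ x in Metric.ball c ((n : ℝ) ^ 2), ‖extension unitSquare (stepFun n b) x‖ ^ p
          ≤ κ * (L : ℝ) ^ (p / 2 - 1) * ∑ P ∈ pt.parts,
            ∫ x, ‖extension (ensemble n P) (stepFun n b) x‖ ^ p * ballWeight W ((n : ℝ) ^ 2) c x) →
      C * κ * (L : ℝ) ^ (-(p / 2)) ≤ 1 / 2 →
      ∀ (c : EuclideanSpace ℝ (Fin 3)) (b : (Fin 2 → Fin n) → ℂ), (∀ j, ‖b j‖ ≤ 1) →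
        ∫ x in Metric.ball c ((n : ℝ) ^ 2), ‖extension unitSquare (stepFun n b) x‖ ^ p ≤
          2 * (C * κ * ((n : ℝ) ^ (3 - p) + (L : ℝ) ^ (p / 2 - 1) * (n : ℝ) ^ (6 - 2 * p))) := by
  obtain ⟨C, hC, h⟩ := step_inequality hW hp3 hp4
  refine ⟨C, hC, fun n M L hn hM hML κ hκ hdec hsmall c b hb ↦ ?_⟩
  have hn' : (0 : ℝ) < n := by exact_mod_cast hn
  have hR : (0 : ℝ) < (n : ℝ) ^ 2 := by positivity
  -- The supremum over all centres and coefficients is finite by the trivial bound `|EF| ≤ 1`, so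
  -- half of it may be subtracted.
  set S : Set ℝ := {y | ∃ (c : EuclideanSpace ℝ (Fin 3)) (b : (Fin 2 → Fin n) → ℂ),
    (∀ j, ‖b j‖ ≤ 1) ∧
    y = ∫ x in Metric.ball c ((n : ℝ) ^ 2), ‖extension unitSquare (stepFun n b) x‖ ^ p} with hS
  have hSb : BddAbove S := by
    refine ⟨((n : ℝ) ^ 2) ^ 3 * unitBallVolume, ?_⟩
    rintro y ⟨c, b, hb, rfl⟩
    calc ∫ x in Metric.ball c ((n : ℝ) ^ 2), ‖extension unitSquare (stepFun n b) x‖ ^ p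
        ≤ ∫ _x in Metric.ball c ((n : ℝ) ^ 2), (1 : ℝ) := by
          refine setIntegral_mono (integrableOn_ball_of_continuous
            (continuous_norm_extension_stepFun_rpow hn (by linarith) b) c _)
            (integrableOn_const measure_ball_lt_top.ne) fun x ↦ ?_
          simp only [extension_unitSquare hn]
          exact Real.rpow_le_one (norm_nonneg _) (norm_sum_squareExt_le hb _ x) (by linarith)
      _ = ((n : ℝ) ^ 2) ^ 3 * unitBallVolume := by
          have := unitBallVolume_pos
          rw [setIntegral_const, smul_eq_mul, mul_one, measureReal_def, volume_ball_eq hR,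
            ENNReal.toReal_ofReal (by positivity)]
  have hle : ∀ (c : EuclideanSpace ℝ (Fin 3)) (b : (Fin 2 → Fin n) → ℂ), (∀ j, ‖b j‖ ≤ 1) →
      ∫ x in Metric.ball c ((n : ℝ) ^ 2), ‖extension unitSquare (stepFun n b) x‖ ^ p ≤ sSup S :=
    fun c b hb ↦ le_csSup hSb ⟨c, b, hb, rfl⟩
  set T := C * κ * ((n : ℝ) ^ (3 - p) + (L : ℝ) ^ (p / 2 - 1) * (n : ℝ) ^ (6 - 2 * p)) with hT
  have hQ0 : 0 ≤ sSup S := (integral_nonneg fun x ↦ by positivity).trans (hle c b hb)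
  have hsup : sSup S ≤ 1 / 2 * sSup S + T := by
    refine csSup_le ⟨_, c, b, hb, rfl⟩ ?_
    rintro y ⟨c, b, hb, rfl⟩
    refine (h n M L hn hM hML κ hκ hdec (sSup S) hle c b hb).trans ?_
    calc _ = C * κ * (L : ℝ) ^ (-(p / 2)) * sSup S + T := by rw [hT]; ring
      _ ≤ _ := by gcongr
  linarith [hle c b hb]

/-- Decoupling on a family `M ∼ R ^ ((4 - p) / (p - 2) + Δ)` implies an extension estimate for step
functions at the large scales of the family. -/
lemma family_bound {W p : ℝ} (hW : 3 < W) (hp3 : 3 < p) (hp4 : p ≤ 4) {Δ : ℝ} {A : Set (ℕ × ℕ)}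
    (hA : IsScaleFamily ((4 - p) / (p - 2) + Δ) A) (hdec : Decoupling W p A) {ε : ℝ} (hε : 0 < ε)
    (hε1 : ε < (1 - ((4 - p) / (p - 2) + Δ)) * (p / 2)) :
    ∃ (C : ℝ) (N : ℕ), 0 < C ∧ ∀ n M : ℕ, (n, M) ∈ A → N ≤ n →
      ∀ (c : EuclideanSpace ℝ (Fin 3)) (b : (Fin 2 → Fin n) → ℂ), (∀ j, ‖b j‖ ≤ 1) →
        ∫ x in Metric.ball c ((n : ℝ) ^ 2), ‖extension unitSquare (stepFun n b) x‖ ^ p ≤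
          C * ((n : ℝ) ^ (2 * ε) * ((n : ℝ) ^ (3 - p) + (n : ℝ) ^ (-(Δ * (p - 2))))) := by
  obtain ⟨C, hC, hstep⟩ := step_bound hW hp3 hp4
  obtain ⟨hA1, a, a', ha, ha', hA2⟩ := hA
  obtain ⟨K, hK⟩ := hdec ε hε
  set β := (4 - p) / (p - 2) + Δ with hβ
  set K' := max K 0 with hK'
  have hK0 : 0 ≤ K' := le_max_right _ _
  -- This identity is the source of the critical exponent: with `L ∼ n^{2(1-β)}`, the power of `n`
  -- in the last term vanishes exactly when `Δ = 0`.
  have hβp : 2 * (1 - β) * (p / 2 - 1) + (6 - 2 * p) = -(Δ * (p - 2)) := by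
    have : p - 2 ≠ 0 := by linarith
    rw [hβ]; field_simp; ring
  -- This sequence dominates the absorption coefficient `C κ L^{-p/2}`; `hε1` makes its exponent
  -- negative, and `N` is the scale beyond which it is at most `1/2`.
  have htend : Filter.Tendsto (fun n : ℕ ↦ C * K' * a' ^ (p / 2) *
      (n : ℝ) ^ (-(2 * ((1 - β) * (p / 2) - ε)))) Filter.atTop (nhds 0) := by
    have := ((tendsto_rpow_neg_atTop (y := 2 * ((1 - β) * (p / 2) - ε)) (by linarith)).comp
      tendsto_natCast_atTop_atTop).const_mul (C * K' * a' ^ (p / 2))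
    simpa [Function.comp_def] using this
  obtain ⟨N, hN⟩ := Filter.eventually_atTop.1
    (htend.eventually (ge_mem_nhds (by norm_num : (0 : ℝ) < 1 / 2)))
  refine ⟨2 * (C * K' + 1) * (1 + a⁻¹ ^ (p / 2 - 1)), N, by positivity, ?_⟩
  intro n M hnM hNn c b hb
  obtain ⟨hn, hdvd⟩ := hA1 _ hnM
  obtain ⟨hM1, hM2⟩ := hA2 _ hnM
  simp only at hn hdvd hM1 hM2
  obtain ⟨L, hL⟩ := hdvd
  have hn' : (0 : ℝ) < n := by exact_mod_cast hn
  have hnβ : ((n : ℝ) ^ 2) ^ β = (n : ℝ) ^ (2 * β) := by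
    rw [← Real.rpow_natCast, ← Real.rpow_mul hn'.le]; norm_num
  rw [hnβ] at hM1 hM2
  have hM0 : (0 : ℝ) < M := lt_of_lt_of_le (by positivity) hM1
  have hM : 1 ≤ M := by exact_mod_cast hM0
  have hLM : (M : ℝ) * L = (n : ℝ) ^ 2 := by exact_mod_cast hL.symm
  have hLe : (n : ℝ) ^ 2 / M = L := by rw [← hLM]; field_simp
  have hL0 : (0 : ℝ) < L := by rw [← hLe]; positivity
  have hn2 : (n : ℝ) ^ 2 = (n : ℝ) ^ (2 * (1 - β)) * (n : ℝ) ^ (2 * β) := by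
    rw [← Real.rpow_add hn', ← Real.rpow_natCast]; congr 1; push_cast; ring
  have hLup : (L : ℝ) ≤ a⁻¹ * (n : ℝ) ^ (2 * (1 - β)) := by
    rw [← hLe, div_le_iff₀ hM0, hn2]
    calc (n : ℝ) ^ (2 * (1 - β)) * (n : ℝ) ^ (2 * β)
        = a⁻¹ * (n : ℝ) ^ (2 * (1 - β)) * (a * (n : ℝ) ^ (2 * β)) := by field_simp
      _ ≤ _ := by gcongr
  have hLlow : a'⁻¹ * (n : ℝ) ^ (2 * (1 - β)) ≤ L := by
    rw [← hLe, le_div_iff₀ hM0, hn2]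
    calc a'⁻¹ * (n : ℝ) ^ (2 * (1 - β)) * M
        ≤ a'⁻¹ * (n : ℝ) ^ (2 * (1 - β)) * (a' * (n : ℝ) ^ (2 * β)) := by gcongr
      _ = _ := by field_simp
  set κ := K' * (n : ℝ) ^ (2 * ε) with hκ
  have hκ0 : 0 ≤ κ := by positivity
  have hnε : ((n : ℝ) ^ 2) ^ ε = (n : ℝ) ^ (2 * ε) := by
    rw [← Real.rpow_natCast, ← Real.rpow_mul hn'.le]; norm_num
  have hdec' : ∀ pt : Finpartition (Finset.univ : Finset (Fin 2 → Fin n)),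
        (∀ P ∈ pt.parts, P.card = M) → ∀ (c : EuclideanSpace ℝ (Fin 3))
        (b : (Fin 2 → Fin n) → ℂ),
        ∫ x in Metric.ball c ((n : ℝ) ^ 2), ‖extension unitSquare (stepFun n b) x‖ ^ p
          ≤ κ * (L : ℝ) ^ (p / 2 - 1) * ∑ P ∈ pt.parts,
            ∫ x, ‖extension (ensemble n P) (stepFun n b) x‖ ^ p * ballWeight W ((n : ℝ) ^ 2) c x := by
    intro pt hpt c b
    refine (hK n M hnM pt hpt c _ (integrableOn_stepFun n b)).trans ?_
    rw [hLe, hnε, hκ]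
    have hw := ballWeight_nonneg W (R := (n : ℝ) ^ 2) (by positivity) c
    refine mul_le_mul_of_nonneg_right ?_ (Finset.sum_nonneg fun P _ ↦ integral_nonneg fun x ↦
      mul_nonneg (by positivity) (hw x))
    gcongr
    exact le_max_left _ _
  have hsmall : C * κ * (L : ℝ) ^ (-(p / 2)) ≤ 1 / 2 := by
    refine le_trans ?_ (hN n hNn)
    have h1 : (L : ℝ) ^ (-(p / 2)) ≤ (a'⁻¹ * (n : ℝ) ^ (2 * (1 - β))) ^ (-(p / 2)) :=
      Real.rpow_le_rpow_of_nonpos (by positivity) hLlow (by linarith)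
    have h2 : (a'⁻¹ * (n : ℝ) ^ (2 * (1 - β))) ^ (-(p / 2)) =
        a' ^ (p / 2) * (n : ℝ) ^ (-(2 * (1 - β) * (p / 2))) := by
      rw [Real.mul_rpow (by positivity) (by positivity), Real.inv_rpow ha'.le,
        Real.rpow_neg ha'.le, inv_inv, ← Real.rpow_mul hn'.le]
      congr 2; ring
    have h3 : (n : ℝ) ^ (2 * ε) * (n : ℝ) ^ (-(2 * (1 - β) * (p / 2))) =
        (n : ℝ) ^ (-(2 * ((1 - β) * (p / 2) - ε))) := by
      rw [← Real.rpow_add hn']; congr 1; ring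
    calc C * κ * (L : ℝ) ^ (-(p / 2))
        ≤ C * κ * (a' ^ (p / 2) * (n : ℝ) ^ (-(2 * (1 - β) * (p / 2)))) := by
          rw [← h2]; gcongr
      _ = C * K' * a' ^ (p / 2) * ((n : ℝ) ^ (2 * ε) * (n : ℝ) ^ (-(2 * (1 - β) * (p / 2)))) := by
          rw [hκ]; ring
      _ ≤ _ := by rw [h3]
  refine (hstep n M L hn hM hL κ hκ0 hdec' hsmall c b hb).trans ?_
  have h1 : (L : ℝ) ^ (p / 2 - 1) * (n : ℝ) ^ (6 - 2 * p) ≤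
      a⁻¹ ^ (p / 2 - 1) * (n : ℝ) ^ (-(Δ * (p - 2))) := by
    rw [← hβp, Real.rpow_add hn', ← mul_assoc]
    gcongr
    calc (L : ℝ) ^ (p / 2 - 1) ≤ (a⁻¹ * (n : ℝ) ^ (2 * (1 - β))) ^ (p / 2 - 1) := by
          gcongr; linarith
      _ = _ := by
          rw [Real.mul_rpow (by positivity) (by positivity), ← Real.rpow_mul hn'.le]
  set Y := (n : ℝ) ^ (3 - p)
  set Z := (n : ℝ) ^ (-(Δ * (p - 2)))
  have hY : 0 ≤ Y := by positivity
  have hZ : 0 ≤ Z := by positivity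
  set s := a⁻¹ ^ (p / 2 - 1)
  have hs : 0 ≤ s := by positivity
  calc 2 * (C * κ * (Y + (L : ℝ) ^ (p / 2 - 1) * (n : ℝ) ^ (6 - 2 * p)))
      ≤ 2 * (C * κ * (Y + s * Z)) := by gcongr
    _ = 2 * (C * K') * ((n : ℝ) ^ (2 * ε) * (Y + s * Z)) := by rw [hκ]; ring
    _ ≤ 2 * (C * K' + 1) * ((n : ℝ) ^ (2 * ε) * ((1 + s) * Y + (1 + s) * Z)) := by
        gcongr
        · linarith
        · exact le_mul_of_one_le_left hY (by linarith)
        · linarith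
    _ = _ := by ring

/-! ### Failure of decoupling above the critical exponent -/

/-- The extension of the constant function one is bounded below near the origin. -/
lemma half_le_norm_extension_one {n : ℕ} (hn : 1 ≤ n) {x : EuclideanSpace ℝ (Fin 3)}
    (hx : ‖x‖ ≤ 1 / 100) :
    1 / 2 ≤ ‖extension unitSquare (stepFun n fun _ ↦ 1) x‖ := by
  have e : extension unitSquare (stepFun n fun _ ↦ 1) x = extension unitSquare (fun _ ↦ 1) x := by
    have i1 := integrableOn_extension_integrand (integrableOn_stepFun n fun _ ↦ 1) x
    have i2 := integrableOn_extension_integrand (S := unitSquare) (F := fun _ ↦ 1)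
      (integrableOn_const isCompact_unitSquare.measure_lt_top.ne) x
    unfold extension
    rw [integral_unitSquare_eq_sum hn i1, integral_unitSquare_eq_sum hn i2]
    refine Finset.sum_congr rfl fun j _ ↦ ?_
    refine setIntegral_congr_fun (measurableSet_halfOpenSquare n j) fun ξ hξ ↦ ?_
    simp only [stepFun_of_mem hξ]
  rw [e]
  have hdiff : ‖extension unitSquare (fun _ ↦ 1) x - 1‖ ≤ 1 / 2 := by
    have h1 : (1 : ℂ) = ∫ _ξ in unitSquare, (1 : ℂ) := by
      rw [setIntegral_const, volume_unitSquare, one_smul]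
    have i2 := integrableOn_extension_integrand (S := unitSquare) (F := fun _ ↦ 1)
      (integrableOn_const isCompact_unitSquare.measure_lt_top.ne) x
    have i1 : IntegrableOn (fun _ ↦ (1 : ℂ)) unitSquare :=
      integrableOn_const isCompact_unitSquare.measure_lt_top.ne
    have h3 : extension unitSquare (fun _ ↦ 1) x - 1 = ∫ ξ in unitSquare, (1 * Complex.exp
        (2 * Real.pi * Complex.I * ((ξ 0 * x 0 + ξ 1 * x 1 + ‖ξ‖ ^ 2 * x 2 : ℝ) : ℂ)) - 1) := by
      rw [integral_sub i2 i1, ← h1, extension]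
    rw [h3]
    refine (norm_setIntegral_le_of_norm_le_const (C := 1 / 2) isCompact_unitSquare.measure_lt_top
      fun ξ hξ ↦ ?_).trans (by rw [volume_unitSquare]; norm_num)
    rw [one_mul]
    set θ : ℝ := ξ 0 * x 0 + ξ 1 * x 1 + ‖ξ‖ ^ 2 * x 2 with hθ
    have hθb : |θ| ≤ 4 / 100 := by
      have hc : ∀ i, |x i| ≤ 1 / 100 := fun i ↦ (abs_coord_le_norm x i).trans hx
      have hb : ∀ i, |ξ i| ≤ 1 := fun i ↦ by
        rw [abs_le]; exact ⟨by linarith [(hξ i).1], (hξ i).2⟩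
      have hb2 : |‖ξ‖ ^ 2| ≤ 2 := by
        rw [abs_of_nonneg (by positivity), EuclideanSpace.real_norm_sq_eq, Fin.sum_univ_two]
        nlinarith [(hξ 0).1, (hξ 0).2, (hξ 1).1, (hξ 1).2]
      calc |θ| ≤ |ξ 0 * x 0| + |ξ 1 * x 1| + |‖ξ‖ ^ 2 * x 2| := abs_add_three _ _ _
        _ ≤ 1 * (1 / 100) + 1 * (1 / 100) + 2 * (1 / 100) := by
            rw [abs_mul, abs_mul, abs_mul]
            gcongr
            exacts [hb 0, hc 0, hb 1, hc 1, hc 2]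
        _ = 4 / 100 := by norm_num
    have h2 : 2 * Real.pi * Complex.I * (θ : ℂ) = Complex.I * ((2 * Real.pi * θ : ℝ) : ℂ) := by
      push_cast; ring
    rw [h2]
    refine (Real.norm_exp_I_mul_ofReal_sub_one_le).trans ?_
    rw [Real.norm_eq_abs, abs_mul, abs_of_pos (by positivity : 0 < 2 * Real.pi)]
    nlinarith [Real.pi_lt_d2, Real.pi_pos, abs_nonneg θ]
  have := norm_sub_norm_le (1 : ℂ) (1 - extension unitSquare (fun _ ↦ 1) x)
  rw [sub_sub_cancel, norm_one, norm_sub_rev] at this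
  linarith

lemma exists_lower_bound {p : ℝ} (hp : 0 ≤ p) : ∃ c₀ : ℝ, 0 < c₀ ∧ ∀ n : ℕ, 1 ≤ n →
    c₀ ≤ ∫ x in Metric.ball 0 ((n : ℝ) ^ 2), ‖extension unitSquare (stepFun n fun _ ↦ 1) x‖ ^ p := by
  have hv := unitBallVolume_pos
  refine ⟨(1 / 100) ^ 3 * unitBallVolume * (1 / 2) ^ p, by positivity, fun n hn ↦ ?_⟩
  have hn' : (1 : ℝ) ≤ n := by exact_mod_cast hn
  have hcont := continuous_norm_extension_stepFun_rpow hn hp fun _ ↦ 1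
  calc (1 / 100) ^ 3 * unitBallVolume * (1 / 2) ^ p
      = ∫ _x in Metric.ball (0 : EuclideanSpace ℝ (Fin 3)) (1 / 100), ((1 : ℝ) / 2) ^ p := by
        rw [setIntegral_const, measureReal_def, volume_ball_eq (by norm_num),
          ENNReal.toReal_ofReal (by positivity), smul_eq_mul]
    _ ≤ ∫ x in Metric.ball 0 (1 / 100), ‖extension unitSquare (stepFun n fun _ ↦ 1) x‖ ^ p := by
        refine setIntegral_mono_on (integrableOn_const measure_ball_lt_top.ne)
          (integrableOn_ball_of_continuous hcont 0 _) measurableSet_ball fun x hx ↦ ?_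
        gcongr
        exact half_le_norm_extension_one hn (mem_ball_zero_iff.1 hx).le
    _ ≤ _ := by
        refine setIntegral_mono_set (integrableOn_ball_of_continuous hcont 0 _)
          (Filter.Eventually.of_forall fun x ↦ by positivity)
          (Filter.Eventually.of_forall (Metric.ball_subset_ball ?_))
        nlinarith

lemma not_decoupling {W p : ℝ} (hW : 3 < W) (hp3 : 3 < p) (hp4 : p ≤ 4) {Δ : ℝ} (hΔ : 0 < Δ)
    (hΔ1 : (4 - p) / (p - 2) + Δ < 1) {A : Set (ℕ × ℕ)}
    (hA : IsScaleFamily ((4 - p) / (p - 2) + Δ) A) (hlarge : ∀ N : ℕ, ∃ q ∈ A, N ≤ q.1) :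
    ¬ Decoupling W p A := by
  intro hdec
  set β := (4 - p) / (p - 2) + Δ with hβ
  -- The first bound permits absorption; the other two make both powers `n^{2ε+3-p}` and
  -- `n^{2ε-Δ(p-2)}` tend to zero.
  obtain ⟨ε, hε, hεlt⟩ : ∃ ε : ℝ, 0 < ε ∧
      ε < min ((1 - β) * (p / 2)) (min ((p - 3) / 2) (Δ * (p - 2) / 2)) := by
    refine exists_between ?_
    have h1 : 0 < (1 - β) * (p / 2) := mul_pos (by linarith) (by linarith)
    have h2 : 0 < Δ * (p - 2) / 2 := by
      have : 0 < p - 2 := by linarith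
      positivity
    exact lt_min h1 (lt_min (by linarith) h2)
  obtain ⟨hε1, hε2⟩ := lt_min_iff.1 hεlt
  obtain ⟨hε2, hε3⟩ := lt_min_iff.1 hε2
  obtain ⟨C, N, hC, hbound⟩ := family_bound hW hp3 hp4 hA hdec hε hε1
  obtain ⟨c₀, hc₀, hlow⟩ := exists_lower_bound (p := p) (by linarith)
  have htend : Filter.Tendsto (fun n : ℕ ↦ C * ((n : ℝ) ^ (-(p - 3 - 2 * ε)) +
      (n : ℝ) ^ (-(Δ * (p - 2) - 2 * ε)))) Filter.atTop (nhds 0) := by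
    have t1 := (tendsto_rpow_neg_atTop (y := p - 3 - 2 * ε) (by linarith)).comp
      (tendsto_natCast_atTop_atTop (R := ℝ))
    have t2 := (tendsto_rpow_neg_atTop (y := Δ * (p - 2) - 2 * ε) (by linarith)).comp
      (tendsto_natCast_atTop_atTop (R := ℝ))
    simpa [Function.comp_def] using (t1.add t2).const_mul C
  obtain ⟨N', hN'⟩ := Filter.eventually_atTop.1 (htend.eventually (gt_mem_nhds hc₀))
  obtain ⟨⟨n, M⟩, hq, hNq⟩ := hlarge (max N N')
  simp only at hNq
  have hn : 1 ≤ n := (hA.1 _ hq).1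
  have hn' : (0 : ℝ) < n := by exact_mod_cast hn
  have h1 := hbound n M hq ((le_max_left _ _).trans hNq) 0 (fun _ ↦ 1) (by simp)
  have h2 := hN' n ((le_max_right _ _).trans hNq)
  have h3 := hlow n hn
  have e : (n : ℝ) ^ (2 * ε) * ((n : ℝ) ^ (3 - p) + (n : ℝ) ^ (-(Δ * (p - 2)))) =
      (n : ℝ) ^ (-(p - 3 - 2 * ε)) + (n : ℝ) ^ (-(Δ * (p - 2) - 2 * ε)) := by
    rw [mul_add, ← Real.rpow_add hn', ← Real.rpow_add hn']
    congr 2 <;> ring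
  rw [e] at h1
  linarith

/-! ### The restriction conjecture at the critical exponent -/

/-- A bounded function may be modulated and renormalized so that a ball with any centre becomes a
ball centred at the origin. -/
lemma exists_normalized {F : EuclideanSpace ℝ (Fin 2) → ℂ}
    (hF : MemLp F ⊤ (volume.restrict unitSquare)) (c : EuclideanSpace ℝ (Fin 3)) :
    ∃ G : EuclideanSpace ℝ (Fin 2) → ℂ, Measurable G ∧ (∀ ξ, ‖G ξ‖ ≤ 1) ∧
      ∀ y, extension unitSquare F (y + c) =
        ((eLpNorm F ⊤ (volume.restrict unitSquare)).toReal : ℂ) * extension unitSquare G y := by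
  set N := (eLpNorm F ⊤ (volume.restrict unitSquare)).toReal with hN
  have hae : ∀ᵐ ξ ∂(volume.restrict unitSquare), ‖F ξ‖ ≤ N := by
    have := ae_le_eLpNormEssSup (f := F) (μ := volume.restrict unitSquare)
    filter_upwards [this] with ξ hξ
    rw [← eLpNorm_exponent_top] at hξ
    rw [hN, ← toReal_enorm]
    exact ENNReal.toReal_mono hF.eLpNorm_lt_top.ne hξ
  obtain ⟨g, hgs, hFg⟩ := hF.aestronglyMeasurable
  have hgm : Measurable g := hgs.measurable
  refine ⟨fun ξ ↦ {ξ | ‖g ξ‖ ≤ N}.indicator (fun ξ ↦ g ξ / (N : ℂ)) ξ *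
    Complex.exp (2 * Real.pi * Complex.I * ((ξ 0 * c 0 + ξ 1 * c 1 + ‖ξ‖ ^ 2 * c 2 : ℝ) : ℂ)),
    ?_, fun ξ ↦ ?_, fun y ↦ ?_⟩
  · refine Measurable.mul (Measurable.indicator (hgm.div_const _)
      (measurableSet_le hgm.norm measurable_const)) (by fun_prop)
  · rw [norm_mul, norm_exp_two_pi, mul_one]
    by_cases h : ‖g ξ‖ ≤ N
    · rw [Set.indicator_of_mem (by exact h), norm_div, Complex.norm_real, Real.norm_eq_abs,
        abs_of_nonneg ENNReal.toReal_nonneg]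
      exact div_le_one_of_le₀ h ENNReal.toReal_nonneg
    · rw [Set.indicator_of_notMem (by exact h)]; simp
  · unfold extension
    rw [← integral_const_mul]
    refine integral_congr_ae ?_
    filter_upwards [hae, hFg] with ξ h1 h2
    have hgN : ‖g ξ‖ ≤ N := by rw [← h2]; exact h1
    have hNg : (N : ℂ) * (g ξ / N) = g ξ := by
      -- If the essential supremum vanishes, division by zero makes the normalized function zero, in
      -- agreement with `g ξ = 0`.
      rcases eq_or_ne N 0 with h | h
      · rw [h] at hgN
        rw [norm_le_zero_iff.1 hgN]; simp
      · have : (N : ℂ) ≠ 0 := by exact_mod_cast h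
        field_simp
    rw [Set.indicator_of_mem (by exact hgN), ← mul_assoc, ← mul_assoc, hNg, h2,
      mul_assoc (g ξ) (Complex.exp _), ← Complex.exp_add]
    congr 2
    simp only [PiLp.add_apply]
    push_cast
    ring

lemma integral_ball_eq_ball_zero (f : EuclideanSpace ℝ (Fin 3) → ℝ) (c : EuclideanSpace ℝ (Fin 3))
    (r : ℝ) : ∫ x in Metric.ball c r, f x = ∫ y in Metric.ball 0 r, f (y + c) := by
  have h := (measurePreserving_add_right (volume : Measure (EuclideanSpace ℝ (Fin 3))) c)
    |>.setIntegral_preimage_emb (measurableEmbedding_addRight c) f (Metric.ball c r)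
  rw [← h]
  congr 2
  ext y
  simp [Metric.mem_ball, dist_eq_norm]

lemma restrictionConjecture_of_decoupling {W p : ℝ} (hW : 3 < W) (hp3 : 3 < p) (hp4 : p ≤ 4)
    {A : Set (ℕ × ℕ)} (hA : IsScaleFamily ((4 - p) / (p - 2)) A)
    (hscales : ∃ D : ℝ, ∀ R : ℝ, 1 ≤ R → ∃ q ∈ A, R ≤ (q.1 : ℝ) ^ 2 ∧ (q.1 : ℝ) ^ 2 ≤ D * R)
    (hdec : Decoupling W p A) : RestrictionConjecture p := by
  intro ε hε
  obtain ⟨D, hD⟩ := hscales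
  have hβ1 : (4 - p) / (p - 2) + 0 < 1 := by
    rw [add_zero, div_lt_one (by linarith)]; linarith
  rw [← add_zero ((4 - p) / (p - 2))] at hA
  obtain ⟨ε', hε', hlt⟩ : ∃ ε' : ℝ, 0 < ε' ∧
      ε' < min ε ((1 - ((4 - p) / (p - 2) + 0)) * (p / 2)) :=
    exists_between (lt_min hε (mul_pos (by linarith) (by linarith)))
  obtain ⟨hε1, hε2⟩ := lt_min_iff.1 hlt
  obtain ⟨C, N, hC, hbound⟩ := family_bound hW hp3 hp4 hA hdec hε' hε2
  set D' : ℝ := D * (1000 ^ 2 + (N : ℝ) ^ 2) with hD'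
  refine ⟨2 * 3 ^ (p - 1) * (2 * C * D' ^ ε'), fun R hR c F hF ↦ ?_⟩
  have hR0 : 0 < R := by linarith
  -- The scale is enlarged by constants so that both `n ≥ 1000 √R`, for the reduction to step
  -- functions, and `n ≥ N`, for absorption, hold. `D'` keeps `n² ≤ D' R`.
  obtain ⟨⟨n, M⟩, hq, hq1, hq2⟩ := hD (1000 ^ 2 * R + (N : ℝ) ^ 2) (by nlinarith [sq_nonneg (N : ℝ)])
  simp only at hq1 hq2
  have hn : 1 ≤ n := (hA.1 _ hq).1
  have hn' : (0 : ℝ) < n := by exact_mod_cast hn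
  have hn1 : (1 : ℝ) ≤ n := by exact_mod_cast hn
  have hNn : N ≤ n := by
    have : (N : ℝ) ^ 2 ≤ (n : ℝ) ^ 2 := by nlinarith
    exact_mod_cast (pow_le_pow_iff_left₀ (by positivity) (by positivity) two_ne_zero).1 this
  have hsq := Real.sq_sqrt hR0.le
  have hr0 : 0 < Real.sqrt R := Real.sqrt_pos.2 hR0
  have hrn : 1000 * Real.sqrt R ≤ n := by
    refine (pow_le_pow_iff_left₀ (by positivity) (by positivity) two_ne_zero).1 ?_
    rw [mul_pow, hsq]
    nlinarith [sq_nonneg (N : ℝ)]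
  have hD0 : 0 ≤ D := by
    by_contra h
    have : D * (1000 ^ 2 * R + (N : ℝ) ^ 2) ≤ 0 :=
      mul_nonpos_of_nonpos_of_nonneg (not_le.1 h).le (by positivity)
    have : (0 : ℝ) < (n : ℝ) ^ 2 := by positivity
    linarith
  have hnR : (n : ℝ) ^ 2 ≤ D' * R := by
    refine hq2.trans ?_
    rw [hD', mul_assoc]
    gcongr
    nlinarith [sq_nonneg (N : ℝ)]
  have hnε : (n : ℝ) ^ (2 * ε') ≤ D' ^ ε' * R ^ ε := by
    calc (n : ℝ) ^ (2 * ε') = ((n : ℝ) ^ 2) ^ ε' := by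
          rw [← Real.rpow_natCast, ← Real.rpow_mul hn'.le]; norm_num
      _ ≤ (D' * R) ^ ε' := by gcongr
      _ = D' ^ ε' * R ^ ε' := Real.mul_rpow (by positivity) hR0.le
      _ ≤ D' ^ ε' * R ^ ε := by
          gcongr
  have hstep : ∀ b : (Fin 2 → Fin n) → ℂ, (∀ j, ‖b j‖ ≤ 1) →
      ∫ x in Metric.ball 0 (Real.sqrt R), ‖extension unitSquare (stepFun n b) x‖ ^ p ≤
        2 * C * D' ^ ε' * R ^ ε := by
    intro b hb
    have hcont := continuous_norm_extension_stepFun_rpow hn (by linarith : 0 ≤ p) b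
    calc ∫ x in Metric.ball 0 (Real.sqrt R), ‖extension unitSquare (stepFun n b) x‖ ^ p
        ≤ ∫ x in Metric.ball 0 ((n : ℝ) ^ 2), ‖extension unitSquare (stepFun n b) x‖ ^ p := by
          refine setIntegral_mono_set (integrableOn_ball_of_continuous hcont 0 _)
            (Filter.Eventually.of_forall fun x ↦ by positivity)
            (Filter.Eventually.of_forall (Metric.ball_subset_ball ?_))
          nlinarith
      -- `family_bound` is used with `Δ = 0`, so the second power of `n` is one and the first is at
      -- most one.
      _ ≤ C * ((n : ℝ) ^ (2 * ε') * ((n : ℝ) ^ (3 - p) + (n : ℝ) ^ (-(0 * (p - 2))))) :=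
          hbound n M hq hNn 0 b hb
      _ ≤ C * ((D' ^ ε' * R ^ ε) * (1 + 1)) := by
          gcongr
          · exact Real.rpow_le_one_of_one_le_of_nonpos hn1 (by linarith)
          · simp
      _ = _ := by ring
  obtain ⟨G, hG, hGB, hGF⟩ := exists_normalized hF c
  have hmain := integral_extension_le_of_step (p := p) (by linarith) hr0 hrn hstep hG hGB
  set E := (eLpNorm F ⊤ (volume.restrict unitSquare)).toReal with hE
  have hE0 : 0 ≤ E := ENNReal.toReal_nonneg
  rw [integral_ball_eq_ball_zero]
  calc ∫ y in Metric.ball 0 (Real.sqrt R), ‖extension unitSquare F (y + c)‖ ^ p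
      = E ^ p * ∫ y in Metric.ball 0 (Real.sqrt R), ‖extension unitSquare G y‖ ^ p := by
        rw [← integral_const_mul]
        congr 1
        funext y
        rw [hGF, norm_mul, Complex.norm_real, Real.norm_eq_abs, abs_of_nonneg hE0,
          Real.mul_rpow hE0 (norm_nonneg _)]
    _ ≤ E ^ p * (2 * 3 ^ (p - 1) * (2 * C * D' ^ ε' * R ^ ε)) := by gcongr
    _ = _ := by ring

end LargeEnsemble

theorem corollary2p3 (W : ℝ) (hW : 3 < W) (p : ℝ) (hp3 : 3 < p) (hp4 : p ≤ 4) :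
    (∀ A : Set (ℕ × ℕ),
        LargeEnsemble.IsScaleFamily ((4 - p) / (p - 2)) A →
        (∃ D : ℝ, ∀ R : ℝ, 1 ≤ R → ∃ q ∈ A, R ≤ (q.1 : ℝ) ^ 2 ∧ (q.1 : ℝ) ^ 2 ≤ D * R) →
        LargeEnsemble.Decoupling W p A →
        LargeEnsemble.RestrictionConjecture p) ∧
    (∀ Δ : ℝ, 0 < Δ → (4 - p) / (p - 2) + Δ < 1 →
      ∀ A : Set (ℕ × ℕ),
        LargeEnsemble.IsScaleFamily ((4 - p) / (p - 2) + Δ) A →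
        (∀ N : ℕ, ∃ q ∈ A, N ≤ q.1) →
        ¬ LargeEnsemble.Decoupling W p A) :=
  ⟨fun _ hA hscales hdec ↦
      LargeEnsemble.restrictionConjecture_of_decoupling hW hp3 hp4 hA hscales hdec,
    fun _ hΔ hΔ1 _ hA hlarge ↦ LargeEnsemble.not_decoupling hW hp3 hp4 hΔ hΔ1 hA hlarge⟩
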